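/- Definitions. A polyhedron is a finite intersection of closed half-spaces in $\mathbb R^3$; its vertices are its extreme points. For a unit vector $v$, the shadow of $P$ in direction $v$ is its orthogonal projection to the plane $v^\perp$, and $\mathfrak s(P)$ is the maximum over all $v\in\mathbb S^2$ of the number of vertices of the shadow. For $n\ge 0$ let $\mathfrak s_u(n)$ be the minimum of $\mathfrak s(P)$ over all polyhedra $P$ (bounded or unbounded) with nonempty interior and exactly $n$ vertices. For $x\in P$, let $D(x;P)\subset\mathbb S^2$ be the set of outward unit normals of the planes supporting $P$ at $x$; for a face $F$ of $P$ let $D(F;P)=\bigcap_{x\in F}D(x;P)$; and let $\mathcal D_\sigma(P)=\{\operatorname{int}D(x;P): x \text{ a vertex of }P\}$, interiors being taken in $\mathbb S^2$. For a finite family $\mathcal D$ of pairwise disjoint open regions of $\mathbb S^2$, let $\mathcal D'$ be $\mathcal D$ together with the exterior region $\mathbb S^2\setminus\bigcup_{T\in\mathcal D}\overline T$ (if nonempty). Consider the nonempty intersections of the closures of two or more members of $\mathcal D'$. Those that are single points are the vertices of $\mathcal D$, and the others are the closed edges of $\mathcal D$. For $n\ge 6$ and $0<r<R$, consider two concentric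 homothetic regular $(n-1)$-gons in the plane, centred at the origin, of circumradii $r$ and $R$. The inner region is the interior of the smaller polygon. The $n-1$ ring regions are the interiors of the quadrilaterals spanned by pairs of corresponding edges of the two polygons. Call the ring thin if every straight line meets at most four ring regions. Identify the plane with $\{x_3=-1\}\subset\mathbb R^3$, its origin with $(0,0,-1)$, and let $\mathcal D_n$ be the family of the $n$ preimages of the inner region and the ring regions under central (gnomonic) projection of the open lower hemisphere from the origin of $\mathbb R^3$ to this plane. Let $P_n$ be the intersection, over the vertices $v$ of $\mathcal D_n$, of the half-spaces $\{x:\langle v,x\rangle\le 1\}$, which contain $\mathbb S^2$ and are bounded by its tangent plane at $v$. Theorem. (a) $\mathfrak s_u(n)=\Theta(1)$ as $n\to\infty$, and $\mathfrak s_u(n)\le 5$ for all $n$. (b) Let $n\ge 6$ and $R>0$. The ring is thin for all $r<R$ sufficiently close to $R$. Whenever $0<r<R$ and the ring is thin, $P_n$ is an unbounded polyhedron with nonempty interior and exactly $n$ vertices, $\mathcal D_\sigma(P_n)=\mathcal D_n$, and $\mathfrak s(P_n)=5$. Moreover $x\mapsto D(x;P_n)$ is a bijection from the vertices of $P_n$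 onto the closures of the regions of $\mathcal D_n$; $F\mapsto D(F;P_n)$ is a bijection from the (bounded and unbounded) edges of $P_n$ onto the closed edges of $\mathcal D_n$, and from the two-dimensional faces of $P_n$ onto the singletons $\{v\}$ with $v$ a vertex of $\mathcal D_n$. -/

import Mathlib

open Set Filter Topology Asymptotics

noncomputable section

namespace ShadowProblem

/-- Euclidean three-space. -/
abbrev E3 := EuclideanSpace ℝ (Fin 3)

/-- The Euclidean plane. -/
abbrev E2 := EuclideanSpace ℝ (Fin 2)

/-- The unit sphere in three-space, with its subspace topology. -/
abbrev S2 := Metric.sphere (0 : E3) 1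

/-! ### Polyhedra and shadow numbers -/

/-- A polyhedron (bounded or not): a finite intersection of closed half-spaces. -/
def IsPolyhedron (P : Set E3) : Prop :=
  ∃ s : Finset (E3 × ℝ), (∀ h ∈ s, h.1 ≠ 0) ∧ P = {x | ∀ h ∈ s, inner ℝ h.1 x ≤ h.2}

/-- The vertices of a polyhedron, or of a polygon lying in a plane of three-space: its extreme
points. -/
abbrev polyVertices (P : Set E3) : Set E3 := P.extremePoints ℝ

/-- The shadow of `P` in direction `v`: the orthogonal projection of `P` onto the plane `v⊥`. -/
def shadow (v : S2) (P : Set E3) : Set E3 :=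
  (Submodule.span ℝ {(v : E3)})ᗮ.starProjection '' P

/-- The shadow number of `P` in direction `v`: the number of vertices of the shadow polygon. -/
def shadowNumberAt (v : S2) (P : Set E3) : ℕ∞ := (polyVertices (shadow v P)).encard

/-- The shadow number of `P`: the maximum over all directions (a supremum in `ℕ∞` is attained
whenever its value is finite). -/
def shadowNumber (P : Set E3) : ℕ∞ := ⨆ v : S2, shadowNumberAt v P

/-- The three-dimensional (bounded or unbounded) polyhedra with exactly `n` vertices. -/
def polyhedraWithVertices (n : ℕ) : Set (Set E3) :=
  {P | IsPolyhedron P ∧ (interior P).Nonempty ∧ (polyVertices P).encard = n}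

/-- The unbounded `n`-vertex shadow number: the minimum of the shadow number over all
three-dimensional polyhedra with exactly `n` vertices, unbounded ones allowed
(`⊤` if there were none). -/
def unboundedShadowNumber (n : ℕ) : ℕ∞ := ⨅ P ∈ polyhedraWithVertices n, shadowNumber P

/-! ### Faces and spherical images -/

/-- The faces of dimension `d` of a polyhedron, as exposed subsets: the edges (bounded or
unbounded) for `d = 1`, the two-dimensional faces for `d = 2`. -/
def facesOfDim (d : ℕ) (P : Set E3) : Set (Set E3) :=
  {F | IsExposed ℝ P F ∧ Module.finrank ℝ (vectorSpan ℝ F) = d}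

/-- The spherical image of a point `x` of `P`: the outward unit normals of the planes that
support `P` at `x`. -/
def sphericalImageAt (P : Set E3) (x : E3) : Set S2 :=
  {u | x ∈ P ∧ ∀ y ∈ P, inner ℝ (u : E3) y ≤ inner ℝ (u : E3) x}

/-- The spherical image of a face `F` of `P`: the outward unit normals of the supporting planes
of `P` that contain `F`. -/
def sphericalImageOfFace (P F : Set E3) : Set S2 :=
  {u | ∀ x ∈ F, u ∈ sphericalImageAt P x}

/-- The spherical image subdivision of a polyhedron: the interiors (in the sphere) of the
spherical images of its vertices. -/
def sphericalImageSubdivision (P : Set E3) : Set (Set S2) :=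
  (fun x => interior (sphericalImageAt P x)) '' polyVertices P

/-! ### Spherical subdivisions -/

/-- The completed subdivision: the regions of `D`, together with the exterior region, the
complement of the union of their closures, if that is not empty. -/
def completedSubdivision (D : Set (Set S2)) : Set (Set S2) :=
  {S | S ∈ D ∨ (S = (⋃ T ∈ D, closure T)ᶜ ∧ S.Nonempty)}

/-- The common boundary pieces of a subdivision: the nonempty intersections of the closures of
at least two regions of the completed subdivision. -/
def boundaryPieces (D : Set (Set S2)) : Set (Set S2) :=
  {A | A.Nonempty ∧ ∃ F ⊆ completedSubdivision D, F.Nontrivial ∧ A = ⋂ S ∈ F, closure S}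

/-- The vertices of a subdivision: the boundary pieces that are points. -/
def subdivisionVertices (D : Set (Set S2)) : Set S2 :=
  {v | {v} ∈ boundaryPieces D}

/-- The closed edges of a subdivision: the boundary pieces with more than one point. (The edges
themselves are the relative interiors of these closed arcs.) -/
def subdivisionClosedEdges (D : Set (Set S2)) : Set (Set S2) :=
  {A | A ∈ boundaryPieces D ∧ A.Nontrivial}

/-! ### The subdivision of a regular polygon and its pull-back to the sphere -/

/-- The vertices of the regular `m`-gon with centre `0`, circumradius `ρ` and phase `φ`,
indexed periodically. -/
def gonVertex (m : ℕ) (φ ρ : ℝ) (k : ℕ) : E2 :=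
  !₂[ρ * Real.cos (φ + 2 * Real.pi * k / m), ρ * Real.sin (φ + 2 * Real.pi * k / m)]

/-- The inner region: the interior of the regular `m`-gon with circumradius `r`. -/
def innerRegion (m : ℕ) (φ r : ℝ) : Set E2 :=
  interior (convexHull ℝ (range (gonVertex m φ r)))

/-- The `k`-th ring region: the interior of the quadrilateral spanned by the corresponding `k`-th
edges of the two concentric regular `m`-gons with circumradii `r` and `R`. -/
def ringRegion (m : ℕ) (φ r R : ℝ) (k : ℕ) : Set E2 :=
  interior (convexHull ℝ {gonVertex m φ r k, gonVertex m φ r (k + 1),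
    gonVertex m φ R k, gonVertex m φ R (k + 1)})

/-- The ring regions. -/
def ringRegions (m : ℕ) (φ r R : ℝ) : Set (Set E2) := range (ringRegion m φ r R)

/-- The ring is thin: every straight line meets at most four ring regions. -/
def IsThinRing (m : ℕ) (φ r R : ℝ) : Prop :=
  ∀ L : AffineSubspace ℝ E2, Module.finrank ℝ L.direction = 1 →
    {S ∈ ringRegions m φ r R | ((L : Set E2) ∩ S).Nonempty}.encard ≤ 4

/-- Central (gnomonic) projection of the open lower hemisphere to the plane `x₃ = -1`, in the
coordinates `(x₁, x₂)` of that plane. Only used where `u 2 < 0`. -/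
def gnomonic (u : S2) : E2 :=
  !₂[-((u : E3) 0 / (u : E3) 2), -((u : E3) 1 / (u : E3) 2)]

/-- The pull-back of a planar set to the open lower hemisphere. -/
def gnomonicPullback (A : Set E2) : Set S2 :=
  {u | (u : E3) 2 < 0 ∧ gnomonic u ∈ A}

/-- The spherical subdivision with `n` regions: the pull-back of the inner region and of the
`n - 1` ring regions of the regular `(n-1)`-gon with circumradius `R`. -/
def ringSubdivision (n : ℕ) (φ r R : ℝ) : Set (Set S2) :=
  gnomonicPullback '' insert (innerRegion (n - 1) φ r) (ringRegions (n - 1) φ r R)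

/-- The intersection, over the vertices `v` of a spherical subdivision, of the half-spaces that
contain the sphere and are bounded by its tangent plane at `v`. -/
def tangentPolyhedron (D : Set (Set S2)) : Set E3 :=
  {x | ∀ v ∈ subdivisionVertices D, inner ℝ (v : E3) x ≤ 1}

end ShadowProblem

end

open ShadowProblem

noncomputable section

namespace ShadowProblem

/-! ### Directions of a regular polygon -/

/-! Apart from degenerate positions, the vertices of the shadow in direction `v` correspond to the
regions of the spherical image crossed by the great circle orthogonal to `v`, and central projection
turns great circles into straight lines. So it suffices to realise, as the spherical image of a
polyhedron, a planar subdivision with many regions of which every line crosses few. A thin ring of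
cells around a convex region is one: a line crosses at most four ring cells, plus the inner region,
which makes five. Its union covers only part of a hemisphere, whence the unboundedness.

That the tangent polyhedron (`cap`) realises the subdivision is a computation of its support
function. Represent downward normals by `(y, -1)`, with functional `val y`, and let `g` be the gauge
equal to `α + β` at `y = α • dir k + β • dir (k + 1)`. The support function is constant, `√(1 +
r²)`, where `g ≤ r`; it is `√(1 + r²) + slope * (g - r)` where `r ≤ g ≤ R`; it is infinite beyond,
because of the recession directions `ray`. It is thus affine on each cell, and its affine pieces are
the vertices `apex` and `ringVertex k`. The decisive identity is `val_combination`: over a ring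
cell, a positive multiple of the gap between this function and `val y p` is a combination of the
slacks of `p` at the four corners of the cell, with nonnegative weights. Hence `y` supports at `p`
exactly when the slacks with nonzero weight vanish (`mem_sphericalImageAt_iff`). Together with
`val_le_apex` over the inner polygon, this yields the spherical images and the list of vertices, and
it classifies the support sets, hence the edges and facets (`supportSet_cases`).

Thinness near `R` holds because the line carrying an inner edge separates its cell from all
non-adjacent cells (`inner_mid_lt_of_far`). Among three cells met in order by a line, the middle one
is therefore adjacent to one of the others, which is impossible throughout a set of five cells
(`not_five_of_adjacency`).

For the upper bound 5, each shadow vertex other than the image of the apex gets a supporting point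
in a closed ring cell on one common line; a small perturbation moves all these points into open ring
regions, still on a common line, so thinness leaves at most four (`shadowNumberAt_cap_le`). For the
lower bound, a line just inside an inner vertex meets the inner region and four ring regions
(`five_le_shadowNumber_cap`).

For (a), `cap` serves `n ≥ 6`. For `n ≤ 5` any polyhedron with `n` vertices will do, since every
shadow vertex lies below a vertex. The lower bound 1 holds because a vertex is exposed by some
functional, and projecting along a direction in the kernel of that functional keeps it a vertex. -/

/-- The unit vector pointing to the `k`-th vertex of the regular `m`-gon with phase `φ`. -/
def dir (m : ℕ) (φ : ℝ) (k : ℤ) : E2 :=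
  !₂[Real.cos (φ + 2 * Real.pi * k / m), Real.sin (φ + 2 * Real.pi * k / m)]

/-- The unit vector pointing to the midpoint of the `k`-th edge of the regular `m`-gon. -/
def mid (m : ℕ) (φ : ℝ) (k : ℤ) : E2 := dir m (φ + Real.pi / m) k

/-- The ratio of inradius and circumradius of the regular `m`-gon. -/
def apo (m : ℕ) : ℝ := Real.cos (Real.pi / m)

lemma inner_E2 (x y : E2) : inner ℝ x y = x 0 * y 0 + x 1 * y 1 := by
  simp [PiLp.inner_apply, Fin.sum_univ_two, mul_comm]

lemma inner_dir_dir (m : ℕ) (φ ψ : ℝ) (k j : ℤ) :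
    inner ℝ (dir m φ k) (dir m ψ j) = Real.cos (φ - ψ + 2 * Real.pi * (k - j) / m) := by
  rw [inner_E2, show φ - ψ + 2 * Real.pi * ((k : ℝ) - j) / m
    = (φ + 2 * Real.pi * k / m) - (ψ + 2 * Real.pi * j / m) by ring, Real.cos_sub]
  simp [dir]

lemma dir_congr {m : ℕ} (hm : 0 < m) (φ : ℝ) {k j : ℤ} (h : (m : ℤ) ∣ k - j) :
    dir m φ k = dir m φ j := by
  obtain ⟨t, ht⟩ := h
  have hk : (k : ℝ) = j + m * t := by
    have : k = j + m * t := by linarith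
    exact_mod_cast this
  have hm' : (m : ℝ) ≠ 0 := by positivity
  have : φ + 2 * Real.pi * k / m = φ + 2 * Real.pi * j / m + t * (2 * Real.pi) := by
    rw [hk]; field_simp; ring
  simp only [dir, this, Real.cos_add_int_mul_two_pi, Real.sin_add_int_mul_two_pi]

lemma mid_congr {m : ℕ} (hm : 0 < m) (φ : ℝ) {k j : ℤ} (h : (m : ℤ) ∣ k - j) :
    mid m φ k = mid m φ j := dir_congr hm _ h

lemma norm_dir (m : ℕ) (φ : ℝ) (k : ℤ) : ‖dir m φ k‖ = 1 := by
  have h := inner_dir_dir m φ φ k k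
  simp only [sub_self, mul_zero, zero_div, add_zero, Real.cos_zero] at h
  rw [real_inner_self_eq_norm_sq] at h
  nlinarith [norm_nonneg (dir m φ k)]

lemma pi_div_lt {m : ℕ} (hm : 5 ≤ m) : Real.pi / m ≤ Real.pi / 5 := by
  have : (5 : ℝ) ≤ m := by exact_mod_cast hm
  gcongr

lemma pi_div_pos {m : ℕ} (hm : 5 ≤ m) : 0 < Real.pi / m := by
  have : 0 < m := by omega
  positivity

lemma apo_pos {m : ℕ} (hm : 5 ≤ m) : 0 < apo m := by
  apply Real.cos_pos_of_mem_Ioo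
  constructor <;> linarith [pi_div_lt hm, pi_div_pos hm, Real.pi_pos]

lemma cos_three_lt {m : ℕ} (hm : 5 ≤ m) : Real.cos (3 * (Real.pi / m)) < apo m := by
  apply Real.cos_lt_cos_of_nonneg_of_le_pi <;>
    linarith [pi_div_lt hm, pi_div_pos hm, Real.pi_pos]

lemma cos_le_cos_of_mem {a x : ℝ} (ha : 0 ≤ a) (h1 : a ≤ x) (h2 : x ≤ 2 * Real.pi - a) :
    Real.cos x ≤ Real.cos a := by
  rcases le_total x Real.pi with h | h
  · exact Real.cos_le_cos_of_nonneg_of_le_pi ha h h1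
  · rw [← Real.cos_two_pi_sub x]
    exact Real.cos_le_cos_of_nonneg_of_le_pi ha (by linarith) (by linarith)

/-- Vertex and edge-midpoint directions differ by odd multiples of `π / m`; the comparisons between
cells below rest on which odd multiple occurs. -/
lemma inner_dir_mid (m : ℕ) (φ : ℝ) (k j : ℤ) :
    inner ℝ (dir m φ k) (mid m φ j) = Real.cos ((2 * ((k - j : ℤ) : ℝ) - 1) * (Real.pi / m)) := by
  rw [mid, inner_dir_dir]
  push_cast
  congr 1
  ring

lemma inner_dir_mid_eq {m : ℕ} (hm : 5 ≤ m) (φ : ℝ) {k j : ℤ}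
    (h : (m : ℤ) ∣ k - j ∨ (m : ℤ) ∣ k - j - 1) :
    inner ℝ (dir m φ k) (mid m φ j) = apo m := by
  rcases h with h | h
  · rw [dir_congr (by omega) φ h, inner_dir_mid, apo, ← Real.cos_neg]
    simp
  · rw [dir_congr (j := j + 1) (by omega) φ (by convert h using 1; ring), inner_dir_mid, apo]
    norm_num

lemma inner_dir_mid_self {m : ℕ} (hm : 5 ≤ m) (φ : ℝ) (k : ℤ) :
    inner ℝ (dir m φ k) (mid m φ k) = apo m := inner_dir_mid_eq hm φ (by simp)

lemma inner_dir_succ_mid {m : ℕ} (hm : 5 ≤ m) (φ : ℝ) (k : ℤ) :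
    inner ℝ (dir m φ (k + 1)) (mid m φ k) = apo m := inner_dir_mid_eq hm φ (by simp)

/-- The index difference has a representative between `2` and `m - 1`, so the angle lies between
`3π/m` and `2π - 3π/m`. The gap between `cos (3π/m)` and `apo m` is what leaves room for thin rings.
-/
lemma inner_dir_mid_le_three {m : ℕ} (hm : 5 ≤ m) (φ : ℝ) {k j : ℤ}
    (h1 : ¬ (m : ℤ) ∣ k - j) (h2 : ¬ (m : ℤ) ∣ k - j - 1) :
    inner ℝ (dir m φ k) (mid m φ j) ≤ Real.cos (3 * (Real.pi / m)) := by
  have hm0 : (0 : ℤ) < m := by omega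
  set i := (k - j) % m with hi
  have hdvd : (m : ℤ) ∣ k - j - i := by
    rw [hi]; exact Int.dvd_self_sub_emod
  have hi0 : 0 ≤ i := Int.emod_nonneg _ hm0.ne'
  have him : i < m := Int.emod_lt_of_pos _ hm0
  have hi2 : 2 ≤ i := by
    by_contra hcon
    have : i = 0 ∨ i = 1 := by omega
    rcases this with h | h
    · rw [h] at hdvd; exact h1 (by simpa using hdvd)
    · rw [h] at hdvd; exact h2 hdvd
  rw [dir_congr (j := j + i) (by omega) φ (by convert hdvd using 1; ring), inner_dir_mid]
  have hpos := pi_div_pos hm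
  have e : (m : ℝ) * (Real.pi / m) = Real.pi := by
    have : (m : ℝ) ≠ 0 := by
      have : 0 < m := by omega
      positivity
    field_simp
  have hi2' : (2 : ℝ) ≤ i := by exact_mod_cast hi2
  have him' : (i : ℝ) + 1 ≤ m := by exact_mod_cast him
  apply cos_le_cos_of_mem
  · positivity
  · push_cast; nlinarith
  · push_cast; nlinarith

lemma inner_dir_mid_le {m : ℕ} (hm : 5 ≤ m) (φ : ℝ) (k j : ℤ) :
    inner ℝ (dir m φ k) (mid m φ j) ≤ apo m := by
  by_cases h : (m : ℤ) ∣ k - j ∨ (m : ℤ) ∣ k - j - 1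
  · exact (inner_dir_mid_eq hm φ h).le
  · push Not at h
    exact (inner_dir_mid_le_three hm φ h.1 h.2).trans (cos_three_lt hm).le

lemma inner_dir_mid_lt {m : ℕ} (hm : 5 ≤ m) (φ : ℝ) {k j : ℤ}
    (h1 : ¬ (m : ℤ) ∣ k - j) (h2 : ¬ (m : ℤ) ∣ k - j - 1) :
    inner ℝ (dir m φ k) (mid m φ j) < apo m :=
  (inner_dir_mid_le_three hm φ h1 h2).trans_lt (cos_three_lt hm)

/-- The floor of the normalised polar angle locates the cone of consecutive directions containing
`y`, and the sine rule in that cone gives the two coefficients. -/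
lemma exists_dir_combination {m : ℕ} (hm : 5 ≤ m) (φ : ℝ) (y : E2) :
    ∃ (k : ℤ) (α β : ℝ), 0 ≤ α ∧ 0 ≤ β ∧ y = α • dir m φ k + β • dir m φ (k + 1) := by
  set z : ℂ := ⟨y 0, y 1⟩ with hz
  set ρ := ‖z‖ with hρ
  set θ := z.arg with hθ
  have h0 : y 0 = ρ * Real.cos θ := (Complex.norm_mul_cos_arg z).symm
  have h1 : y 1 = ρ * Real.sin θ := (Complex.norm_mul_sin_arg z).symm
  have hρ0 : 0 ≤ ρ := norm_nonneg z
  have hm' : (0 : ℝ) < m := by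
    have : 0 < m := by omega
    positivity
  have hpi := Real.pi_pos
  set k : ℤ := ⌊(θ - φ) * m / (2 * Real.pi)⌋ with hk
  have hk1 : (k : ℝ) ≤ (θ - φ) * m / (2 * Real.pi) := Int.floor_le _
  have hk2 : (θ - φ) * m / (2 * Real.pi) < k + 1 := Int.lt_floor_add_one _
  set τ : ℝ := 2 * Real.pi / m with hτ
  set δ : ℝ := θ - φ - 2 * Real.pi * k / m with hδ
  have hδ0 : 0 ≤ δ := by
    rw [le_div_iff₀ (by positivity)] at hk1
    rw [hδ, sub_nonneg, div_le_iff₀ hm']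
    linarith
  have hδ1 : 0 ≤ τ - δ := by
    rw [div_lt_iff₀ (by positivity)] at hk2
    have : τ - δ = (2 * Real.pi * (k + 1) - (θ - φ) * m) / m := by
      rw [hτ, hδ]; field_simp; ring
    rw [this]
    apply div_nonneg _ hm'.le
    linarith
  have hτpi : τ < Real.pi := by
    have := pi_div_lt hm
    have : τ = 2 * (Real.pi / m) := by rw [hτ]; ring
    linarith
  have hτ0 : 0 < τ := by positivity
  have hs : 0 < Real.sin τ := Real.sin_pos_of_pos_of_lt_pi hτ0 hτpi
  refine ⟨k, ρ * Real.sin (τ - δ) / Real.sin τ, ρ * Real.sin δ / Real.sin τ, ?_, ?_, ?_⟩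
  · have := Real.sin_nonneg_of_nonneg_of_le_pi hδ1 (by linarith)
    positivity
  · have := Real.sin_nonneg_of_nonneg_of_le_pi hδ0 (by linarith)
    positivity
  · have ek : φ + 2 * Real.pi * k / m = θ - δ := by rw [hδ]; ring
    have ek1 : φ + 2 * Real.pi * ((k + 1 : ℤ) : ℝ) / m = θ - δ + τ := by
      rw [hδ, hτ]; push_cast; ring
    have hss := Real.sin_sq_add_cos_sq δ
    clear_value δ τ
    ext i
    fin_cases i
    · simp only [dir, ek, ek1]
      simp [h0]
      simp only [Real.cos_add, Real.cos_sub, Real.sin_sub]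
      field_simp
      linear_combination (-ρ * Real.sin τ * Real.cos θ) * hss
    · simp only [dir, ek, ek1]
      simp [h1]
      simp only [Real.sin_add, Real.cos_sub, Real.sin_sub]
      field_simp
      linear_combination (-ρ * Real.sin τ * Real.sin θ) * hss

/-! ### Sectors, cells of the ring, and concentric polygons -/

section Plane

variable {m : ℕ} {φ r R ρ : ℝ}

lemma inner_combination_mid_self (hm : 5 ≤ m) (k : ℤ) (α β : ℝ) :
    inner ℝ (α • dir m φ k + β • dir m φ (k + 1)) (mid m φ k) = (α + β) * apo m := by
  rw [inner_add_left, inner_smul_left, inner_smul_left, inner_dir_mid_self hm,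
    inner_dir_succ_mid hm]
  simp; ring

lemma inner_combination_mid_le (hm : 5 ≤ m) (k j : ℤ) {α β : ℝ} (hα : 0 ≤ α) (hβ : 0 ≤ β) :
    inner ℝ (α • dir m φ k + β • dir m φ (k + 1)) (mid m φ j) ≤ (α + β) * apo m := by
  rw [inner_add_left, inner_smul_left, inner_smul_left]
  have h1 := inner_dir_mid_le hm φ k j
  have h2 := inner_dir_mid_le hm φ (k + 1) j
  simp only [conj_trivial]
  nlinarith

/-- Equality forces each direction with nonzero coefficient to be an endpoint of edge `j`, as every
other vertex direction has strictly smaller product with `mid j`. -/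
lemma inner_combination_mid_eq (hm : 5 ≤ m) {k j : ℤ} {α β : ℝ} (hα : 0 ≤ α) (hβ : 0 ≤ β)
    (h : inner ℝ (α • dir m φ k + β • dir m φ (k + 1)) (mid m φ j) = (α + β) * apo m) :
    (α = 0 ∨ (m : ℤ) ∣ k - j ∨ (m : ℤ) ∣ k - j - 1) ∧
      (β = 0 ∨ (m : ℤ) ∣ k - j ∨ (m : ℤ) ∣ k + 1 - j) := by
  rw [inner_add_left, inner_smul_left, inner_smul_left] at h
  simp only [conj_trivial] at h
  have h1 := inner_dir_mid_le hm φ k j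
  have h2 := inner_dir_mid_le hm φ (k + 1) j
  constructor
  · by_contra hcon
    push Not at hcon
    have h3 := inner_dir_mid_lt hm φ hcon.2.1 hcon.2.2
    have := hα.lt_of_ne' hcon.1
    nlinarith
  · by_contra hcon
    push Not at hcon
    have h3 := inner_dir_mid_lt hm φ hcon.2.2 (by convert hcon.2.1 using 2; ring)
    have := hβ.lt_of_ne' hcon.1
    nlinarith

lemma not_dvd_of_lt {t : ℤ} (ht : t ≠ 0) (h : |t| < m) : ¬ (m : ℤ) ∣ t :=
  fun hd => ht (Int.eq_zero_of_abs_lt_dvd hd h)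

/-- The closed sector spanned by two consecutive directions. -/
def sector (m : ℕ) (φ : ℝ) (k : ℤ) : Set E2 :=
  {y | ∀ j, inner ℝ y (mid m φ j) ≤ inner ℝ y (mid m φ k)}

lemma combination_mem_sector (hm : 5 ≤ m) (k : ℤ) {α β : ℝ} (hα : 0 ≤ α) (hβ : 0 ≤ β) :
    α • dir m φ k + β • dir m φ (k + 1) ∈ sector m φ k := fun j => by
  rw [inner_combination_mid_self hm]
  exact inner_combination_mid_le hm k j hα hβ

lemma sector_congr (hm : 5 ≤ m) {k j : ℤ} (h : (m : ℤ) ∣ k - j) : sector m φ k = sector m φ j := by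
  simp only [sector, mid_congr (by omega : 0 < m) φ h]

/-- Every point lies in the cone of some edge `j`. If `k` also maximises the product, the equality
case leaves only `j ≡ k`, or a point on a ray shared by the two cones. -/
lemma mem_sector_iff (hm : 5 ≤ m) {k : ℤ} {y : E2} : y ∈ sector m φ k ↔
    ∃ α β : ℝ, 0 ≤ α ∧ 0 ≤ β ∧ y = α • dir m φ k + β • dir m φ (k + 1) := by
  constructor
  · intro h
    obtain ⟨j, α, β, hα, hβ, rfl⟩ := exists_dir_combination hm φ y
    have h1 : inner ℝ (α • dir m φ j + β • dir m φ (j + 1)) (mid m φ k) = (α + β) * apo m := by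
      apply le_antisymm (inner_combination_mid_le hm j k hα hβ)
      rw [← inner_combination_mid_self hm j]
      exact h j
    have hm0 : 0 < m := by omega
    obtain ⟨ha, hb⟩ := inner_combination_mid_eq hm hα hβ h1
    by_cases hjk : (m : ℤ) ∣ j - k
    · refine ⟨α, β, hα, hβ, ?_⟩
      rw [dir_congr hm0 φ hjk, dir_congr (k := j + 1) (j := k + 1) hm0 φ (by simpa using hjk)]
    by_cases hjk1 : (m : ℤ) ∣ j - k - 1
    · refine ⟨0, α, le_rfl, hα, ?_⟩
      have hb0 : β = 0 := by
        by_contra hne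
        have h2 : (m : ℤ) ∣ j + 1 - k := by tauto
        have := dvd_sub h2 hjk1
        rw [show j + 1 - k - (j - k - 1) = 2 by ring] at this
        exact not_dvd_of_lt (by norm_num) (by norm_num; omega) this
      rw [hb0, dir_congr (j := k + 1) hm0 φ (by convert hjk1 using 1; ring)]
      simp
    · have ha0 : α = 0 := by tauto
      by_cases hb0 : β = 0
      · exact ⟨0, 0, le_rfl, le_rfl, by simp [ha0, hb0]⟩
      · refine ⟨β, 0, hβ, le_rfl, ?_⟩
        have h2 : (m : ℤ) ∣ j + 1 - k := by tauto
        rw [ha0, dir_congr hm0 φ h2]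
        simp
  · rintro ⟨α, β, hα, hβ, rfl⟩
    exact combination_mem_sector hm k hα hβ

lemma sector_inter_eq_zero (hm : 5 ≤ m) {k j : ℤ} (h0 : ¬ (m : ℤ) ∣ k - j)
    (h1 : ¬ (m : ℤ) ∣ k - j - 1) (h2 : ¬ (m : ℤ) ∣ k + 1 - j) {y : E2}
    (hk : y ∈ sector m φ k) (hj : y ∈ sector m φ j) : y = 0 := by
  obtain ⟨α, β, hα, hβ, rfl⟩ := (mem_sector_iff hm).1 hk
  have h : inner ℝ (α • dir m φ k + β • dir m φ (k + 1)) (mid m φ j) = (α + β) * apo m :=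
    le_antisymm (inner_combination_mid_le hm k j hα hβ)
      (by rw [← inner_combination_mid_self hm k]; exact hj k)
  obtain ⟨ha, hb⟩ := inner_combination_mid_eq hm hα hβ h
  have : α = 0 := by tauto
  have : β = 0 := by tauto
  simp [*]

lemma sector_inter_succ (hm : 5 ≤ m) {k : ℤ} {y : E2} (hk : y ∈ sector m φ k)
    (hj : y ∈ sector m φ (k + 1)) : ∃ β : ℝ, 0 ≤ β ∧ y = β • dir m φ (k + 1) := by
  obtain ⟨α, β, hα, hβ, rfl⟩ := (mem_sector_iff hm).1 hk
  have h : inner ℝ (α • dir m φ k + β • dir m φ (k + 1)) (mid m φ (k + 1)) = (α + β) * apo m :=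
    le_antisymm (inner_combination_mid_le hm k _ hα hβ)
      (by rw [← inner_combination_mid_self hm k]; exact hj k)
  obtain ⟨ha, hb⟩ := inner_combination_mid_eq hm hα hβ h
  have h1 : ¬ (m : ℤ) ∣ k - (k + 1) := not_dvd_of_lt (by omega) (by ring_nf; norm_num; omega)
  have h2 : ¬ (m : ℤ) ∣ k - (k + 1) - 1 := not_dvd_of_lt (by omega) (by ring_nf; norm_num; omega)
  have : α = 0 := by tauto
  exact ⟨β, hβ, by simp [this]⟩

/-- The closed cell of the ring between the `k`-th edges of the polygons of circumradii `r`, `R`. -/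
def ringCell (m : ℕ) (φ r R : ℝ) (k : ℤ) : Set E2 :=
  {y | y ∈ sector m φ k ∧ r * apo m ≤ inner ℝ y (mid m φ k) ∧ inner ℝ y (mid m φ k) ≤ R * apo m}

/-- The closed regular polygon of circumradius `ρ`, as an intersection of half-planes. -/
def polygon (m : ℕ) (φ ρ : ℝ) : Set E2 := {y | ∀ j, inner ℝ y (mid m φ j) ≤ ρ * apo m}

lemma ringCell_congr (hm : 5 ≤ m) {k j : ℤ} (h : (m : ℤ) ∣ k - j) :
    ringCell m φ r R k = ringCell m φ r R j := by
  simp only [ringCell, mid_congr (by omega : 0 < m) φ h, sector_congr hm h]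

lemma mem_ringCell_iff (hm : 5 ≤ m) {k : ℤ} {y : E2} : y ∈ ringCell m φ r R k ↔
    ∃ α β : ℝ, 0 ≤ α ∧ 0 ≤ β ∧ r ≤ α + β ∧ α + β ≤ R ∧
      y = α • dir m φ k + β • dir m φ (k + 1) := by
  have hc := apo_pos hm
  constructor
  · rintro ⟨h, h1, h2⟩
    obtain ⟨α, β, hα, hβ, rfl⟩ := (mem_sector_iff hm).1 h
    rw [inner_combination_mid_self hm] at h1 h2
    exact ⟨α, β, hα, hβ, le_of_mul_le_mul_right h1 hc, le_of_mul_le_mul_right h2 hc, rfl⟩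
  · rintro ⟨α, β, hα, hβ, h1, h2, rfl⟩
    refine ⟨combination_mem_sector hm k hα hβ, ?_, ?_⟩ <;> rw [inner_combination_mid_self hm] <;>
      gcongr

lemma combination_mem_polygon_iff (hm : 5 ≤ m) {k : ℤ} {α β : ℝ} (hα : 0 ≤ α) (hβ : 0 ≤ β) :
    α • dir m φ k + β • dir m φ (k + 1) ∈ polygon m φ ρ ↔ α + β ≤ ρ := by
  have hc := apo_pos hm
  constructor
  · intro h
    have := h k
    rw [inner_combination_mid_self hm] at this
    exact le_of_mul_le_mul_right this hc
  · intro h j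
    exact (inner_combination_mid_le hm k j hα hβ).trans (by gcongr)

lemma convex_polygon : Convex ℝ (polygon m φ ρ) := by
  intro x hx y hy a b ha hb hab j
  rw [inner_add_left, inner_smul_left, inner_smul_left]
  simp only [conj_trivial]
  have := hx j
  have := hy j
  calc _ ≤ a * (ρ * apo m) + b * (ρ * apo m) := by gcongr
    _ = _ := by rw [← add_mul, hab, one_mul]

lemma convex_ringCell : Convex ℝ (ringCell m φ r R k) := by
  rintro x ⟨hx, hx1, hx2⟩ y ⟨hy, hy1, hy2⟩ a b ha hb hab
  simp only [ringCell, sector, mem_ofPred_eq, inner_add_left, inner_smul_left, conj_trivial]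
  refine ⟨fun j => ?_, ?_, ?_⟩
  · have := hx j
    have := hy j
    gcongr
  · calc _ = a * (r * apo m) + b * (r * apo m) := by rw [← add_mul, hab, one_mul]
      _ ≤ _ := by gcongr
  · calc _ ≤ a * (R * apo m) + b * (R * apo m) := by gcongr
      _ = _ := by rw [← add_mul, hab, one_mul]

lemma gonVertex_eq (m : ℕ) (φ ρ : ℝ) (k : ℕ) : gonVertex m φ ρ k = ρ • dir m φ k := by
  ext i
  fin_cases i <;> simp [gonVertex, dir]

lemma exists_range_dvd_sub (hm : 0 < m) (k : ℤ) :
    ∃ j ∈ Finset.range m, (m : ℤ) ∣ k - (j : ℤ) := by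
  have hm0 : (0 : ℤ) < m := by omega
  obtain ⟨i, hi⟩ := Int.eq_ofNat_of_zero_le (Int.emod_nonneg k hm0.ne')
  have him : i < m := by have := Int.emod_lt_of_pos k hm0; omega
  exact ⟨i, Finset.mem_range.2 him, by rw [← hi]; exact Int.dvd_self_sub_emod⟩

lemma exists_nat_dvd_sub (hm : 0 < m) (k : ℤ) : ∃ j : ℕ, (m : ℤ) ∣ k - j :=
  (exists_range_dvd_sub hm k).imp fun _ h => h.2

lemma range_gonVertex (hm : 5 ≤ m) (φ ρ : ℝ) :
    range (gonVertex m φ ρ) = range fun k : ℤ => ρ • dir m φ k := by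
  ext y
  constructor
  · rintro ⟨k, rfl⟩
    exact ⟨k, (gonVertex_eq m φ ρ k).symm⟩
  · rintro ⟨k, rfl⟩
    obtain ⟨j, hj⟩ := exists_nat_dvd_sub (by omega : 0 < m) k
    exact ⟨j, by simp only [gonVertex_eq, dir_congr (by omega : 0 < m) φ hj]⟩

lemma smul_dir_mem_polygon (hm : 5 ≤ m) (hρ : 0 ≤ ρ) (k : ℤ) : ρ • dir m φ k ∈ polygon m φ ρ := by
  have := (combination_mem_polygon_iff (φ := φ) (ρ := ρ) (k := k) hm hρ le_rfl).2 (by simp)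
  simpa using this

/-- Writing `-dir m φ 0` as a conic combination of two directions gives a positive linear relation,
which is then normalised by its total weight `1 + α + β`. -/
lemma zero_mem_convexHull_dir (hm : 5 ≤ m) (φ : ℝ) :
    (0 : E2) ∈ convexHull ℝ (range (dir m φ)) := by
  obtain ⟨k, α, β, hα, hβ, h⟩ := exists_dir_combination hm φ (-dir m φ 0)
  have hs : (0 : ℝ) < 1 + α + β := by positivity
  have := (convex_convexHull ℝ (range (dir m φ))).sum_mem (t := (Finset.univ : Finset (Fin 3)))
    (w := ![1 / (1 + α + β), α / (1 + α + β), β / (1 + α + β)])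
    (z := ![dir m φ 0, dir m φ k, dir m φ (k + 1)]) ?_ ?_ ?_
  · convert this using 1
    simp only [Fin.sum_univ_three, Matrix.cons_val]
    rw [div_eq_inv_mul, div_eq_inv_mul, div_eq_inv_mul, mul_smul, mul_smul, mul_smul, one_smul,
      ← smul_add, ← smul_add, add_assoc (dir m φ 0), ← h]
    simp
  · intro i _
    fin_cases i <;> simp <;> positivity
  · simp only [Fin.sum_univ_three, Matrix.cons_val]
    field_simp
  · intro i _
    fin_cases i <;> exact subset_convexHull ℝ _ (mem_range_self _)

lemma polygon_eq_convexHull (hm : 5 ≤ m) (hρ : 0 < ρ) :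
    polygon m φ ρ = convexHull ℝ (range (gonVertex m φ ρ)) := by
  rw [range_gonVertex hm]
  apply subset_antisymm
  · intro y hy
    obtain ⟨k, α, β, hα, hβ, rfl⟩ := exists_dir_combination hm φ y
    have hle := (combination_mem_polygon_iff hm hα hβ).1 hy
    have h0 : (0 : E2) ∈ convexHull ℝ (range fun k : ℤ => ρ • dir m φ k) := by
      have : (range fun k : ℤ => ρ • dir m φ k) = (ρ • ·) '' range (dir m φ) := by
        rw [← range_comp]; rfl
      rw [this, image_smul, convexHull_smul]
      exact ⟨0, zero_mem_convexHull_dir hm φ, smul_zero _⟩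
    -- The point is a convex combination of two consecutive vertices and the centre, which takes the
    -- remaining weight `1 - (α + β) / ρ`.
    have := (convex_convexHull ℝ (range fun k : ℤ => ρ • dir m φ k)).sum_mem
      (t := (Finset.univ : Finset (Fin 3)))
      (w := ![α / ρ, β / ρ, 1 - (α + β) / ρ])
      (z := ![ρ • dir m φ k, ρ • dir m φ (k + 1), 0]) ?_ ?_ ?_
    · convert this using 1
      simp only [Fin.sum_univ_three, Matrix.cons_val, smul_smul, smul_zero, add_zero]
      rw [div_mul_cancel₀ _ hρ.ne', div_mul_cancel₀ _ hρ.ne']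
    · have : (α + β) / ρ ≤ 1 := by rwa [div_le_one hρ]
      intro i _
      fin_cases i <;> simp <;> first | positivity | exact this
    · simp only [Fin.sum_univ_three, Matrix.cons_val]
      field_simp; ring
    · intro i _
      fin_cases i
      · exact subset_convexHull ℝ _ ⟨k, rfl⟩
      · exact subset_convexHull ℝ _ ⟨k + 1, rfl⟩
      · exact h0
  · apply convexHull_min _ convex_polygon
    rintro _ ⟨k, rfl⟩
    exact smul_dir_mem_polygon hm hρ.le k

lemma smul_dir_mem_ringCell (hm : 5 ≤ m) (hr : 0 < r) {μ : ℝ} (h1 : r ≤ μ) (h2 : μ ≤ R) (k : ℤ) :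
    μ • dir m φ k ∈ ringCell m φ r R k :=
  (mem_ringCell_iff hm).2 ⟨μ, 0, by linarith, le_rfl, by linarith, by linarith, by simp⟩

lemma smul_dir_succ_mem_ringCell (hm : 5 ≤ m) (hr : 0 < r) {μ : ℝ} (h1 : r ≤ μ) (h2 : μ ≤ R)
    (k : ℤ) : μ • dir m φ (k + 1) ∈ ringCell m φ r R k :=
  (mem_ringCell_iff hm).2 ⟨0, μ, le_rfl, by linarith, by linarith, by linarith, by simp⟩

lemma ringCell_eq_convexHull (hm : 5 ≤ m) (hr : 0 < r) (hR : r < R) (k : ℤ) :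
    ringCell m φ r R k = convexHull ℝ {r • dir m φ k, r • dir m φ (k + 1),
      R • dir m φ k, R • dir m φ (k + 1)} := by
  apply subset_antisymm
  · intro y hy
    obtain ⟨α, β, hα, hβ, h1, h2, rfl⟩ := (mem_ringCell_iff hm).1 hy
    have hs : 0 < α + β := by linarith
    have hd : 0 < R - r := by linarith
    -- With `s = α + β`, these are product weights: `α / s` and `β / s` along the edges, times `(R -
    -- s) / (R - r)` and `(s - r) / (R - r)` across the ring.
    have := (convex_convexHull ℝ {r • dir m φ k, r • dir m φ (k + 1),
      R • dir m φ k, R • dir m φ (k + 1)}).sum_mem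
      (t := (Finset.univ : Finset (Fin 4)))
      (w := ![α * (R - (α + β)) / ((α + β) * (R - r)), β * (R - (α + β)) / ((α + β) * (R - r)),
        α * (α + β - r) / ((α + β) * (R - r)), β * (α + β - r) / ((α + β) * (R - r))])
      (z := ![r • dir m φ k, r • dir m φ (k + 1), R • dir m φ k, R • dir m φ (k + 1)]) ?_ ?_ ?_
    · convert this using 1
      simp only [Fin.sum_univ_four, Matrix.cons_val]
      match_scalars <;> field_simp <;> ring
    · have h3 : 0 ≤ R - (α + β) := by linarith
      have h4 : 0 ≤ α + β - r := by linarith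
      intro i _
      fin_cases i <;> simp <;> positivity
    · simp only [Fin.sum_univ_four, Matrix.cons_val]
      field_simp; ring
    · intro i _
      fin_cases i <;> exact subset_convexHull ℝ _ (by simp)
  · apply convexHull_min _ convex_ringCell
    rintro _ (rfl | rfl | rfl | rfl)
    · exact smul_dir_mem_ringCell hm hr le_rfl hR.le k
    · exact smul_dir_succ_mem_ringCell hm hr le_rfl hR.le k
    · exact smul_dir_mem_ringCell hm hr hR.le le_rfl k
    · exact smul_dir_succ_mem_ringCell hm hr hR.le le_rfl k

lemma innerRegion_eq (hm : 5 ≤ m) (hr : 0 < r) :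
    innerRegion m φ r = interior (polygon m φ r) := by
  rw [innerRegion, polygon_eq_convexHull hm hr]

lemma ringRegion_eq (hm : 5 ≤ m) (hr : 0 < r) (hR : r < R) (k : ℕ) :
    ringRegion m φ r R k = interior (ringCell m φ r R k) := by
  rw [ringRegion, ringCell_eq_convexHull hm hr hR]
  simp only [gonVertex_eq]
  push_cast
  rfl

lemma ringRegions_eq (hm : 5 ≤ m) (hr : 0 < r) (hR : r < R) :
    ringRegions m φ r R = range fun k : ℤ => interior (ringCell m φ r R k) := by
  ext S
  constructor
  · rintro ⟨k, rfl⟩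
    exact ⟨k, (ringRegion_eq hm hr hR k).symm⟩
  · rintro ⟨k, rfl⟩
    obtain ⟨j, hj⟩ := exists_nat_dvd_sub (by omega : 0 < m) k
    exact ⟨j, by rw [ringRegion_eq hm hr hR]; simp only [ringCell_congr hm hj]⟩

lemma isCompact_polygon (hm : 5 ≤ m) (hρ : 0 < ρ) : IsCompact (polygon m φ ρ) := by
  rw [polygon_eq_convexHull hm hρ]
  refine Set.Finite.isCompact_convexHull ℝ ?_
  apply ((Finset.range m).finite_toSet.image (gonVertex m φ ρ)).subset
  rintro _ ⟨k, rfl⟩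
  refine ⟨k % m, by simpa using Nat.mod_lt _ (by omega), ?_⟩
  rw [gonVertex_eq, gonVertex_eq, dir_congr (by omega : 0 < m) φ (j := (k : ℤ))]
  push_cast
  rw [dvd_sub_comm]
  exact Int.dvd_self_sub_emod

lemma isCompact_ringCell (hm : 5 ≤ m) (hr : 0 < r) (hR : r < R) (k : ℤ) :
    IsCompact (ringCell m φ r R k) := by
  rw [ringCell_eq_convexHull hm hr hR]
  exact (Set.toFinite _).isCompact_convexHull ℝ

end Plane

/-! ### Interiors and closures of the planar cells -/

section Plane

variable {m : ℕ} {φ r R ρ : ℝ}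

lemma not_dvd_two (hm : 5 ≤ m) : ¬ (m : ℤ) ∣ 2 := not_dvd_of_lt (by norm_num) (by norm_num; omega)

lemma inner_combination_mid_lt (hm : 5 ≤ m) {k j : ℤ} {α β : ℝ} (hα : 0 < α) (hβ : 0 < β)
    (h : ¬ (m : ℤ) ∣ k - j) :
    inner ℝ (α • dir m φ k + β • dir m φ (k + 1)) (mid m φ j) < (α + β) * apo m := by
  refine lt_of_le_of_ne (inner_combination_mid_le hm k j hα.le hβ.le) fun heq => ?_
  obtain ⟨h1, h2⟩ := inner_combination_mid_eq hm hα.le hβ.le heq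
  have h3 : (m : ℤ) ∣ k - j - 1 := by have := hα.ne'; tauto
  have h4 : (m : ℤ) ∣ k + 1 - j := by have := hβ.ne'; tauto
  have := dvd_sub h4 h3
  rw [show k + 1 - j - (k - j - 1) = 2 by ring] at this
  exact not_dvd_two hm this

lemma mid_inj (hm : 5 ≤ m) {k j : ℤ} (h : mid m φ k = mid m φ j) : (m : ℤ) ∣ k - j := by
  by_contra hcon
  have h1 := inner_combination_mid_lt (φ := φ) hm one_pos one_pos hcon
  rw [← h, inner_combination_mid_self hm] at h1
  exact lt_irrefl _ h1

lemma mem_interior_ringCell (hm : 5 ≤ m) {k : ℤ} {y : E2}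
    (h : ∀ j ∈ Finset.range m, ¬ (m : ℤ) ∣ k - j →
      inner ℝ y (mid m φ j) < inner ℝ y (mid m φ k))
    (h1 : r * apo m < inner ℝ y (mid m φ k)) (h2 : inner ℝ y (mid m φ k) < R * apo m) :
    y ∈ interior (ringCell m φ r R k) := by
  rw [mem_interior_iff_mem_nhds]
  have hc : ∀ j : ℤ, ContinuousAt (fun z : E2 => inner ℝ z (mid m φ j)) y := fun j => by fun_prop
  have e0 : ∀ᶠ z in 𝓝 y, ∀ j ∈ Finset.range m,
      ¬ (m : ℤ) ∣ k - (j : ℤ) → inner ℝ z (mid m φ j) < inner ℝ z (mid m φ k) := by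
    rw [Filter.eventually_all_finset]
    intro j hj
    by_cases hd : (m : ℤ) ∣ k - (j : ℤ)
    · exact Eventually.of_forall fun z hz => absurd hd hz
    · filter_upwards [(hc j).eventually_lt (hc k) (h j hj hd)] with z hz _ using hz
  filter_upwards [e0, continuousAt_const.eventually_lt (hc k) h1,
    (hc k).eventually_lt continuousAt_const h2] with z hz hz1 hz2
  refine ⟨fun j => ?_, hz1.le, hz2.le⟩
  obtain ⟨i, him, hd⟩ := exists_range_dvd_sub (by omega : 0 < m) j
  rw [mid_congr (by omega) φ hd]
  by_cases hki : (m : ℤ) ∣ k - i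
  · rw [mid_congr (by omega) φ hki]
  · exact (hz i (him) hki).le

lemma combination_mem_interior_ringCell (hm : 5 ≤ m) (k : ℤ) {α β : ℝ} (hα : 0 < α) (hβ : 0 < β)
    (h1 : r < α + β) (h2 : α + β < R) :
    α • dir m φ k + β • dir m φ (k + 1) ∈ interior (ringCell m φ r R k) := by
  have hc := apo_pos hm
  apply mem_interior_ringCell hm
  · intro j _ hj
    rw [inner_combination_mid_self hm]
    exact inner_combination_mid_lt hm hα hβ hj
  all_goals
    rw [inner_combination_mid_self hm]
    gcongr

lemma closure_interior_ringCell (hm : 5 ≤ m) (hr : 0 < r) (hR : r < R) (k : ℤ) :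
    closure (interior (ringCell m φ r R k)) = ringCell m φ r R k := by
  rw [convex_ringCell.closure_interior_eq_closure_of_nonempty_interior,
    (isCompact_ringCell hm hr hR k).isClosed.closure_eq]
  exact ⟨_, combination_mem_interior_ringCell hm k (α := (r + R) / 4) (β := (r + R) / 4)
    (by linarith) (by linarith) (by linarith) (by linarith)⟩

lemma interior_polygon (hm : 5 ≤ m) (hρ : 0 < ρ) :
    interior (polygon m φ ρ) = {y | ∀ j, inner ℝ y (mid m φ j) < ρ * apo m} := by
  have hc := apo_pos hm
  apply subset_antisymm
  · intro y hy j
    refine lt_of_le_of_ne (interior_subset hy j) fun heq => ?_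
    rw [mem_interior_iff_mem_nhds] at hy
    have ht : Tendsto (fun t : ℝ => t • y) (𝓝 1) (𝓝 y) := by
      have : ContinuousAt (fun t : ℝ => t • y) 1 := by fun_prop
      simpa [ContinuousAt] using this
    -- The bound `ρ * apo m` is positive, so scaling a boundary point by any `t > 1` breaks its
    -- tight constraint.
    have hev : ∀ᶠ t : ℝ in 𝓝[>] 1, t • y ∈ polygon m φ ρ :=
      (ht.mono_left nhdsWithin_le_nhds).eventually hy
    obtain ⟨t, hty, ht1⟩ := (hev.and self_mem_nhdsWithin).exists
    have := hty j
    rw [inner_smul_left, heq] at this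
    simp only [conj_trivial] at this
    have hpos : 0 < ρ * apo m := by positivity
    have ht1' : (1 : ℝ) < t := ht1
    nlinarith
  · intro y hy
    rw [mem_interior_iff_mem_nhds]
    have e0 : ∀ᶠ z in 𝓝 y, ∀ j ∈ Finset.range m, inner ℝ z (mid m φ j) < ρ * apo m := by
      rw [Filter.eventually_all_finset]
      intro j _
      have hcj : ContinuousAt (fun z : E2 => inner ℝ z (mid m φ j)) y := by fun_prop
      exact hcj.eventually_lt continuousAt_const (hy j)
    filter_upwards [e0] with z hz j
    obtain ⟨i, him, hd⟩ := exists_range_dvd_sub (by omega : 0 < m) j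
    rw [mid_congr (by omega) φ hd]
    exact (hz i (him)).le

lemma zero_mem_interior_polygon (hm : 5 ≤ m) (hρ : 0 < ρ) :
    (0 : E2) ∈ interior (polygon m φ ρ) := by
  rw [interior_polygon hm hρ]
  intro j
  have := apo_pos hm
  simp only [inner_zero_left]
  positivity

lemma closure_interior_polygon (hm : 5 ≤ m) (hρ : 0 < ρ) :
    closure (interior (polygon m φ ρ)) = polygon m φ ρ := by
  rw [convex_polygon.closure_interior_eq_closure_of_nonempty_interior,
    (isCompact_polygon hm hρ).isClosed.closure_eq]
  exact ⟨0, zero_mem_interior_polygon hm hρ⟩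

/-! ### Intersections of the cells -/

lemma combination_mem_segment {k : ℤ} (hρ : 0 < ρ) {α β : ℝ} (hα : 0 ≤ α) (hβ : 0 ≤ β)
    (h : α + β = ρ) : α • dir m φ k + β • dir m φ (k + 1) ∈
      segment ℝ (ρ • dir m φ k) (ρ • dir m φ (k + 1)) := by
  refine ⟨α / ρ, β / ρ, by positivity, by positivity, ?_, ?_⟩
  · rw [← add_div, h, div_self hρ.ne']
  · rw [smul_smul, smul_smul, div_mul_cancel₀ _ hρ.ne', div_mul_cancel₀ _ hρ.ne']

lemma mem_edge_iff {k : ℤ} (hρ : 0 < ρ) {y : E2} :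
    y ∈ segment ℝ (ρ • dir m φ k) (ρ • dir m φ (k + 1)) ↔
      ∃ α β : ℝ, 0 ≤ α ∧ 0 ≤ β ∧ α + β = ρ ∧ y = α • dir m φ k + β • dir m φ (k + 1) := by
  constructor
  · rintro ⟨a, b, ha, hb, hab, rfl⟩
    exact ⟨a * ρ, b * ρ, by positivity, by positivity, by rw [← add_mul, hab, one_mul],
      by simp [smul_smul]⟩
  · rintro ⟨α, β, hα, hβ, h, rfl⟩
    exact combination_mem_segment hρ hα hβ h

lemma mem_spoke_iff {k : ℤ} (hR : r < R) {y : E2} :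
    y ∈ segment ℝ (r • dir m φ k) (R • dir m φ k) ↔
      ∃ μ : ℝ, r ≤ μ ∧ μ ≤ R ∧ y = μ • dir m φ k := by
  have hd : 0 < R - r := by linarith
  constructor
  · rintro ⟨a, b, ha, hb, hab, rfl⟩
    obtain rfl : b = 1 - a := by linarith
    refine ⟨a * r + (1 - a) * R, by nlinarith, by nlinarith, by module⟩
  · rintro ⟨μ, h1, h2, rfl⟩
    refine ⟨(R - μ) / (R - r), (μ - r) / (R - r), div_nonneg (by linarith) hd.le,
      div_nonneg (by linarith) hd.le, ?_, ?_⟩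
    · field_simp; ring
    · rw [smul_smul, smul_smul, ← add_smul]
      congr 1
      field_simp; ring

lemma polygon_inter_ringCell (hm : 5 ≤ m) (hr : 0 < r) (hR : r < R) (k : ℤ) :
    polygon m φ r ∩ ringCell m φ r R k = segment ℝ (r • dir m φ k) (r • dir m φ (k + 1)) := by
  ext y
  rw [mem_edge_iff hr]
  constructor
  · rintro ⟨hy, hy'⟩
    obtain ⟨α, β, hα, hβ, h1, h2, rfl⟩ := (mem_ringCell_iff hm).1 hy'
    have := (combination_mem_polygon_iff hm hα hβ).1 hy
    exact ⟨α, β, hα, hβ, le_antisymm this h1, rfl⟩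
  · rintro ⟨α, β, hα, hβ, h, rfl⟩
    exact ⟨(combination_mem_polygon_iff hm hα hβ).2 h.le,
      (mem_ringCell_iff hm).2 ⟨α, β, hα, hβ, h.ge, h.trans_le hR.le, rfl⟩⟩

lemma ringCell_inter_succ (hm : 5 ≤ m) (hr : 0 < r) (hR : r < R) (k : ℤ) :
    ringCell m φ r R k ∩ ringCell m φ r R (k + 1) =
      segment ℝ (r • dir m φ (k + 1)) (R • dir m φ (k + 1)) := by
  have hc := apo_pos hm
  ext y
  rw [mem_spoke_iff hR]
  constructor
  · rintro ⟨h, h'⟩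
    obtain ⟨β, hβ, rfl⟩ := sector_inter_succ hm h.1 h'.1
    have h1 := h.2.1
    have h2 := h.2.2
    rw [inner_smul_left, inner_dir_succ_mid hm] at h1 h2
    exact ⟨β, le_of_mul_le_mul_right h1 hc, le_of_mul_le_mul_right h2 hc, rfl⟩
  · rintro ⟨μ, h1, h2, rfl⟩
    exact ⟨smul_dir_succ_mem_ringCell hm hr h1 h2 k, smul_dir_mem_ringCell hm hr h1 h2 _⟩

lemma zero_notMem_ringCell (hm : 5 ≤ m) (hr : 0 < r) (k : ℤ) : (0 : E2) ∉ ringCell m φ r R k := by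
  have hc := apo_pos hm
  intro h
  have := h.2.1
  rw [inner_zero_left] at this
  have : 0 < r * apo m := by positivity
  linarith

lemma ringCell_inter_far (hm : 5 ≤ m) (hr : 0 < r) {k j : ℤ} (h0 : ¬ (m : ℤ) ∣ k - j)
    (h1 : ¬ (m : ℤ) ∣ k - j - 1) (h2 : ¬ (m : ℤ) ∣ k + 1 - j) :
    ringCell m φ r R k ∩ ringCell m φ r R j = ∅ := by
  rw [eq_empty_iff_forall_notMem]
  rintro y ⟨hk, hj⟩
  have := sector_inter_eq_zero hm h0 h1 h2 hk.1 hj.1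
  subst this
  exact zero_notMem_ringCell hm hr k hk

lemma ringCell_sdiff_interior (hm : 5 ≤ m) (hr : 0 < r) (hR : r < R) (k : ℤ) :
    ringCell m φ r R k ∩ (interior (polygon m φ R))ᶜ =
      segment ℝ (R • dir m φ k) (R • dir m φ (k + 1)) := by
  have hc := apo_pos hm
  have hR0 : 0 < R := hr.trans hR
  ext y
  rw [mem_edge_iff hR0, interior_polygon hm hR0]
  constructor
  · rintro ⟨hy, hy'⟩
    obtain ⟨α, β, hα, hβ, h1, h2, rfl⟩ := (mem_ringCell_iff hm).1 hy
    refine ⟨α, β, hα, hβ, le_antisymm h2 ?_, rfl⟩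
    by_contra hlt
    push Not at hlt
    exact hy' fun j => (inner_combination_mid_le hm k j hα hβ).trans_lt (by gcongr)
  · rintro ⟨α, β, hα, hβ, h, rfl⟩
    refine ⟨(mem_ringCell_iff hm).2 ⟨α, β, hα, hβ, hR.le.trans h.ge, h.le, rfl⟩, fun hy => ?_⟩
    have := hy k
    rw [inner_combination_mid_self hm, h] at this
    exact lt_irrefl _ this

lemma polygon_subset_interior (hm : 5 ≤ m) (hr : 0 < r) (hR : r < R) :
    polygon m φ r ⊆ interior (polygon m φ R) := by
  rw [interior_polygon hm (hr.trans hR)]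
  intro y hy j
  have := apo_pos hm
  exact (hy j).trans_lt (by gcongr)

lemma polygon_union_ringCells (hm : 5 ≤ m) (hr : 0 < r) (hR : r < R) :
    polygon m φ r ∪ ⋃ k, ringCell m φ r R k = polygon m φ R := by
  apply subset_antisymm
  · apply union_subset ((polygon_subset_interior hm hr hR).trans interior_subset)
    apply iUnion_subset
    intro k y hy
    obtain ⟨α, β, hα, hβ, h1, h2, rfl⟩ := (mem_ringCell_iff hm).1 hy
    exact (combination_mem_polygon_iff hm hα hβ).2 h2
  · intro y hy
    obtain ⟨k, α, β, hα, hβ, rfl⟩ := exists_dir_combination hm φ y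
    have h := (combination_mem_polygon_iff hm hα hβ).1 hy
    rcases le_total (α + β) r with h1 | h1
    · exact Or.inl ((combination_mem_polygon_iff hm hα hβ).2 h1)
    · exact Or.inr (mem_iUnion.2 ⟨k, (mem_ringCell_iff hm).2 ⟨α, β, hα, hβ, h1, h, rfl⟩⟩)

/-! ### Thin rings -/

/-- Both corner directions of a cell neither equal nor adjacent to cell `j` have product at most
`cos (3π/m)` with `mid j`. So the line carrying the inner edge `j` strictly separates such a cell
from cell `j`. -/
lemma inner_mid_lt_of_far (hm : 5 ≤ m) (hr : 0 < r)
    (h : R * Real.cos (3 * (Real.pi / m)) < r * apo m) {k j : ℤ} (h0 : ¬ (m : ℤ) ∣ k - j)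
    (h1 : ¬ (m : ℤ) ∣ k - j - 1) (h2 : ¬ (m : ℤ) ∣ k - j + 1) {y : E2}
    (hy : y ∈ ringCell m φ r R k) : inner ℝ y (mid m φ j) < r * apo m := by
  obtain ⟨α, β, hα, hβ, h3, h4, rfl⟩ := (mem_ringCell_iff hm).1 hy
  have hc := apo_pos hm
  have e1 := inner_dir_mid_le_three hm φ h0 h1
  have e2 := inner_dir_mid_le_three hm φ (k := k + 1) (j := j) (by convert h2 using 2; ring)
    (by convert h0 using 2; ring)
  rw [inner_add_left, inner_smul_left, inner_smul_left]
  simp only [conj_trivial]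
  set C := Real.cos (3 * (Real.pi / m))
  have e3 := mul_le_mul_of_nonneg_left e1 hα
  have e4 := mul_le_mul_of_nonneg_left e2 hβ
  have hpos : 0 < r * apo m := by positivity
  -- For a nonpositive cosine (as for `m = 5`) the bound `α + β ≤ R` is not needed; otherwise it is
  -- combined with `h`.
  rcases le_total C 0 with hC | hC
  · nlinarith
  · nlinarith

lemma dvd_of_eq_sub {a b c d : ℤ} (ha : d ∣ a) (hb : d ∣ b) (h : c = a - b) : d ∣ c :=
  h ▸ dvd_sub ha hb

/-- Applied to the middle point 2, `key` makes it adjacent to both points on one side. Those two are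
not adjacent to each other, so `key` at the inner one of them gives it two further neighbours on the
far side: three in all. -/
lemma not_five_of_adjacency (A : Fin 5 → Fin 5 → Prop)
    (key : ∀ a b c, a < b → b < c → A a b ∨ A c b) (symm : ∀ a b, A a b → A b a)
    (three : ∀ a b c d, a ≠ b → a ≠ c → b ≠ c → A a d → A b d → A c d → False)
    (notAdj : ∀ a b c, a ≠ b → A a c → A b c → ¬ A a b) : False := by
  have k1 := key 0 2 3 (by decide) (by decide)
  have k2 := key 0 2 4 (by decide) (by decide)
  have k3 := key 1 2 3 (by decide) (by decide)
  have k4 := key 1 2 4 (by decide) (by decide)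
  have hcase : (A 0 2 ∧ A 1 2) ∨ (A 3 2 ∧ A 4 2) := by tauto
  rcases hcase with ⟨h0, h1⟩ | ⟨h3, h4⟩
  · have hn := notAdj 0 1 2 (by decide) h0 h1
    have h31 := (key 0 1 3 (by decide) (by decide)).resolve_left hn
    have h41 := (key 0 1 4 (by decide) (by decide)).resolve_left hn
    exact three 2 3 4 1 (by decide) (by decide) (by decide) (symm _ _ h1) h31 h41
  · have hn := notAdj 4 3 2 (by decide) h4 h3
    have h03 := (key 0 3 4 (by decide) (by decide)).resolve_right hn
    have h13 := (key 1 3 4 (by decide) (by decide)).resolve_right hn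
    exact three 2 0 1 3 (by decide) (by decide) (by decide) (symm _ _ h3) h03 h13

lemma not_three_adjacent {a b c d m : ℤ} (hab : ¬ m ∣ a - b) (hac : ¬ m ∣ a - c)
    (hbc : ¬ m ∣ b - c) (ha : m ∣ a - d - 1 ∨ m ∣ a - d + 1) (hb : m ∣ b - d - 1 ∨ m ∣ b - d + 1)
    (hc : m ∣ c - d - 1 ∨ m ∣ c - d + 1) : False := by
  have h1 : ∀ x y : ℤ, m ∣ x - d - 1 → m ∣ y - d - 1 → m ∣ x - y := fun x y h h' =>
    dvd_of_eq_sub h h' (by ring)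
  have h2 : ∀ x y : ℤ, m ∣ x - d + 1 → m ∣ y - d + 1 → m ∣ x - y := fun x y h h' =>
    dvd_of_eq_sub h h' (by ring)
  rcases ha with ha | ha <;> rcases hb with hb | hb <;> rcases hc with hc | hc
  all_goals first
    | exact hab (h1 _ _ ha hb)
    | exact hab (h2 _ _ ha hb)
    | exact hac (h1 _ _ ha hc)
    | exact hac (h2 _ _ ha hc)
    | exact hbc (h1 _ _ hb hc)
    | exact hbc (h2 _ _ hb hc)

lemma not_adjacent_triangle (hm : 5 ≤ m) {a b c : ℤ} (hab : ¬ (m : ℤ) ∣ a - b)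
    (ha : (m : ℤ) ∣ a - c - 1 ∨ (m : ℤ) ∣ a - c + 1)
    (hb : (m : ℤ) ∣ b - c - 1 ∨ (m : ℤ) ∣ b - c + 1) :
    ¬ ((m : ℤ) ∣ a - b - 1 ∨ (m : ℤ) ∣ a - b + 1) := by
  have h1 : ¬ (m : ℤ) ∣ 1 := not_dvd_of_lt (by norm_num) (by norm_num; omega)
  have h3 : ¬ (m : ℤ) ∣ 3 := not_dvd_of_lt (by norm_num) (by norm_num; omega)
  intro h
  rcases ha with ha | ha <;> rcases hb with hb | hb
  · exact hab (dvd_of_eq_sub ha hb (by ring))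
  · rcases h with h | h
    · exact h1 (dvd_of_eq_sub h (dvd_sub ha hb) (by ring))
    · exact h3 (dvd_of_eq_sub h (dvd_sub ha hb) (by ring))
  · rcases h with h | h
    · exact h3 (dvd_of_eq_sub (dvd_sub ha hb) h (by ring))
    · exact h1 (dvd_of_eq_sub (dvd_sub ha hb) h (by ring))
  · exact hab (dvd_of_eq_sub ha hb (by ring))

/-- A linear functional restricted to a line is monotone. If the outer two of three ordered points
lay in cells not adjacent to the middle cell `b`, their products with `mid b` would be below `r *
apo m`, hence also that of the middle point, which is false in cell `b`. -/
lemma not_five_on_line (hm : 5 ≤ m) (hr : 0 < r)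
    (h : R * Real.cos (3 * (Real.pi / m)) < r * apo m) (p v : E2) (s : Fin 5 → ℝ)
    (hs : Monotone s) (k : Fin 5 → ℤ) (hk : ∀ i j, i ≠ j → ¬ (m : ℤ) ∣ k i - k j)
    (hmem : ∀ i, p + s i • v ∈ ringCell m φ r R (k i)) : False := by
  refine not_five_of_adjacency
    (fun i j => (m : ℤ) ∣ k i - k j - 1 ∨ (m : ℤ) ∣ k i - k j + 1) ?_ ?_ ?_ ?_
  · intro a b c hab hbc
    by_contra hcon
    push Not at hcon
    have ha := inner_mid_lt_of_far hm hr h (hk a b hab.ne) hcon.1.1 hcon.1.2 (hmem a)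
    have hc := inner_mid_lt_of_far hm hr h (hk c b hbc.ne') hcon.2.1 hcon.2.2 (hmem c)
    have hb := (hmem b).2.1
    rw [inner_add_left, inner_smul_left] at ha hb hc
    simp only [conj_trivial] at ha hb hc
    have h1 := hs hab.le
    have h2 := hs hbc.le
    rcases le_total 0 (inner ℝ v (mid m φ (k b))) with hv | hv <;> nlinarith
  · rintro a b (h1 | h1)
    · exact Or.inr (dvd_of_eq_sub (dvd_zero _) h1 (by ring))
    · exact Or.inl (dvd_of_eq_sub (dvd_zero _) h1 (by ring))
  · exact fun a b c d hab hac hbc ha hb hc =>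
      not_three_adjacent (hk _ _ hab) (hk _ _ hac) (hk _ _ hbc) ha hb hc
  · exact fun a b c hab ha hb => not_adjacent_triangle hm (hk _ _ hab) ha hb

lemma isThinRing_of_lt (hm : 5 ≤ m) (hr : 0 < r) (hR : r < R)
    (h : R * Real.cos (3 * (Real.pi / m)) < r * apo m) : IsThinRing m φ r R := by
  intro L hL
  by_contra hcon
  push Not at hcon
  obtain ⟨T, hT, hT5⟩ := Set.exists_subset_encard_eq (Order.add_one_le_of_lt hcon)
  have hT5' : T.encard = (5 : ℕ) := by rw [hT5]; rfl
  have hfin : T.Finite := Set.finite_of_encard_eq_coe hT5'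
  have := hfin.to_subtype
  have hcard : Nat.card T = 5 := by
    rw [Nat.card_coe_set_eq, Set.ncard, hT5']; rfl
  let ε : Fin 5 ≃ T := (Finite.equivFinOfCardEq hcard).symm
  have hex : ∀ i : Fin 5, ∃ (k : ℤ) (y : E2), (ε i : Set E2) = interior (ringCell m φ r R k) ∧
      y ∈ L ∧ y ∈ (ε i : Set E2) := by
    intro i
    obtain ⟨h1, y, hy, hy'⟩ := hT (ε i).2
    rw [ringRegions_eq hm hr hR] at h1
    obtain ⟨k, hk⟩ := h1
    exact ⟨k, y, hk.symm, hy, hy'⟩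
  choose k y hk hyL hyT using hex
  obtain ⟨v, hv, hspan⟩ := finrank_eq_one_iff'.1 hL
  have hparam : ∀ i, ∃ s : ℝ, y i = y 0 + s • (v : E2) := by
    intro i
    obtain ⟨s, hs⟩ := hspan ⟨y i -ᵥ y 0, AffineSubspace.vsub_mem_direction (hyL i) (hyL 0)⟩
    refine ⟨s, ?_⟩
    have := congrArg Subtype.val hs
    simp only [Submodule.coe_smul, vsub_eq_sub] at this
    rw [this]; abel
  choose s hs using hparam
  -- The five points are reordered by their parameter along the line.
  refine not_five_on_line (φ := φ) hm hr h (y 0) v (s ∘ Tuple.sort s) (Tuple.monotone_sort s)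
    (k ∘ Tuple.sort s) ?_ ?_
  · intro i j hij hd
    have : (ε (Tuple.sort s i) : Set E2) = ε (Tuple.sort s j) := by
      rw [hk, hk]
      simp only [Function.comp] at hd
      rw [ringCell_congr hm hd]
    exact hij ((Tuple.sort s).injective (ε.injective (Subtype.ext this)))
  · intro i
    simp only [Function.comp]
    rw [← hs]
    have := hyT (Tuple.sort s i)
    rw [hk] at this
    exact interior_subset this

lemma eventually_isThinRing (hm : 5 ≤ m) (hR : 0 < R) : ∀ᶠ r in 𝓝[<] R, IsThinRing m φ r R := by
  have hc : ContinuousAt (fun r : ℝ => r * apo m) R := by fun_prop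
  have h1 : ∀ᶠ r in 𝓝 R, R * Real.cos (3 * (Real.pi / m)) < r * apo m :=
    continuousAt_const.eventually_lt hc (by have := cos_three_lt hm; gcongr)
  filter_upwards [nhdsWithin_le_nhds h1, nhdsWithin_le_nhds (lt_mem_nhds hR), self_mem_nhdsWithin]
    with r h1 h2 h3 using isThinRing_of_lt hm h2 h3 h1

end Plane

/-! ### The inverse of the gnomonic projection -/

/-- The point of three-space with horizontal part `ξ` and height `t`. -/
def vec (ξ : E2) (t : ℝ) : E3 := !₂[ξ 0, ξ 1, t]

/-- The horizontal part of a point of three-space. -/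
def hor (p : E3) : E2 := !₂[p 0, p 1]

lemma inner_E3 (x y : E3) : inner ℝ x y = x 0 * y 0 + x 1 * y 1 + x 2 * y 2 := by
  simp [PiLp.inner_apply, Fin.sum_univ_three, mul_comm]

lemma vec_hor (p : E3) : vec (hor p) (p 2) = p := by
  ext i; fin_cases i <;> rfl

@[simp] lemma hor_vec (ξ : E2) (t : ℝ) : hor (vec ξ t) = ξ := by
  ext i; fin_cases i <;> rfl

@[simp] lemma vec_two (ξ : E2) (t : ℝ) : vec ξ t 2 = t := rfl

lemma inner_eq_hor (p q : E3) : inner ℝ p q = inner ℝ (hor p) (hor q) + p 2 * q 2 := by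
  rw [inner_E3, inner_E2]; rfl

lemma inner_vec_left (ξ : E2) (t : ℝ) (q : E3) :
    inner ℝ (vec ξ t) q = inner ℝ ξ (hor q) + t * q 2 := by
  rw [inner_eq_hor, hor_vec, vec_two]

lemma hor_add (p q : E3) : hor (p + q) = hor p + hor q := by
  ext i; fin_cases i <;> simp [hor]

lemma hor_sub (p q : E3) : hor (p - q) = hor p - hor q := by
  ext i; fin_cases i <;> simp [hor]

lemma hor_smul (a : ℝ) (p : E3) : hor (a • p) = a • hor p := by
  ext i; fin_cases i <;> simp [hor]

lemma continuous_vec : Continuous fun z : E2 × ℝ => vec z.1 z.2 := by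
  unfold vec
  apply (PiLp.continuous_toLp 2 _).comp
  apply continuous_pi
  intro i
  fin_cases i <;> simp <;> fun_prop

lemma norm_vec_sq (ξ : E2) (t : ℝ) : ‖vec ξ t‖ ^ 2 = ‖ξ‖ ^ 2 + t ^ 2 := by
  rw [← real_inner_self_eq_norm_sq, inner_vec_left, hor_vec, real_inner_self_eq_norm_sq, vec_two]
  ring

lemma norm_vec (y : E2) : ‖vec y (-1)‖ = √(1 + ‖y‖ ^ 2) := by
  rw [← Real.sqrt_sq (norm_nonneg _), norm_vec_sq]
  congr 1; ring

lemma norm_vec_pos (y : E2) : 0 < √(1 + ‖y‖ ^ 2) := by positivity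

/-- The central projection of the plane `x₃ = -1` to the open lower hemisphere. -/
def invGnomonic (y : E2) : S2 :=
  ⟨(√(1 + ‖y‖ ^ 2))⁻¹ • vec y (-1), by
    have := norm_vec_pos y
    rw [mem_sphere_zero_iff_norm, norm_smul, norm_vec, norm_inv, Real.norm_of_nonneg this.le,
      inv_mul_cancel₀ this.ne']⟩

lemma coe_invGnomonic (y : E2) :
    (invGnomonic y : E3) = (√(1 + ‖y‖ ^ 2))⁻¹ • vec y (-1) := rfl

lemma inner_invGnomonic (y : E2) (p : E3) :
    inner ℝ (invGnomonic y : E3) p = (√(1 + ‖y‖ ^ 2))⁻¹ * (inner ℝ y (hor p) - p 2) := by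
  rw [coe_invGnomonic, real_inner_smul_left, inner_vec_left]
  ring

lemma invGnomonic_two (y : E2) : (invGnomonic y : E3) 2 = -(√(1 + ‖y‖ ^ 2))⁻¹ := by
  rw [coe_invGnomonic, PiLp.smul_apply, vec_two]
  simp

lemma invGnomonic_two_neg (y : E2) : (invGnomonic y : E3) 2 < 0 := by
  rw [invGnomonic_two, neg_lt_zero]
  exact inv_pos.2 (norm_vec_pos y)

lemma gnomonic_invGnomonic (y : E2) : gnomonic (invGnomonic y) = y := by
  have := (norm_vec_pos y).ne'
  ext i
  fin_cases i
  · simp [gnomonic, coe_invGnomonic, vec]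
    field_simp
  · simp [gnomonic, coe_invGnomonic, vec]
    field_simp

lemma invGnomonic_injective : Function.Injective invGnomonic :=
  Function.LeftInverse.injective gnomonic_invGnomonic

lemma hor_eq_smul_gnomonic {u : S2} (hu : (u : E3) 2 < 0) :
    hor (u : E3) = (-(u : E3) 2) • gnomonic u := by
  have := hu.ne
  ext i
  fin_cases i <;> simp [hor, gnomonic] <;> field_simp

lemma invGnomonic_gnomonic {u : S2} (hu : (u : E3) 2 < 0) : invGnomonic (gnomonic u) = u := by
  have h0 : 0 < -(u : E3) 2 := by linarith
  have h1 : (u : E3) = (-(u : E3) 2) • vec (gnomonic u) (-1) := by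
    rw [← vec_hor (u : E3), hor_eq_smul_gnomonic hu]
    ext i; fin_cases i <;> simp [vec]
  have h2 : (-(u : E3) 2) * √(1 + ‖gnomonic u‖ ^ 2) = 1 := by
    have h3 : ‖(u : E3)‖ = 1 := mem_sphere_zero_iff_norm.1 u.2
    rw [h1, norm_smul, norm_vec, Real.norm_of_nonneg (by simpa [vec_two] using h0.le)] at h3
    simpa using h3
  apply Subtype.ext
  rw [coe_invGnomonic]
  conv_rhs => rw [h1]
  congr 1
  rw [inv_eq_iff_eq_inv, eq_comm, inv_eq_iff_eq_inv, ← eq_inv_of_mul_eq_one_left h2]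

lemma gnomonicPullback_eq_image (A : Set E2) : gnomonicPullback A = invGnomonic '' A := by
  ext u
  constructor
  · rintro ⟨h, h'⟩
    exact ⟨_, h', invGnomonic_gnomonic h⟩
  · rintro ⟨y, hy, rfl⟩
    exact ⟨invGnomonic_two_neg y, by rwa [gnomonic_invGnomonic]⟩

lemma continuous_invGnomonic : Continuous invGnomonic := by
  apply Continuous.subtype_mk
  apply Continuous.fun_smul
  · exact Continuous.inv₀ (by fun_prop) fun y => (norm_vec_pos y).ne'
  · exact continuous_vec.comp (by fun_prop : Continuous fun y : E2 => (y, (-1 : ℝ)))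

lemma isOpen_gnomonicPullback {A : Set E2} (hA : IsOpen A) : IsOpen (gnomonicPullback A) := by
  have hc : ∀ i : Fin 3, Continuous fun u : S2 => (u : E3) i := fun i => by fun_prop
  have ho : IsOpen {u : S2 | (u : E3) 2 < 0} := isOpen_lt (hc 2) continuous_const
  have hne : ∀ u ∈ {u : S2 | (u : E3) 2 < 0}, (u : E3) 2 ≠ 0 := fun u hu => (ne_of_lt hu)
  suffices h : ContinuousOn gnomonic {u : S2 | (u : E3) 2 < 0} from h.isOpen_inter_preimage ho hA
  refine (PiLp.continuous_toLp 2 _).comp_continuousOn (continuousOn_pi.2 fun i => ?_)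
  fin_cases i
  · exact ((hc 0).continuousOn.div (hc 2).continuousOn hne).neg
  · exact ((hc 1).continuousOn.div (hc 2).continuousOn hne).neg

lemma isOpenMap_invGnomonic : IsOpenMap invGnomonic := fun A hA => by
  rw [← gnomonicPullback_eq_image]
  exact isOpen_gnomonicPullback hA

lemma interior_image_invGnomonic (A : Set E2) :
    interior (invGnomonic '' A) = invGnomonic '' interior A := by
  apply subset_antisymm
  · intro u hu
    obtain ⟨y, hy, rfl⟩ := interior_subset hu
    refine ⟨y, ?_, rfl⟩
    have := preimage_interior_subset_interior_preimage continuous_invGnomonic hu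
    rwa [preimage_image_eq _ invGnomonic_injective] at this
  · exact isOpenMap_invGnomonic.image_interior_subset A

lemma isClosed_image_invGnomonic {K : Set E2} (hK : IsCompact K) :
    IsClosed (invGnomonic '' K) := (hK.image continuous_invGnomonic).isClosed

/-- Compactness makes the image of `K` closed in the whole sphere, so the closure gains nothing at
the equator. -/
lemma closure_image_interior {K : Set E2} (hK : IsCompact K) (h : closure (interior K) = K) :
    closure (invGnomonic '' interior K) = invGnomonic '' K := by
  apply subset_antisymm
  · exact closure_minimal (image_mono interior_subset) (isClosed_image_invGnomonic hK)
  · conv_lhs => rw [← h]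
    exact image_closure_subset_closure_image continuous_invGnomonic

/-! ### The vertices and edges of the ring subdivision -/

section Subdivision

variable {m : ℕ} {φ r R : ℝ}

/-- The vertices of the two concentric polygons. -/
def nodes (m : ℕ) (φ r R : ℝ) : Set E2 :=
  {y | ∃ k : ℤ, y = r • dir m φ k ∨ y = R • dir m φ k}

/-- The closed edges of the planar ring subdivision. -/
def planarEdges (m : ℕ) (φ r R : ℝ) : Set (Set E2) :=
  {A | ∃ k : ℤ, A = segment ℝ (r • dir m φ k) (r • dir m φ (k + 1)) ∨
    A = segment ℝ (r • dir m φ k) (R • dir m φ k) ∨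
    A = segment ℝ (R • dir m φ k) (R • dir m φ (k + 1))}

lemma dir_ne_zero (m : ℕ) (φ : ℝ) (k : ℤ) : dir m φ k ≠ 0 := by
  rw [← norm_ne_zero_iff, norm_dir]; exact one_ne_zero

lemma dir_ne_succ (hm : 5 ≤ m) (φ : ℝ) (k : ℤ) : dir m φ k ≠ dir m φ (k + 1) := by
  intro h
  have h1 := inner_dir_mid_lt hm φ (k := k) (j := k + 1)
    (not_dvd_of_lt (by omega) (by rw [show k - (k + 1) = -1 by ring]; norm_num; omega))
    (not_dvd_of_lt (by omega) (by rw [show k - (k + 1) - 1 = -2 by ring]; norm_num; omega))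
  rw [h, inner_dir_mid_self hm] at h1
  exact lt_irrefl _ h1

lemma nontrivial_of_mem_planarEdges (hm : 5 ≤ m) (hr : 0 < r) (hR : r < R) {A : Set E2}
    (hA : A ∈ planarEdges m φ r R) : A.Nontrivial := by
  have key : ∀ x y : E2, x ≠ y → (segment ℝ x y).Nontrivial := fun x y h =>
    ⟨x, left_mem_segment ℝ x y, y, right_mem_segment ℝ x y, h⟩
  obtain ⟨k, rfl | rfl | rfl⟩ := hA
  · exact key _ _ fun h => dir_ne_succ hm φ k (smul_right_injective _ hr.ne' h)
  · exact key _ _ fun h => hR.ne (smul_left_injective ℝ (dir_ne_zero m φ k) h)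
  · exact key _ _ fun h => dir_ne_succ hm φ k (smul_right_injective _ (hr.trans hR).ne' h)

lemma ringCell_inj (hm : 5 ≤ m) (hr : 0 < r) (hR : r < R) {k j : ℤ}
    (h : ringCell m φ r R k = ringCell m φ r R j) : (m : ℤ) ∣ k - j := by
  by_contra hcon
  have hp : 0 < (r + R) / 4 := by linarith
  have h1 := inner_combination_mid_lt (φ := φ) hm hp hp hcon
  have h2 : ((r + R) / 4) • dir m φ k + ((r + R) / 4) • dir m φ (k + 1) ∈ ringCell m φ r R k :=
    (mem_ringCell_iff hm).2 ⟨_, _, hp.le, hp.le, by linarith, by linarith, rfl⟩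
  rw [h] at h2
  have := h2.1 k
  rw [inner_combination_mid_self hm] at this
  linarith

lemma ringCell_cases (hm : 5 ≤ m) (hr : 0 < r) (k j : ℤ) :
    ringCell m φ r R j = ringCell m φ r R k ∨ ringCell m φ r R j = ringCell m φ r R (k - 1) ∨
      ringCell m φ r R j = ringCell m φ r R (k + 1) ∨
      ringCell m φ r R k ∩ ringCell m φ r R j = ∅ := by
  by_cases h0 : (m : ℤ) ∣ k - j
  · exact Or.inl (ringCell_congr hm h0).symm
  by_cases h1 : (m : ℤ) ∣ k - j - 1
  · exact Or.inr (Or.inl (ringCell_congr hm (by convert h1 using 1; ring)).symm)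
  by_cases h2 : (m : ℤ) ∣ k + 1 - j
  · exact Or.inr (Or.inr (Or.inl (ringCell_congr hm h2).symm))
  · exact Or.inr (Or.inr (Or.inr (ringCell_inter_far hm hr h0 h1 h2)))

lemma ringCell_inter_pred (hm : 5 ≤ m) (hr : 0 < r) (hR : r < R) (k : ℤ) :
    ringCell m φ r R k ∩ ringCell m φ r R (k - 1) =
      segment ℝ (r • dir m φ k) (R • dir m φ k) := by
  have := ringCell_inter_succ (φ := φ) hm hr hR (k - 1)
  rw [sub_add_cancel] at this
  rw [inter_comm, this]

lemma smul_dir_mem_polygon_iff (hm : 5 ≤ m) {ρ μ : ℝ} (hμ : 0 ≤ μ) (k : ℤ) :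
    μ • dir m φ k ∈ polygon m φ ρ ↔ μ ≤ ρ := by
  have := combination_mem_polygon_iff (φ := φ) (ρ := ρ) (k := k) hm hμ le_rfl
  simpa using this

lemma smul_dir_notMem_interior_iff (hm : 5 ≤ m) {ρ μ : ℝ} (hρ : 0 < ρ) (hμ : 0 ≤ μ) (k : ℤ) :
    μ • dir m φ k ∈ (interior (polygon m φ ρ))ᶜ ↔ ρ ≤ μ := by
  have hc := apo_pos hm
  rw [interior_polygon hm hρ]
  constructor
  · intro h
    by_contra hcon
    push Not at hcon
    apply h
    intro j
    rw [real_inner_smul_left]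
    calc _ ≤ μ * apo m := by have := inner_dir_mid_le hm φ k j; gcongr
      _ < _ := by gcongr
  · intro h hcon
    have := hcon k
    rw [real_inner_smul_left, inner_dir_mid_self hm] at this
    have := lt_of_mul_lt_mul_right this hc.le
    linarith

/-- The traces in the plane of the closures of the regions of the completed ring subdivision. -/
def IsClosedTrace (m : ℕ) (φ r R : ℝ) (K : Set E2) : Prop :=
  K = polygon m φ r ∨ (∃ k, K = ringCell m φ r R k) ∨ K = (interior (polygon m φ R))ᶜ

/-- This makes intersections of more than two closures harmless: adding a region to the family
either keeps the whole edge or leaves at most one node. -/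
lemma planarEdge_subset_or (hm : 5 ≤ m) (hr : 0 < r) (hR : r < R) {A K : Set E2}
    (hA : A ∈ planarEdges m φ r R) (hK : IsClosedTrace m φ r R K) :
    A ⊆ K ∨ ∃ p ∈ nodes m φ r R, A ∩ K ⊆ {p} := by
  have hR0 := hr.trans hR
  have hIX := polygon_subset_interior (φ := φ) hm hr hR
  obtain ⟨k, rfl | rfl | rfl⟩ := hA
  · rcases hK with rfl | ⟨j, rfl⟩ | rfl
    · left
      rw [← polygon_inter_ringCell hm hr hR k]
      exact inter_subset_left
    · rw [← polygon_inter_ringCell hm hr hR k]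
      rcases ringCell_cases (φ := φ) (R := R) hm hr k j with h | h | h | h
      · left; rw [h]; exact inter_subset_right
      · right
        refine ⟨r • dir m φ k, ⟨k, Or.inl rfl⟩, ?_⟩
        rintro y ⟨⟨hy, hy1⟩, hy2⟩
        rw [h] at hy2
        have := ringCell_inter_pred hm hr hR k ▸ (mem_inter hy1 hy2)
        obtain ⟨μ, h1, h2, rfl⟩ := (mem_spoke_iff hR).1 this
        have := (smul_dir_mem_polygon_iff hm (by linarith) k).1 hy
        rw [le_antisymm this h1]; rfl
      · right
        refine ⟨r • dir m φ (k + 1), ⟨k + 1, Or.inl rfl⟩, ?_⟩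
        rintro y ⟨⟨hy, hy1⟩, hy2⟩
        rw [h] at hy2
        have := ringCell_inter_succ hm hr hR k ▸ (mem_inter hy1 hy2)
        obtain ⟨μ, h1, h2, rfl⟩ := (mem_spoke_iff hR).1 this
        have := (smul_dir_mem_polygon_iff hm (by linarith) _).1 hy
        rw [le_antisymm this h1]; rfl
      · right
        -- The intersection is empty here, so any node serves; the same default is used in the other
        -- empty cases.
        refine ⟨r • dir m φ k, ⟨k, Or.inl rfl⟩, ?_⟩
        rintro y ⟨⟨hy, hy1⟩, hy2⟩
        exact absurd (mem_inter hy1 hy2) (by rw [h]; exact notMem_empty _)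
    · right
      refine ⟨r • dir m φ k, ⟨k, Or.inl rfl⟩, ?_⟩
      rw [← polygon_inter_ringCell hm hr hR k]
      rintro y ⟨⟨hy, hy1⟩, hy2⟩
      exact absurd (hIX hy) hy2
  · rw [← ringCell_inter_pred hm hr hR k]
    rcases hK with rfl | ⟨j, rfl⟩ | rfl
    · right
      refine ⟨r • dir m φ k, ⟨k, Or.inl rfl⟩, ?_⟩
      rw [ringCell_inter_pred hm hr hR k]
      rintro y ⟨hy1, hy⟩
      obtain ⟨μ, h1, h2, rfl⟩ := (mem_spoke_iff hR).1 hy1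
      have := (smul_dir_mem_polygon_iff hm (by linarith) k).1 hy
      rw [le_antisymm this h1]; rfl
    · rcases ringCell_cases (φ := φ) (R := R) hm hr k j with h | h | h | h
      · left; rw [h]; exact inter_subset_left
      · left; rw [h]; exact inter_subset_right
      · right
        refine ⟨r • dir m φ k, ⟨k, Or.inl rfl⟩, ?_⟩
        rintro y ⟨⟨hy, hy1⟩, hy2⟩
        rw [h] at hy2
        have h3 : ringCell m φ r R (k + 1) ∩ ringCell m φ r R (k - 1) = ∅ := by
          apply ringCell_inter_far hm hr
          · rw [show k + 1 - (k - 1) = 2 by ring]; exact not_dvd_two hm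
          · rw [show k + 1 - (k - 1) - 1 = 1 by ring]
            exact not_dvd_of_lt (by norm_num) (by norm_num; omega)
          · rw [show k + 1 + 1 - (k - 1) = 3 by ring]
            exact not_dvd_of_lt (by norm_num) (by norm_num; omega)
        exact absurd (mem_inter hy2 hy1) (by rw [h3]; exact notMem_empty _)
      · right
        refine ⟨r • dir m φ k, ⟨k, Or.inl rfl⟩, ?_⟩
        rintro y ⟨⟨hy, hy1⟩, hy2⟩
        exact absurd (mem_inter hy hy2) (by rw [h]; exact notMem_empty _)
    · right
      refine ⟨R • dir m φ k, ⟨k, Or.inr rfl⟩, ?_⟩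
      rw [ringCell_inter_pred hm hr hR k]
      rintro y ⟨hy1, hy⟩
      obtain ⟨μ, h1, h2, rfl⟩ := (mem_spoke_iff hR).1 hy1
      have := (smul_dir_notMem_interior_iff hm hR0 (by linarith) k).1 hy
      rw [le_antisymm h2 this]; rfl
  · rw [← ringCell_sdiff_interior hm hr hR k]
    rcases hK with rfl | ⟨j, rfl⟩ | rfl
    · right
      refine ⟨r • dir m φ k, ⟨k, Or.inl rfl⟩, ?_⟩
      rintro y ⟨⟨hy, hy1⟩, hy2⟩
      exact absurd (hIX hy2) hy1
    · rcases ringCell_cases (φ := φ) (R := R) hm hr k j with h | h | h | h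
      · left; rw [h]; exact inter_subset_left
      · right
        refine ⟨R • dir m φ k, ⟨k, Or.inr rfl⟩, ?_⟩
        rintro y ⟨⟨hy1, hy⟩, hy2⟩
        rw [h] at hy2
        have := ringCell_inter_pred hm hr hR k ▸ (mem_inter hy1 hy2)
        obtain ⟨μ, h1, h2, rfl⟩ := (mem_spoke_iff hR).1 this
        have := (smul_dir_notMem_interior_iff hm hR0 (by linarith) k).1 hy
        rw [le_antisymm h2 this]; rfl
      · right
        refine ⟨R • dir m φ (k + 1), ⟨k + 1, Or.inr rfl⟩, ?_⟩
        rintro y ⟨⟨hy1, hy⟩, hy2⟩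
        rw [h] at hy2
        have := ringCell_inter_succ hm hr hR k ▸ (mem_inter hy1 hy2)
        obtain ⟨μ, h1, h2, rfl⟩ := (mem_spoke_iff hR).1 this
        have := (smul_dir_notMem_interior_iff hm hR0 (by linarith) _).1 hy
        rw [le_antisymm h2 this]; rfl
      · right
        refine ⟨r • dir m φ k, ⟨k, Or.inl rfl⟩, ?_⟩
        rintro y ⟨⟨hy, hy1⟩, hy2⟩
        exact absurd (mem_inter hy hy2) (by rw [h]; exact notMem_empty _)
    · left; exact inter_subset_right

lemma traces_inter (hm : 5 ≤ m) (hr : 0 < r) (hR : r < R) {K K' : Set E2}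
    (hK : IsClosedTrace m φ r R K) (hK' : IsClosedTrace m φ r R K') (hne : K ≠ K') :
    K ∩ K' = ∅ ∨ K ∩ K' ∈ planarEdges m φ r R := by
  have hIX := polygon_subset_interior (φ := φ) hm hr hR
  have hIX' : polygon m φ r ∩ (interior (polygon m φ R))ᶜ = ∅ := by
    rw [← sdiff_eq]
    exact sdiff_eq_empty.2 hIX
  rcases hK with rfl | ⟨k, rfl⟩ | rfl <;> rcases hK' with rfl | ⟨j, rfl⟩ | rfl
  · exact absurd rfl hne
  · exact Or.inr ⟨j, Or.inl (polygon_inter_ringCell hm hr hR j)⟩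
  · exact Or.inl hIX'
  · rw [inter_comm]
    exact Or.inr ⟨k, Or.inl (polygon_inter_ringCell hm hr hR k)⟩
  · rcases ringCell_cases (φ := φ) (R := R) hm hr k j with h | h | h | h
    · exact absurd h.symm hne
    · rw [h]
      exact Or.inr ⟨k, Or.inr (Or.inl (ringCell_inter_pred hm hr hR k))⟩
    · rw [h]
      exact Or.inr ⟨k + 1, Or.inr (Or.inl (ringCell_inter_succ hm hr hR k))⟩
    · exact Or.inl h
  · exact Or.inr ⟨k, Or.inr (Or.inr (ringCell_sdiff_interior hm hr hR k))⟩
  · rw [inter_comm]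
    exact Or.inl hIX'
  · rw [inter_comm]
    exact Or.inr ⟨j, Or.inr (Or.inr (ringCell_sdiff_interior hm hr hR j))⟩
  · exact absurd rfl hne

/-! ### The pull-back to the sphere -/

lemma ringSubdivision_eq (hm : 5 ≤ m) (hr : 0 < r) (hR : r < R) :
    ringSubdivision (m + 1) φ r R = insert (invGnomonic '' interior (polygon m φ r))
      (range fun k : ℤ => invGnomonic '' interior (ringCell m φ r R k)) := by
  rw [ringSubdivision, Nat.add_sub_cancel, image_insert_eq, innerRegion_eq hm hr,
    ringRegions_eq hm hr hR, gnomonicPullback_eq_image, ← range_comp]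
  simp only [Function.comp_def, gnomonicPullback_eq_image]

lemma closure_inner (hm : 5 ≤ m) (hr : 0 < r) :
    closure (invGnomonic '' interior (polygon m φ r)) = invGnomonic '' polygon m φ r :=
  closure_image_interior (isCompact_polygon hm hr) (closure_interior_polygon hm hr)

lemma closure_ring (hm : 5 ≤ m) (hr : 0 < r) (hR : r < R) (k : ℤ) :
    closure (invGnomonic '' interior (ringCell m φ r R k)) = invGnomonic '' ringCell m φ r R k :=
  closure_image_interior (isCompact_ringCell hm hr hR k) (closure_interior_ringCell hm hr hR k)

lemma closure_image_ringSubdivision (hm : 5 ≤ m) (hr : 0 < r) (hR : r < R) :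
    closure '' ringSubdivision (m + 1) φ r R = insert (invGnomonic '' polygon m φ r)
      (range fun k : ℤ => invGnomonic '' ringCell m φ r R k) := by
  rw [ringSubdivision_eq hm hr hR, image_insert_eq, closure_inner hm hr, ← range_comp]
  simp only [Function.comp_def, closure_ring hm hr hR]

lemma biUnion_closure_ringSubdivision (hm : 5 ≤ m) (hr : 0 < r) (hR : r < R) :
    ⋃ T ∈ ringSubdivision (m + 1) φ r R, closure T = invGnomonic '' polygon m φ R := by
  rw [ringSubdivision_eq hm hr hR, biUnion_insert, closure_inner hm hr, biUnion_range,
    ← polygon_union_ringCells hm hr hR, image_union, image_iUnion]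
  simp only [closure_ring hm hr hR]

/-- The north pole is never reached from the plane, so the exterior region always belongs to the
completed subdivision. -/
lemma exterior_nonempty (A : Set E2) : ((invGnomonic '' A)ᶜ : Set S2).Nonempty := by
  refine ⟨⟨vec 0 1, ?_⟩, ?_⟩
  · have h := norm_vec_sq 0 1
    rw [mem_sphere_zero_iff_norm]
    simp only [norm_zero] at h
    nlinarith [norm_nonneg (vec 0 1)]
  · rintro ⟨y, _, hy⟩
    have h1 := invGnomonic_two_neg y
    rw [hy] at h1
    simp only [vec_two] at h1
    linarith

lemma mem_completedSubdivision (hm : 5 ≤ m) (hr : 0 < r) (hR : r < R) {S : Set S2} :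
    S ∈ completedSubdivision (ringSubdivision (m + 1) φ r R) ↔
      S = invGnomonic '' interior (polygon m φ r) ∨
      (∃ k : ℤ, S = invGnomonic '' interior (ringCell m φ r R k)) ∨
      S = (invGnomonic '' polygon m φ R)ᶜ := by
  unfold completedSubdivision
  rw [mem_ofPred_eq, biUnion_closure_ringSubdivision hm hr hR, ringSubdivision_eq hm hr hR]
  simp only [mem_insert_iff, mem_range, or_assoc]
  constructor
  · rintro (h | ⟨k, h⟩ | ⟨h, _⟩)
    · exact Or.inl h
    · exact Or.inr (Or.inl ⟨k, h.symm⟩)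
    · exact Or.inr (Or.inr h)
  · rintro (h | ⟨k, h⟩ | h)
    · exact Or.inl h
    · exact Or.inr (Or.inl ⟨k, h.symm⟩)
    · exact Or.inr (Or.inr ⟨h, h ▸ exterior_nonempty _⟩)

lemma closure_exterior (m : ℕ) (φ R : ℝ) : closure (invGnomonic '' polygon m φ R)ᶜ =
    (invGnomonic '' interior (polygon m φ R))ᶜ := by
  rw [closure_compl, interior_image_invGnomonic]

lemma preimage_image_eq' (A : Set E2) : invGnomonic ⁻¹' (invGnomonic '' A) = A :=
  preimage_image_eq _ invGnomonic_injective

lemma isClosedTrace_preimage_closure (hm : 5 ≤ m) (hr : 0 < r) (hR : r < R) {S : Set S2}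
    (hS : S ∈ completedSubdivision (ringSubdivision (m + 1) φ r R)) :
    IsClosedTrace m φ r R (invGnomonic ⁻¹' closure S) := by
  rcases (mem_completedSubdivision hm hr hR).1 hS with rfl | ⟨k, rfl⟩ | rfl
  · rw [closure_inner hm hr, preimage_image_eq']
    exact Or.inl rfl
  · rw [closure_ring hm hr hR, preimage_image_eq']
    exact Or.inr (Or.inl ⟨k, rfl⟩)
  · rw [closure_exterior, preimage_compl, preimage_image_eq']
    exact Or.inr (Or.inr rfl)

/-- The origin distinguishes the inner trace from the others, and a ring cell contains an inner
node, which the exterior trace does not. So distinct regions have distinct traces, as `traces_inter`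
requires. -/
lemma eq_of_trace_eq (hm : 5 ≤ m) (hr : 0 < r) (hR : r < R) {S T : Set S2}
    (hS : S ∈ completedSubdivision (ringSubdivision (m + 1) φ r R))
    (hT : T ∈ completedSubdivision (ringSubdivision (m + 1) φ r R))
    (h : invGnomonic ⁻¹' closure S = invGnomonic ⁻¹' closure T) : S = T := by
  have hR0 := hr.trans hR
  have h0I : (0 : E2) ∈ polygon m φ r := interior_subset (zero_mem_interior_polygon hm hr)
  have h0X : (0 : E2) ∉ (interior (polygon m φ R))ᶜ :=
    not_not.2 (zero_mem_interior_polygon hm hR0)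
  have hTX : ∀ k, ringCell m φ r R k ≠ (interior (polygon m φ R))ᶜ := by
    intro k h
    have h1 : r • dir m φ k ∈ ringCell m φ r R k := smul_dir_mem_ringCell hm hr le_rfl hR.le k
    rw [h, smul_dir_notMem_interior_iff hm hR0 hr.le] at h1
    linarith
  rcases (mem_completedSubdivision hm hr hR).1 hS with rfl | ⟨k, rfl⟩ | rfl <;>
  rcases (mem_completedSubdivision hm hr hR).1 hT with rfl | ⟨j, rfl⟩ | rfl <;>
  simp only [closure_inner hm hr, closure_ring hm hr hR, closure_exterior,
    preimage_compl, preimage_image_eq'] at h ⊢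
  · exact absurd (h ▸ h0I) (zero_notMem_ringCell hm hr j)
  · exact absurd (h ▸ h0I) h0X
  · exact absurd (h.symm ▸ h0I) (zero_notMem_ringCell hm hr k)
  · rw [h]
  · exact absurd h (hTX k)
  · exact absurd (h.symm ▸ h0I) h0X
  · exact absurd h.symm (hTX j)

/-- Two distinct closures meet in nothing or in one edge. Each further closure either contains that
edge or cuts it down to at most a node. -/
lemma boundaryPieces_subset (hm : 5 ≤ m) (hr : 0 < r) (hR : r < R) {A : Set S2}
    (hA : A ∈ boundaryPieces (ringSubdivision (m + 1) φ r R)) :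
    (∃ e ∈ planarEdges m φ r R, A = invGnomonic '' e) ∨
      ∃ p ∈ nodes m φ r R, A = {invGnomonic p} := by
  obtain ⟨hne, F, hF, ⟨S, hS, T, hT, hST⟩, rfl⟩ := hA
  have hTr : ∀ S ∈ F, IsClosedTrace m φ r R (invGnomonic ⁻¹' closure S) := fun S hS =>
    isClosedTrace_preimage_closure hm hr hR (hF hS)
  have hSTtr := traces_inter hm hr hR (hTr S hS) (hTr T hT)
    fun h => hST (eq_of_trace_eq hm hr hR (hF hS) (hF hT) h)
  -- Only the closure of the exterior leaves the lower hemisphere, and `S ≠ T` excludes taking it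
  -- twice.
  have hsub : closure S ∩ closure T ⊆ range invGnomonic := by
    rcases (mem_completedSubdivision hm hr hR).1 (hF hS) with rfl | ⟨k, rfl⟩ | rfl
    · rw [closure_inner hm hr]
      exact inter_subset_left.trans (image_subset_range _ _)
    · rw [closure_ring hm hr hR]
      exact inter_subset_left.trans (image_subset_range _ _)
    rcases (mem_completedSubdivision hm hr hR).1 (hF hT) with rfl | ⟨k, rfl⟩ | rfl
    · rw [closure_inner hm hr]
      exact inter_subset_right.trans (image_subset_range _ _)
    · rw [closure_ring hm hr hR]
      exact inter_subset_right.trans (image_subset_range _ _)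
    · exact absurd rfl hST
  have heq : closure S ∩ closure T =
      invGnomonic '' (invGnomonic ⁻¹' closure S ∩ invGnomonic ⁻¹' closure T) := by
    rw [← preimage_inter, image_preimage_eq_of_subset hsub]
  have hAsub : (⋂ S ∈ F, closure S) ⊆ closure S ∩ closure T :=
    subset_inter (biInter_subset_of_mem hS) (biInter_subset_of_mem hT)
  rcases hSTtr with h | h
  · rw [heq, h, image_empty] at hAsub
    exact absurd (hne.mono hAsub) not_nonempty_empty
  · set e := invGnomonic ⁻¹' closure S ∩ invGnomonic ⁻¹' closure T
    by_cases hall : ∀ U ∈ F, e ⊆ invGnomonic ⁻¹' closure U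
    · left
      refine ⟨e, h, subset_antisymm (hAsub.trans heq.subset) ?_⟩
      exact subset_iInter₂ fun U hU => image_subset_iff.2 (hall U hU)
    · push Not at hall
      obtain ⟨U, hU, hUe⟩ := hall
      right
      obtain ⟨p, hp, hsp⟩ := (planarEdge_subset_or hm hr hR h (hTr U hU)).resolve_left hUe
      refine ⟨p, hp, (hne.subset_singleton_iff).1 fun u hu => ?_⟩
      have h1 := hAsub hu
      rw [heq] at h1
      obtain ⟨y, hy, rfl⟩ := h1
      have h2 : invGnomonic y ∈ closure U := mem_iInter₂.1 hu U hU
      have : y = p := hsp ⟨hy, h2⟩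
      rw [this]; rfl

lemma image_mem_boundaryPieces (hm : 5 ≤ m) (hr : 0 < r) (hR : r < R) {e : Set E2}
    (he : e ∈ planarEdges m φ r R) :
    invGnomonic '' e ∈ boundaryPieces (ringSubdivision (m + 1) φ r R) := by
  have hne := ((nontrivial_of_mem_planarEdges hm hr hR he).nonempty).image invGnomonic
  have hR0 := hr.trans hR
  have pair : ∀ S T : Set S2, S ∈ completedSubdivision (ringSubdivision (m + 1) φ r R) →
      T ∈ completedSubdivision (ringSubdivision (m + 1) φ r R) →
      closure S ≠ closure T → invGnomonic '' e = closure S ∩ closure T →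
      invGnomonic '' e ∈ boundaryPieces (ringSubdivision (m + 1) φ r R) := by
    intro S T hS hT hST h
    refine ⟨hne, {S, T}, ?_, ?_, ?_⟩
    · rintro _ (rfl | rfl) <;> assumption
    · exact ⟨S, by simp, T, by simp, fun h => hST (congrArg closure h)⟩
    · rw [h, biInter_pair]
  have h0 : (0 : E2) ∈ polygon m φ r := interior_subset (zero_mem_interior_polygon hm hr)
  obtain ⟨k, rfl | rfl | rfl⟩ := he
  · refine pair _ _ ((mem_completedSubdivision hm hr hR).2 (Or.inl rfl))
      ((mem_completedSubdivision hm hr hR).2 (Or.inr (Or.inl ⟨k, rfl⟩))) ?_ ?_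
    · rw [closure_inner hm hr, closure_ring hm hr hR]
      intro h
      rw [invGnomonic_injective.image_injective h] at h0
      exact zero_notMem_ringCell hm hr k h0
    · rw [closure_inner hm hr, closure_ring hm hr hR, ← image_inter invGnomonic_injective,
        polygon_inter_ringCell hm hr hR]
  · refine pair _ _ ((mem_completedSubdivision hm hr hR).2 (Or.inr (Or.inl ⟨k, rfl⟩)))
      ((mem_completedSubdivision hm hr hR).2 (Or.inr (Or.inl ⟨k - 1, rfl⟩))) ?_ ?_
    · rw [closure_ring hm hr hR, closure_ring hm hr hR]
      intro h
      have := ringCell_inj hm hr hR (invGnomonic_injective.image_injective h)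
      rw [show k - (k - 1) = 1 by ring] at this
      exact not_dvd_of_lt (by norm_num) (by norm_num; omega) this
    · rw [closure_ring hm hr hR, closure_ring hm hr hR, ← image_inter invGnomonic_injective,
        ringCell_inter_pred hm hr hR]
  · refine pair _ _ ((mem_completedSubdivision hm hr hR).2 (Or.inr (Or.inl ⟨k, rfl⟩)))
      ((mem_completedSubdivision hm hr hR).2 (Or.inr (Or.inr rfl))) ?_ ?_
    · rw [closure_ring hm hr hR, closure_exterior]
      intro h
      obtain ⟨u, hu⟩ := exterior_nonempty univ
      have hu' : u ∈ (invGnomonic '' interior (polygon m φ R))ᶜ := fun ⟨y, _, hy⟩ =>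
        hu ⟨y, mem_univ _, hy⟩
      rw [← h] at hu'
      obtain ⟨y, _, hy⟩ := hu'
      exact hu ⟨y, mem_univ _, hy⟩
    · rw [closure_ring hm hr hR, closure_exterior, ← ringCell_sdiff_interior hm hr hR]
      ext u
      constructor
      · rintro ⟨y, ⟨hy, hy'⟩, rfl⟩
        exact ⟨⟨y, hy, rfl⟩, fun ⟨z, hz, hzy⟩ => hy' (invGnomonic_injective hzy ▸ hz)⟩
      · rintro ⟨⟨y, hy, rfl⟩, h⟩
        exact ⟨y, ⟨hy, fun hy' => h ⟨y, hy', rfl⟩⟩, rfl⟩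

/-- A node is isolated by three regions: the two ring cells sharing its spoke, and the inner region
at radius `r` or the exterior at radius `R`. -/
lemma singleton_mem_boundaryPieces (hm : 5 ≤ m) (hr : 0 < r) (hR : r < R) {p : E2}
    (hp : p ∈ nodes m φ r R) :
    {invGnomonic p} ∈ boundaryPieces (ringSubdivision (m + 1) φ r R) := by
  have hR0 := hr.trans hR
  have triple : ∀ (S : Set S2) (k : ℤ),
      S ∈ completedSubdivision (ringSubdivision (m + 1) φ r R) →
      segment ℝ (r • dir m φ k) (R • dir m φ k) ∩ invGnomonic ⁻¹' closure S = {p} →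
      {invGnomonic p} ∈ boundaryPieces (ringSubdivision (m + 1) φ r R) := by
    intro S k hS h
    refine ⟨singleton_nonempty _, {S, invGnomonic '' interior (ringCell m φ r R k),
      invGnomonic '' interior (ringCell m φ r R (k - 1))}, ?_, ?_, ?_⟩
    · rintro _ (rfl | rfl | rfl)
      · exact hS
      · exact (mem_completedSubdivision hm hr hR).2 (Or.inr (Or.inl ⟨k, rfl⟩))
      · exact (mem_completedSubdivision hm hr hR).2 (Or.inr (Or.inl ⟨k - 1, rfl⟩))
    · refine ⟨invGnomonic '' interior (ringCell m φ r R k), by simp,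
        invGnomonic '' interior (ringCell m φ r R (k - 1)), by simp, fun heq => ?_⟩
      have := congrArg closure heq
      rw [closure_ring hm hr hR, closure_ring hm hr hR] at this
      have := ringCell_inj hm hr hR (invGnomonic_injective.image_injective this)
      rw [show k - (k - 1) = 1 by ring] at this
      exact not_dvd_of_lt (by norm_num) (by norm_num; omega) this
    · rw [biInter_insert, biInter_pair, closure_ring hm hr hR, closure_ring hm hr hR,
        ← image_inter invGnomonic_injective, ringCell_inter_pred hm hr hR, ← image_singleton, ← h,
        image_inter_preimage, inter_comm]
  obtain ⟨k, rfl | rfl⟩ := hp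
  · refine triple _ k ((mem_completedSubdivision hm hr hR).2 (Or.inl rfl)) ?_
    rw [closure_inner hm hr, preimage_image_eq']
    apply subset_antisymm
    · rintro y ⟨hy1, hy⟩
      obtain ⟨μ, h1, h2, rfl⟩ := (mem_spoke_iff hR).1 hy1
      have := (smul_dir_mem_polygon_iff hm (by linarith) k).1 hy
      rw [le_antisymm this h1]; rfl
    · rintro _ rfl
      exact ⟨left_mem_segment ℝ _ _, smul_dir_mem_polygon hm hr.le k⟩
  · refine triple _ k ((mem_completedSubdivision hm hr hR).2 (Or.inr (Or.inr rfl))) ?_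
    rw [closure_exterior, preimage_compl, preimage_image_eq']
    apply subset_antisymm
    · rintro y ⟨hy1, hy⟩
      obtain ⟨μ, h1, h2, rfl⟩ := (mem_spoke_iff hR).1 hy1
      have := (smul_dir_notMem_interior_iff hm hR0 (by linarith) k).1 hy
      rw [le_antisymm h2 this]; rfl
    · rintro _ rfl
      exact ⟨right_mem_segment ℝ _ _, (smul_dir_notMem_interior_iff hm hR0 hR0.le k).2 le_rfl⟩

lemma subdivisionVertices_eq (hm : 5 ≤ m) (hr : 0 < r) (hR : r < R) :
    subdivisionVertices (ringSubdivision (m + 1) φ r R) = invGnomonic '' nodes m φ r R := by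
  ext v
  constructor
  · intro hv
    rcases boundaryPieces_subset hm hr hR hv with ⟨e, he, h⟩ | ⟨p, hp, h⟩
    · have := (nontrivial_of_mem_planarEdges hm hr hR he).image invGnomonic_injective
      rw [← h] at this
      exact absurd this not_nontrivial_singleton
    · exact ⟨p, hp, (singleton_injective h).symm⟩
  · rintro ⟨p, hp, rfl⟩
    exact singleton_mem_boundaryPieces hm hr hR hp

lemma subdivisionClosedEdges_eq (hm : 5 ≤ m) (hr : 0 < r) (hR : r < R) :
    subdivisionClosedEdges (ringSubdivision (m + 1) φ r R) =
      (invGnomonic '' ·) '' planarEdges m φ r R := by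
  ext A
  constructor
  · rintro ⟨hA, hA'⟩
    rcases boundaryPieces_subset hm hr hR hA with ⟨e, he, h⟩ | ⟨p, hp, rfl⟩
    · exact ⟨e, he, h.symm⟩
    · exact absurd hA' not_nontrivial_singleton
  · rintro ⟨e, he, rfl⟩
    exact ⟨image_mem_boundaryPieces hm hr hR he,
      (nontrivial_of_mem_planarEdges hm hr hR he).image invGnomonic_injective⟩

end Subdivision

/-! ### Extreme points of polyhedra and of their shadows -/

lemma starProjection_apply (v : S2) (x : E3) :
    (Submodule.span ℝ {(v : E3)})ᗮ.starProjection x = x - inner ℝ (v : E3) x • (v : E3) := by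
  have hv : ‖(v : E3)‖ = 1 := mem_sphere_zero_iff_norm.1 v.2
  rw [Submodule.starProjection_orthogonal', ← Submodule.starProjection_unit_singleton ℝ hv x]
  rfl

lemma inner_starProjection {v : S2} {u : E3} (h : inner ℝ (v : E3) u = 0) (x : E3) :
    inner ℝ u ((Submodule.span ℝ {(v : E3)})ᗮ.starProjection x) = inner ℝ u x := by
  rw [starProjection_apply, inner_sub_right, inner_smul_right, real_inner_comm (v : E3) u, h]
  simp

lemma starProjection_eq_iff {v : S2} {x y : E3} :
    (Submodule.span ℝ {(v : E3)})ᗮ.starProjection x =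
      (Submodule.span ℝ {(v : E3)})ᗮ.starProjection y ↔ ∃ s : ℝ, x - y = s • (v : E3) := by
  have hv : ‖(v : E3)‖ = 1 := mem_sphere_zero_iff_norm.1 v.2
  rw [← sub_eq_zero, ← map_sub, starProjection_apply, sub_eq_zero]
  constructor
  · exact fun h => ⟨_, h⟩
  · rintro ⟨s, hs⟩
    rw [hs, real_inner_smul_right, real_inner_self_eq_norm_sq, hv]
    simp

lemma mem_extremePoints_of_exposed {A : Set E3} {x u : E3} (hx : x ∈ A)
    (h : ∀ y ∈ A, y ≠ x → inner ℝ u y < inner ℝ u x) : x ∈ A.extremePoints ℝ := by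
  refine ⟨hx, fun y hy z hz hxyz => ?_⟩
  by_contra hne
  obtain ⟨a, b, ha, hb, hab, rfl⟩ := hxyz
  have h1 := h y hy hne
  have h2 : inner ℝ u z ≤ inner ℝ u (a • y + b • z) := by
    by_cases hz' : z = a • y + b • z
    · rw [← hz']
    · exact (h z hz hz').le
  have h3 : inner ℝ u (a • y + b • z) = a * inner ℝ u y + b * inner ℝ u z := by
    rw [inner_add_right, inner_smul_right, inner_smul_right]
  obtain rfl : b = 1 - a := by linarith
  nlinarith

/-- A functional orthogonal to `v` takes the same values on the shadow as on `P`. So points exposed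
by such functionals project to distinct vertices of the shadow. -/
lemma encard_le_shadowNumberAt {v : S2} {P U : Set E3} (hU : U ⊆ P)
    (h : ∀ x ∈ U, ∃ u : E3, inner ℝ (v : E3) u = 0 ∧ ∀ y ∈ P, y ≠ x → inner ℝ u y < inner ℝ u x) :
    U.encard ≤ shadowNumberAt v P := by
  refine Set.encard_le_encard_of_injOn
    (f := (Submodule.span ℝ {(v : E3)})ᗮ.starProjection) ?_ ?_
  · intro x hx
    obtain ⟨u, hvu, hu⟩ := h x hx
    refine mem_extremePoints_of_exposed (u := u) (mem_image_of_mem _ (hU hx)) ?_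
    rintro _ ⟨y, hy, rfl⟩ hne
    rw [inner_starProjection hvu, inner_starProjection hvu]
    exact hu y hy fun hyx => hne (by rw [hyx])
  · intro x hx y hy hxy
    by_contra hne
    obtain ⟨u, hvu, hu⟩ := h x hx
    have h1 := hu y (hU hy) (Ne.symm hne)
    rw [← inner_starProjection hvu y, ← inner_starProjection hvu x, hxy] at h1
    exact lt_irrefl _ h1

/-! ### Active constraints, and shadow vertices of general polyhedra -/

section Polyhedron

variable {s : Finset (E3 × ℝ)} {P : Set E3}

/-- If `d` is tangent to all active constraints, then small moves of `x` by multiples of `±d` stay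
in `P`, contradicting extremality unless `d = 0`. -/
lemma eq_zero_of_active (hP : P = {x | ∀ h ∈ s, inner ℝ h.1 x ≤ h.2}) {x d : E3}
    (hx : x ∈ polyVertices P) (hd : ∀ h ∈ s, inner ℝ h.1 x = h.2 → inner ℝ h.1 d = 0) : d = 0 := by
  have hxP : ∀ h ∈ s, inner ℝ h.1 x ≤ h.2 := by have := hx.1; rwa [hP] at this
  have hev : ∀ᶠ t : ℝ in 𝓝 0, ∀ h ∈ s, inner ℝ h.1 (x + t • d) ≤ h.2 := by
    rw [Filter.eventually_all_finset]
    intro h hs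
    rcases (hxP h hs).eq_or_lt with he | hlt
    · refine Eventually.of_forall fun t => ?_
      rw [inner_add_right, inner_smul_right, hd h hs he, he]
      simp
    · have hc : ContinuousAt (fun t : ℝ => inner ℝ h.1 (x + t • d)) 0 := by fun_prop
      have := hc.eventually_lt (continuousAt_const (y := h.2)) (by simpa using hlt)
      filter_upwards [this] with t ht using ht.le
  obtain ⟨ε, hε, hb⟩ := Metric.eventually_nhds_iff.1 hev
  have h1 : x + (ε / 2) • d ∈ P := by
    rw [hP]; exact hb (by rw [dist_zero_right, Real.norm_of_nonneg (by positivity)]; linarith)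
  have h2 : x + (-(ε / 2)) • d ∈ P := by
    rw [hP]
    exact hb (by rw [dist_zero_right, norm_neg, Real.norm_of_nonneg (by positivity)]; linarith)
  have h3 := hx.2 h1 h2 ⟨1 / 2, 1 / 2, by norm_num, by norm_num, by norm_num, by module⟩
  have h4 : (ε / 2) • d = 0 := by simpa using h3
  exact (smul_eq_zero.1 h4).resolve_left (by positivity)

/-- The sum of the active normals works: a point attaining equality is tight in every active
constraint, so its difference from `x` vanishes by `eq_zero_of_active`. -/
lemma exists_exposing (hP : P = {x | ∀ h ∈ s, inner ℝ h.1 x ≤ h.2}) {x : E3}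
    (hx : x ∈ polyVertices P) : ∃ u : E3, ∀ y ∈ P, y ≠ x → inner ℝ u y < inner ℝ u x := by
  classical
  have hxP : ∀ h ∈ s, inner ℝ h.1 x ≤ h.2 := by have := hx.1; rwa [hP] at this
  set T := s.filter fun h => inner ℝ h.1 x = h.2 with hT
  refine ⟨∑ h ∈ T, h.1, fun y hy hne => ?_⟩
  have hyP : ∀ h ∈ s, inner ℝ h.1 y ≤ h.2 := by rwa [hP] at hy
  rw [sum_inner, sum_inner]
  have hle : ∀ h ∈ T, inner ℝ h.1 y ≤ inner ℝ h.1 x := fun h hh => by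
    rw [(Finset.mem_filter.1 hh).2]; exact hyP h (Finset.mem_filter.1 hh).1
  refine Finset.sum_lt_sum hle ?_
  by_contra hcon
  push Not at hcon
  refine hne (sub_eq_zero.1 (eq_zero_of_active hP hx fun h hh he => ?_))
  have hhT : h ∈ T := Finset.mem_filter.2 ⟨hh, he⟩
  rw [inner_sub_right, sub_eq_zero]
  exact le_antisymm (hle h hhT) (hcon h hhT)

lemma mem_vertices_of_active (hP : P = {x | ∀ h ∈ s, inner ℝ h.1 x ≤ h.2}) {x : E3} (hx : x ∈ P)
    (hd : ∀ d : E3, (∀ h ∈ s, inner ℝ h.1 x = h.2 → inner ℝ h.1 d = 0) → d = 0) :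
    x ∈ polyVertices P := by
  refine ⟨hx, fun y hy z hz hxyz => sub_eq_zero.1 (hd _ fun h hh he => ?_)⟩
  obtain ⟨a, b, ha, hb, hab, rfl⟩ := hxyz
  have hy' : inner ℝ h.1 y ≤ h.2 := by rw [hP] at hy; exact hy h hh
  have hz' : inner ℝ h.1 z ≤ h.2 := by rw [hP] at hz; exact hz h hh
  rw [inner_sub_right, he]
  rw [inner_add_right, inner_smul_right, inner_smul_right] at he
  obtain rfl : b = 1 - a := by linarith
  nlinarith

/-- The fibre of `P` over `q` is bounded in one of its two directions, because a polyhedron with a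
vertex contains no line. Its endpoint on that side is extreme: extremality of `q` keeps any segment
through it inside the fibre. -/
lemma exists_vertex_over (hP : P = {x | ∀ h ∈ s, inner ℝ h.1 x ≤ h.2})
    (hne : (polyVertices P).Nonempty) {v : S2} {q : E3} (hq : q ∈ polyVertices (shadow v P)) :
    ∃ x ∈ polyVertices P, (Submodule.span ℝ {(v : E3)})ᗮ.starProjection x = q := by
  have hv : (v : E3) ≠ 0 := ne_zero_of_mem_unit_sphere v
  have hmem : ∀ x, x ∈ P ↔ ∀ h ∈ s, inner ℝ h.1 x ≤ h.2 := fun x => by rw [hP]; rfl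
  obtain ⟨x₁, hx₁⟩ := hne
  -- Some constraint varies along `v`; otherwise `v` would be tangent to all active constraints at
  -- the given vertex. The sign of `w` is then chosen so that this constraint bounds the fibre
  -- above.
  obtain ⟨h, hs, hhv⟩ : ∃ h ∈ s, inner ℝ h.1 (v : E3) ≠ 0 := by
    by_contra hcon
    push Not at hcon
    exact hv (eq_zero_of_active hP hx₁ fun h hh _ => hcon h hh)
  obtain ⟨w, hw, hwv, hhw⟩ : ∃ w : E3, w ≠ 0 ∧ (w = (v : E3) ∨ w = -(v : E3)) ∧
      0 < inner ℝ h.1 w := by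
    rcases hhv.lt_or_gt with hlt | hgt
    · exact ⟨-(v : E3), neg_ne_zero.2 hv, Or.inr rfl, by rw [inner_neg_right]; linarith⟩
    · exact ⟨v, hv, Or.inl rfl, hgt⟩
  have hpw : ∀ x y : E3, (Submodule.span ℝ {(v : E3)})ᗮ.starProjection x =
      (Submodule.span ℝ {(v : E3)})ᗮ.starProjection y ↔ ∃ t : ℝ, x - y = t • w := by
    intro x y
    rw [starProjection_eq_iff]
    rcases hwv with rfl | rfl
    · rfl
    · exact ⟨fun ⟨t, ht⟩ => ⟨-t, by simpa using ht⟩, fun ⟨t, ht⟩ => ⟨-t, by simpa using ht⟩⟩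
  obtain ⟨⟨x, hx, rfl⟩, hext⟩ := hq
  let T : Set ℝ := {t | x + t • w ∈ P}
  have hTne : T.Nonempty := ⟨0, by simpa [T] using hx⟩
  have hTclosed : IsClosed T := by
    have : T = ⋂ h ∈ s, {t : ℝ | inner ℝ h.1 (x + t • w) ≤ h.2} := by
      ext t; simp only [T, mem_ofPred_eq, hmem, mem_iInter]
    rw [this]
    exact isClosed_biInter fun h _ => isClosed_le (by fun_prop) continuous_const
  have hTbdd : BddAbove T := by
    refine ⟨(h.2 - inner ℝ h.1 x) / inner ℝ h.1 w, fun t ht => ?_⟩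
    have := (hmem _).1 ht h hs
    rw [inner_add_right, inner_smul_right] at this
    rw [le_div_iff₀ hhw]
    linarith
  have htop := hTclosed.csSup_mem hTne hTbdd
  set t₀ := sSup T
  refine ⟨x + t₀ • w, ⟨htop, fun y hy z hz hyz => ?_⟩, (hpw _ _).2 ⟨t₀, by simp⟩⟩
  have hπ : (Submodule.span ℝ {(v : E3)})ᗮ.starProjection (x + t₀ • w) =
      (Submodule.span ℝ {(v : E3)})ᗮ.starProjection x := (hpw _ _).2 ⟨t₀, by simp⟩
  have hseg : (Submodule.span ℝ {(v : E3)})ᗮ.starProjection x ∈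
      openSegment ℝ ((Submodule.span ℝ {(v : E3)})ᗮ.starProjection y)
        ((Submodule.span ℝ {(v : E3)})ᗮ.starProjection z) := by
    obtain ⟨a, b, ha, hb, hab, h⟩ := hyz
    exact ⟨a, b, ha, hb, hab, by rw [← hπ, ← h, map_add, map_smul, map_smul]⟩
  have hy' := hext (mem_image_of_mem _ hy) (mem_image_of_mem _ hz) hseg
  have hz' := hext (mem_image_of_mem _ hz) (mem_image_of_mem _ hy) (by
    rwa [openSegment_symm])
  obtain ⟨t₁, h₁⟩ := (hpw _ _).1 hy'
  obtain ⟨t₂, h₂⟩ := (hpw _ _).1 hz'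
  have ey : y = x + t₁ • w := by rw [← h₁]; abel
  have ez : z = x + t₂ • w := by rw [← h₂]; abel
  have l₁ : t₁ ≤ t₀ := le_csSup hTbdd (show x + t₁ • w ∈ P from ey ▸ hy)
  have l₂ : t₂ ≤ t₀ := le_csSup hTbdd (show x + t₂ • w ∈ P from ez ▸ hz)
  obtain ⟨a, b, ha, hb, hab, h⟩ := hyz
  rw [ey, ez] at h
  have h3 : (a * t₁ + b * t₂ - t₀) • w = 0 := by
    have e : a • (x + t₁ • w) + b • (x + t₂ • w) = (a + b) • x + (a * t₁ + b * t₂) • w := by module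
    rw [e, hab, one_smul] at h
    rw [sub_smul, sub_eq_zero]
    exact add_left_cancel h
  have h4 := (smul_eq_zero.1 h3).resolve_right hw
  have : t₁ = t₀ := by
    obtain rfl : b = 1 - a := by linarith
    nlinarith
  rw [ey, this]

lemma shadowNumberAt_le (hP : P = {x | ∀ h ∈ s, inner ℝ h.1 x ≤ h.2})
    (hne : (polyVertices P).Nonempty) (v : S2) : shadowNumberAt v P ≤ (polyVertices P).encard := by
  have : polyVertices (shadow v P) ⊆
      (Submodule.span ℝ {(v : E3)})ᗮ.starProjection '' polyVertices P := fun q hq => by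
    obtain ⟨x, hx, h⟩ := exists_vertex_over hP hne hq
    exact ⟨x, hx, h⟩
  exact (Set.encard_le_encard this).trans (Set.encard_image_le _ _)

lemma exists_unit_orthogonal (u : E3) : ∃ v : S2, inner ℝ (v : E3) u = 0 := by
  obtain ⟨w, hw, h⟩ : ∃ w : E3, w ≠ 0 ∧ inner ℝ w u = 0 := by
    by_cases h : u 0 = 0 ∧ u 1 = 0
    · refine ⟨!₂[1, 0, 0], fun h0 => ?_, by simp [inner_E3, h.1]⟩
      simpa using congrArg (fun x : E3 => x 0) h0
    · refine ⟨!₂[-u 1, u 0, 0], fun h0 => h ?_, by simp [inner_E3]; ring⟩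
      have e0 := congrArg (fun x : E3 => x 0) h0
      have e1 := congrArg (fun x : E3 => x 1) h0
      simp at e0 e1
      exact ⟨e1, e0⟩
  refine ⟨⟨‖w‖⁻¹ • w, ?_⟩, ?_⟩
  · rw [mem_sphere_zero_iff_norm, norm_smul, norm_inv, norm_norm,
      inv_mul_cancel₀ (norm_ne_zero_iff.2 hw)]
  · change inner ℝ (‖w‖⁻¹ • w) u = 0
    rw [real_inner_smul_left, h, mul_zero]

lemma one_le_shadowNumber (hP : P = {x | ∀ h ∈ s, inner ℝ h.1 x ≤ h.2})
    (hne : (polyVertices P).Nonempty) : 1 ≤ shadowNumber P := by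
  obtain ⟨x, hx⟩ := hne
  obtain ⟨u, hu⟩ := exists_exposing hP hx
  obtain ⟨v, hv⟩ := exists_unit_orthogonal u
  refine le_trans ?_ (le_iSup (fun v => shadowNumberAt v P) v)
  rw [← Set.encard_singleton x]
  refine encard_le_shadowNumberAt (singleton_subset_iff.2 hx.1) ?_
  rintro _ rfl
  exact ⟨u, hv, hu⟩

end Polyhedron

/-! ### The tangent polyhedron of the ring subdivision -/

section Cap

variable {m : ℕ} {φ r R : ℝ}

/-- The slack of the point `p` in the half-space tangent to the sphere at the pull-back of the
`k`-th vertex of the polygon of circumradius `ρ` (up to a positive factor). -/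
def slack (m : ℕ) (φ ρ : ℝ) (k : ℤ) (p : E3) : ℝ :=
  √(1 + ρ ^ 2) + p 2 - ρ * inner ℝ (dir m φ k) (hor p)

/-- The intersection of the half-spaces tangent to the sphere at the pull-backs of the vertices
of the two concentric polygons. -/
def cap (m : ℕ) (φ r R : ℝ) : Set E3 :=
  {p | ∀ k, 0 ≤ slack m φ r k p ∧ 0 ≤ slack m φ R k p}

lemma inner_invGnomonic_smul_dir_le_iff (m : ℕ) (φ ρ : ℝ) (k : ℤ) (p : E3) :
    inner ℝ (invGnomonic (ρ • dir m φ k) : E3) p ≤ 1 ↔ 0 ≤ slack m φ ρ k p := by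
  have hpos := norm_vec_pos (ρ • dir m φ k)
  have hn : ‖ρ • dir m φ k‖ ^ 2 = ρ ^ 2 := by
    rw [norm_smul, norm_dir, mul_one, Real.norm_eq_abs, sq_abs]
  rw [inner_invGnomonic, inv_mul_le_iff₀ hpos, mul_one, hn, real_inner_smul_left, slack]
  constructor <;> intro h <;> linarith

lemma tangentPolyhedron_eq (hm : 5 ≤ m) (hr : 0 < r) (hR : r < R) :
    tangentPolyhedron (ringSubdivision (m + 1) φ r R) = cap m φ r R := by
  ext p
  rw [tangentPolyhedron, subdivisionVertices_eq hm hr hR]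
  constructor
  · intro h k
    exact ⟨(inner_invGnomonic_smul_dir_le_iff m φ r k p).1 (h _ ⟨_, ⟨k, Or.inl rfl⟩, rfl⟩),
      (inner_invGnomonic_smul_dir_le_iff m φ R k p).1 (h _ ⟨_, ⟨k, Or.inr rfl⟩, rfl⟩)⟩
  · rintro h _ ⟨_, ⟨k, rfl | rfl⟩, rfl⟩
    · exact (inner_invGnomonic_smul_dir_le_iff m φ r k p).2 (h k).1
    · exact (inner_invGnomonic_smul_dir_le_iff m φ R k p).2 (h k).2

lemma inner_vec_smul_dir (m : ℕ) (φ ρ : ℝ) (k : ℤ) (p : E3) :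
    inner ℝ (vec (ρ • dir m φ k) (-1)) p = √(1 + ρ ^ 2) - slack m φ ρ k p := by
  rw [inner_vec_left, real_inner_smul_left, slack]; ring

lemma isPolyhedron_cap (hm : 5 ≤ m) (φ r R : ℝ) : IsPolyhedron (cap m φ r R) := by
  classical
  refine ⟨(Finset.range m).image (fun k : ℕ => (vec (r • dir m φ k) (-1), √(1 + r ^ 2))) ∪
    (Finset.range m).image (fun k : ℕ => (vec (R • dir m φ k) (-1), √(1 + R ^ 2))), ?_, ?_⟩
  · have hne : ∀ y : E2, vec y (-1) ≠ 0 := fun y h => by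
      have := congrArg (fun x : E3 => x 2) h
      simp at this
    intro h hh
    rcases Finset.mem_union.1 hh with hh | hh <;>
      obtain ⟨k, -, rfl⟩ := Finset.mem_image.1 hh <;> exact hne _
  · ext p
    constructor
    · intro hp h hh
      rcases Finset.mem_union.1 hh with hh | hh <;> obtain ⟨k, -, rfl⟩ := Finset.mem_image.1 hh
      · have := (hp k).1
        simp only [inner_vec_smul_dir]; linarith
      · have := (hp k).2
        simp only [inner_vec_smul_dir]; linarith
    · intro h k
      obtain ⟨i, him, hd⟩ := exists_range_dvd_sub (by omega : 0 < m) k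
      have e : ∀ ρ, slack m φ ρ k p = slack m φ ρ i p := fun ρ => by
        rw [slack, slack, dir_congr (by omega) φ hd]
      rw [e, e]
      have h1 := h _ (Finset.mem_union_left _
        (Finset.mem_image.2 ⟨i, him, rfl⟩))
      have h2 := h _ (Finset.mem_union_right _
        (Finset.mem_image.2 ⟨i, him, rfl⟩))
      simp only [inner_vec_smul_dir] at h1 h2
      constructor <;> linarith

/-- The half-spaces are tangent to the unit sphere, so the unit ball lies in all of them. -/
lemma interior_cap_nonempty (m : ℕ) (φ r R : ℝ) : (interior (cap m φ r R)).Nonempty := by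
  refine ⟨0, mem_interior.2 ⟨Metric.ball 0 1, fun p hp k => ?_, Metric.isOpen_ball,
    Metric.mem_ball_self one_pos⟩⟩
  rw [mem_ball_zero_iff] at hp
  constructor <;> rw [← inner_invGnomonic_smul_dir_le_iff]
  all_goals
    refine (real_inner_le_norm _ _).trans ?_
    rw [mem_sphere_zero_iff_norm.1 (invGnomonic _).2, one_mul]
    exact hp.le

lemma not_isBounded_cap (m : ℕ) (φ r R : ℝ) : ¬ Bornology.IsBounded (cap m φ r R) := by
  intro h
  obtain ⟨C, hC⟩ := h.exists_norm_le
  have hmem : vec 0 (|C| + 1) ∈ cap m φ r R := fun k => by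
    simp only [slack, hor_vec, vec_two, inner_zero_right, mul_zero, sub_zero]
    exact ⟨by positivity, by positivity⟩
  have h1 := hC _ hmem
  have h2 := norm_vec_sq 0 (|C| + 1)
  rw [norm_zero] at h2
  nlinarith [abs_nonneg C, le_abs_self C, norm_nonneg (vec 0 (|C| + 1)), sq_abs C]

/-! ### The vertices and recession directions of the polyhedron -/

/-- The ratio of the increments of height and circumradius. -/
def slope (r R : ℝ) : ℝ := (√(1 + R ^ 2) - √(1 + r ^ 2)) / (R - r)

lemma slope_pos (hr : 0 < r) (hR : r < R) : 0 < slope r R := by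
  apply div_pos _ (by linarith)
  rw [sub_pos]
  apply Real.sqrt_lt_sqrt (by positivity)
  nlinarith

lemma sqrt_eq_slope (hR : r < R) : √(1 + R ^ 2) = √(1 + r ^ 2) + slope r R * (R - r) := by
  rw [slope, div_mul_cancel₀ _ (by linarith)]; ring

/-- The lowest vertex of the polyhedron. -/
def apex (r : ℝ) : E3 := vec 0 (-√(1 + r ^ 2))

/-- The vertices of the polyhedron that are dual to the ring regions. -/
def ringVertex (m : ℕ) (φ r R : ℝ) (k : ℤ) : E3 :=
  vec ((slope r R / apo m) • mid m φ k) (r * slope r R - √(1 + r ^ 2))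

/-- The directions of the unbounded edges of the polyhedron. -/
def ray (m : ℕ) (φ R : ℝ) (k : ℤ) : E3 := vec (mid m φ k) (R * apo m)

/-- The value at `p` of the linear functional represented by `(y, -1)`. -/
def val (y : E2) (p : E3) : ℝ := inner ℝ y (hor p) - p 2

lemma val_add (y : E2) (p q : E3) : val y (p + q) = val y p + val y q := by
  simp only [val, hor_add, inner_add_right, PiLp.add_apply]; ring

lemma val_smul (y : E2) (a : ℝ) (p : E3) : val y (a • p) = a * val y p := by
  simp only [val, hor_smul, inner_smul_right, PiLp.smul_apply, smul_eq_mul]; ring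

lemma slack_eq_val (m : ℕ) (φ ρ : ℝ) (k : ℤ) (p : E3) :
    slack m φ ρ k p = √(1 + ρ ^ 2) - val (ρ • dir m φ k) p := by
  rw [slack, val, real_inner_smul_left]; ring

lemma val_apex (y : E2) : val y (apex r) = √(1 + r ^ 2) := by simp [val, apex]

lemma val_ringVertex (y : E2) (k : ℤ) : val y (ringVertex m φ r R k) =
    √(1 + r ^ 2) + slope r R * (inner ℝ y (mid m φ k) / apo m - r) := by
  simp only [val, ringVertex, hor_vec, vec_two, inner_smul_right]; ring

lemma val_ray (y : E2) (k : ℤ) : val y (ray m φ R k) = inner ℝ y (mid m φ k) - R * apo m := by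
  simp only [val, ray, hor_vec, vec_two]

lemma slack_add_ray (ρ : ℝ) (k j : ℤ) (t : ℝ) (p : E3) : slack m φ ρ j (p + t • ray m φ R k) =
    slack m φ ρ j p + t * (R * apo m - ρ * inner ℝ (dir m φ j) (mid m φ k)) := by
  rw [slack_eq_val, slack_eq_val, val_add, val_smul, val_ray, real_inner_smul_left]; ring

lemma slack_inner_apex (m : ℕ) (φ r : ℝ) (k : ℤ) : slack m φ r k (apex r) = 0 := by
  rw [slack_eq_val, val_apex, sub_self]

lemma slack_inner_ringVertex (hm : 5 ≤ m) (k j : ℤ) : slack m φ r j (ringVertex m φ r R k) =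
    r * slope r R * ((apo m - inner ℝ (dir m φ j) (mid m φ k)) / apo m) := by
  have := (apo_pos hm).ne'
  rw [slack_eq_val, val_ringVertex, real_inner_smul_left]
  field_simp
  ring

lemma slack_outer_ringVertex (hm : 5 ≤ m) (hR : r < R) (k j : ℤ) :
    slack m φ R j (ringVertex m φ r R k) =
    R * slope r R * ((apo m - inner ℝ (dir m φ j) (mid m φ k)) / apo m) := by
  have := (apo_pos hm).ne'
  rw [slack_eq_val, val_ringVertex, real_inner_smul_left, sqrt_eq_slope hR]
  field_simp
  ring

lemma apex_mem_cap (hr : 0 < r) (hR : r < R) : apex r ∈ cap m φ r R := fun k => by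
  have := slope_pos hr hR
  rw [slack_inner_apex, slack_eq_val, val_apex, sqrt_eq_slope hR]
  exact ⟨le_rfl, by nlinarith⟩

lemma ringVertex_mem_cap (hm : 5 ≤ m) (hr : 0 < r) (hR : r < R) (k : ℤ) :
    ringVertex m φ r R k ∈ cap m φ r R := fun j => by
  have hR0 := hr.trans hR
  have h1 := slope_pos hr hR
  have h2 := apo_pos hm
  have h3 : 0 ≤ apo m - inner ℝ (dir m φ j) (mid m φ k) := by
    linarith [inner_dir_mid_le hm φ j k]
  rw [slack_inner_ringVertex hm, slack_outer_ringVertex hm hR]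
  exact ⟨by positivity, by positivity⟩

lemma add_ray_mem_cap (hm : 5 ≤ m) (hr : 0 < r) (hR : r < R) (k : ℤ) {t : ℝ} (ht : 0 ≤ t) {p : E3}
    (hp : p ∈ cap m φ r R) : p + t • ray m φ R k ∈ cap m φ r R := fun j => by
  have hR0 := hr.trans hR
  have h2 := apo_pos hm
  have h3 := inner_dir_mid_le hm φ j k
  rw [slack_add_ray, slack_add_ray]
  have e1 : r * inner ℝ (dir m φ j) (mid m φ k) ≤ R * apo m := by nlinarith
  have e2 : R * inner ℝ (dir m φ j) (mid m φ k) ≤ R * apo m := by nlinarith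
  exact ⟨add_nonneg (hp j).1 (mul_nonneg ht (by linarith)),
    add_nonneg (hp j).2 (mul_nonneg ht (by linarith))⟩

/-! ### Supporting planes -/

/-- The vertex directions are the edge midpoints of the polygon turned back by `π / m`, so the
maximising index is that of the sector of the turned polygon that contains `ξ`. -/
lemma exists_dir_max (hm : 5 ≤ m) (φ : ℝ) (ξ : E2) : ∃ j, (∀ i, inner ℝ (dir m φ i) ξ ≤
    inner ℝ (dir m φ j) ξ) ∧ 0 ≤ inner ℝ (dir m φ j) ξ ∧ (inner ℝ (dir m φ j) ξ = 0 → ξ = 0) := by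
  have e : ∀ i, mid m (φ - Real.pi / m) i = dir m φ i := fun i => by rw [mid, sub_add_cancel]
  obtain ⟨j, α, β, hα, hβ, rfl⟩ := exists_dir_combination hm (φ - Real.pi / m) ξ
  have hc := apo_pos hm
  refine ⟨j, fun i => ?_, ?_, fun h => ?_⟩
  · rw [← e, ← e, real_inner_comm, real_inner_comm _ (mid m _ j), inner_combination_mid_self hm]
    exact inner_combination_mid_le hm j i hα hβ
  · rw [← e, real_inner_comm, inner_combination_mid_self hm]
    positivity
  · rw [← e, real_inner_comm, inner_combination_mid_self hm] at h
    have h1 : α + β = 0 := (mul_eq_zero.1 h).resolve_right hc.ne'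
    have h2 : α = 0 := by linarith
    have h3 : β = 0 := by linarith
    simp [h2, h3]

lemma eq_zero_of_inner_dir (hm : 5 ≤ m) {k : ℤ} {ξ : E2} (h1 : inner ℝ (dir m φ k) ξ = 0)
    (h2 : inner ℝ (dir m φ (k + 1)) ξ = 0) : ξ = 0 := by
  obtain ⟨j, -, h, h0⟩ := exists_dir_max hm φ ξ
  -- The determinant of two consecutive directions is `sin (2π/m)`, which is positive.
  have hdet : dir m φ k 0 * dir m φ (k + 1) 1 - dir m φ k 1 * dir m φ (k + 1) 0 ≠ 0 := by
    have : dir m φ k 0 * dir m φ (k + 1) 1 - dir m φ k 1 * dir m φ (k + 1) 0 =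
        Real.sin (2 * (Real.pi / m)) := by
      rw [show 2 * (Real.pi / m) = (φ + 2 * Real.pi * ((k + 1 : ℤ) : ℝ) / m)
        - (φ + 2 * Real.pi * k / m) by push_cast; ring, Real.sin_sub]
      simp [dir]; ring
    rw [this]
    have := pi_div_lt hm
    have := pi_div_pos hm
    exact (Real.sin_pos_of_pos_of_lt_pi (by linarith) (by linarith [Real.pi_pos])).ne'
  rw [inner_E2] at h1 h2
  have e0 : (dir m φ k 0 * dir m φ (k + 1) 1 - dir m φ k 1 * dir m φ (k + 1) 0) * ξ 0 = 0 := by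
    linear_combination dir m φ (k + 1) 1 * h1 - dir m φ k 1 * h2
  have e1 : (dir m φ k 0 * dir m φ (k + 1) 1 - dir m φ k 1 * dir m φ (k + 1) 0) * ξ 1 = 0 := by
    linear_combination dir m φ k 0 * h2 - dir m φ (k + 1) 0 * h1
  ext i
  fin_cases i
  · exact (mul_eq_zero.1 e0).resolve_left hdet
  · exact (mul_eq_zero.1 e1).resolve_left hdet

/-- The point `y` is the convex combination of the four corners of its cell used in
`ringCell_eq_convexHull`, and by `sqrt_eq_slope` the same weights interpolate the tangent constants.
On the cell all four weights are nonnegative, so the gap is a nonnegative combination of slacks. -/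
lemma val_combination (hR : r < R) (k : ℤ) (α β : ℝ) (p : E3) :
    (α + β) * (R - r) * (√(1 + r ^ 2) + slope r R * (α + β - r) -
      val (α • dir m φ k + β • dir m φ (k + 1)) p) =
    α * (R - (α + β)) * slack m φ r k p + α * (α + β - r) * slack m φ R k p +
    β * (R - (α + β)) * slack m φ r (k + 1) p + β * (α + β - r) * slack m φ R (k + 1) p := by
  simp only [slack, sqrt_eq_slope hR, val, inner_add_left, real_inner_smul_left]
  ring

/-- The conditions under which `p` lies on the supporting plane with normal direction
`(y, -1)`, where `y` lies in the `k`-th cell of the ring. -/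
lemma val_le_and_eq_iff (hr : 0 < r) (hR : r < R) {k : ℤ} {α β : ℝ} (hα : 0 ≤ α)
    (hβ : 0 ≤ β) (h1 : r ≤ α + β) (h2 : α + β ≤ R) {p : E3} (hp : p ∈ cap m φ r R) :
    val (α • dir m φ k + β • dir m φ (k + 1)) p ≤ √(1 + r ^ 2) + slope r R * (α + β - r) ∧
    (val (α • dir m φ k + β • dir m φ (k + 1)) p = √(1 + r ^ 2) + slope r R * (α + β - r) ↔
      (α * (R - (α + β)) * slack m φ r k p = 0 ∧ α * (α + β - r) * slack m φ R k p = 0) ∧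
      (β * (R - (α + β)) * slack m φ r (k + 1) p = 0 ∧
        β * (α + β - r) * slack m φ R (k + 1) p = 0)) := by
  have key := val_combination (m := m) (φ := φ) hR k α β p
  have e1 : 0 ≤ R - (α + β) := by linarith
  have e2 : 0 ≤ α + β - r := by linarith
  have hs : 0 < (α + β) * (R - r) := mul_pos (by linarith) (by linarith)
  have t1 := mul_nonneg (mul_nonneg hα e1) (hp k).1
  have t2 := mul_nonneg (mul_nonneg hα e2) (hp k).2
  have t3 := mul_nonneg (mul_nonneg hβ e1) (hp (k + 1)).1
  have t4 := mul_nonneg (mul_nonneg hβ e2) (hp (k + 1)).2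
  constructor
  · by_contra hcon
    push Not at hcon
    have := mul_neg_of_pos_of_neg hs (sub_neg.2 hcon)
    linarith
  · constructor
    · intro h
      rw [h, sub_self, mul_zero] at key
      refine ⟨⟨?_, ?_⟩, ?_, ?_⟩ <;> linarith
    · rintro ⟨⟨h3, h4⟩, h5, h6⟩
      rw [h3, h4, h5, h6] at key
      have := (mul_eq_zero.1 (key.trans (by ring))).resolve_left hs.ne'
      linarith

/-- Let `M ≥ 0` be the largest product of the horizontal part of `p` with a direction. Then `val y p
≤ (α + β) * M - p 2 ≤ r * M - p 2`, and the inner constraint in the maximising direction bounds the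
last term. Equality with `α + β < r` forces `M = 0`, so `p` is on the axis. -/
lemma val_le_apex (hm : 5 ≤ m) {k : ℤ} {α β : ℝ} (hα : 0 ≤ α)
    (hβ : 0 ≤ β) (h1 : α + β ≤ r) {p : E3} (hp : p ∈ cap m φ r R) :
    val (α • dir m φ k + β • dir m φ (k + 1)) p ≤ √(1 + r ^ 2) ∧ (α + β < r →
      val (α • dir m φ k + β • dir m φ (k + 1)) p = √(1 + r ^ 2) → p = apex r) := by
  obtain ⟨j, hj, hj0, hj1⟩ := exists_dir_max hm φ (hor p)
  have hs := (hp j).1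
  rw [slack] at hs
  have e1 := mul_le_mul_of_nonneg_left (hj k) hα
  have e2 := mul_le_mul_of_nonneg_left (hj (k + 1)) hβ
  have e3 := mul_le_mul_of_nonneg_right h1 hj0
  simp only [val, inner_add_left, real_inner_smul_left]
  refine ⟨by nlinarith, fun hlt heq => ?_⟩
  have hM : inner ℝ (dir m φ j) (hor p) = 0 := by
    refine le_antisymm ?_ hj0
    by_contra hcon
    push Not at hcon
    have := mul_lt_mul_of_pos_right hlt hcon
    nlinarith
  have h0 := hj1 hM
  rw [h0] at heq
  simp only [inner_zero_right] at heq
  rw [apex, ← h0, ← vec_hor p, hor_vec]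
  congr 1
  linarith

lemma mem_sphericalImageAt_invGnomonic {P : Set E3} {x : E3} {y : E2} :
    invGnomonic y ∈ sphericalImageAt P x ↔ x ∈ P ∧ ∀ p ∈ P, val y p ≤ val y x := by
  have hpos := inv_pos.2 (norm_vec_pos y)
  unfold sphericalImageAt
  rw [mem_ofPred_eq]
  simp only [inner_invGnomonic]
  exact and_congr_right fun _ => forall₂_congr fun p _ => mul_le_mul_iff_right₀ hpos

lemma inner_ray_nonpos (hm : 5 ≤ m) (hr : 0 < r) (hR : r < R) {u : S2} {x : E3}
    (hu : u ∈ sphericalImageAt (cap m φ r R) x) (k : ℤ) : inner ℝ (u : E3) (ray m φ R k) ≤ 0 := by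
  have := hu.2 _ (add_ray_mem_cap hm hr hR k zero_le_one hu.1)
  rw [one_smul, inner_add_right] at this
  linarith

lemma exists_inner_mid_nonneg (hm : 5 ≤ m) (φ : ℝ) (y : E2) :
    ∃ k, 0 ≤ inner ℝ y (mid m φ k) ∧ (inner ℝ y (mid m φ k) = 0 → y = 0) := by
  obtain ⟨j, -, h, h'⟩ := exists_dir_max hm (φ + Real.pi / m) y
  exact ⟨j, by rwa [real_inner_comm], by rwa [real_inner_comm]⟩

/-- Some edge midpoint has nonnegative product with the horizontal part of `u`, and every `ray`
points upwards; were `u 2 ≥ 0`, both terms would vanish and so would `u`. -/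
lemma two_neg_of_inner_ray (hm : 5 ≤ m) (hR : 0 < R) {u : E3} (hu : u ≠ 0)
    (h : ∀ k, inner ℝ u (ray m φ R k) ≤ 0) : u 2 < 0 := by
  have hc := apo_pos hm
  obtain ⟨k, hk, hk0⟩ := exists_inner_mid_nonneg hm φ (hor u)
  have h1 := h k
  rw [inner_eq_hor, ray, hor_vec, vec_two] at h1
  have hpos : 0 < R * apo m := by positivity
  by_contra hcon
  push Not at hcon
  have h2 : u 2 = 0 := by nlinarith
  rw [h2, zero_mul, add_zero] at h1
  have h3 := hk0 (le_antisymm h1 hk)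
  apply hu
  rw [← vec_hor u, h3, h2]
  ext i; fin_cases i <;> rfl

/-- A supporting normal is nonpositive on every recession direction `ray k`. This puts it in the
lower hemisphere, and there it is precisely the `k`-th half-plane condition of the outer polygon. -/
lemma exists_eq_invGnomonic (hm : 5 ≤ m) (hr : 0 < r) (hR : r < R) {u : S2} {x : E3}
    (hu : u ∈ sphericalImageAt (cap m φ r R) x) : ∃ y ∈ polygon m φ R, u = invGnomonic y := by
  have h1 := inner_ray_nonpos hm hr hR hu
  have h2 := two_neg_of_inner_ray hm (hr.trans hR) (ne_zero_of_mem_unit_sphere u) h1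
  refine ⟨gnomonic u, fun k => ?_, (invGnomonic_gnomonic h2).symm⟩
  have h3 := h1 k
  rw [← invGnomonic_gnomonic h2, inner_invGnomonic] at h3
  have h4 : val (gnomonic u) (ray m φ R k) ≤ 0 := by
    have := inv_pos.2 (norm_vec_pos (gnomonic u))
    by_contra hcon
    push Not at hcon
    exact absurd h3 (not_le.2 (mul_pos this hcon))
  rw [val_ray] at h4
  linarith

lemma val_ringVertex_combination (hm : 5 ≤ m) (k : ℤ) (α β : ℝ) :
    val (α • dir m φ k + β • dir m φ (k + 1)) (ringVertex m φ r R k) =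
      √(1 + r ^ 2) + slope r R * (α + β - r) := by
  rw [val_ringVertex, inner_combination_mid_self hm, mul_div_cancel_right₀ _ (apo_pos hm).ne']

/-- Comparing `ringVertex k` with the other ring vertices gives the sector, with the apex the inner
bound, and with its ray the outer bound. The converse is the support inequality `val_le_and_eq_iff`.
-/
lemma sphericalImageAt_ringVertex (hm : 5 ≤ m) (hr : 0 < r) (hR : r < R) (k : ℤ) :
    sphericalImageAt (cap m φ r R) (ringVertex m φ r R k) =
      invGnomonic '' ringCell m φ r R k := by
  have hc := apo_pos hm
  have hs := slope_pos hr hR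
  apply subset_antisymm
  · intro u hu
    obtain ⟨y, hy, rfl⟩ := exists_eq_invGnomonic hm hr hR hu
    rw [mem_sphericalImageAt_invGnomonic] at hu
    refine ⟨y, ⟨fun j => ?_, ?_, hy k⟩, rfl⟩
    · have := hu.2 _ (ringVertex_mem_cap hm hr hR j)
      rw [val_ringVertex, val_ringVertex] at this
      have h1 := le_of_mul_le_mul_left (le_of_add_le_add_left this) hs
      have h2 : inner ℝ y (mid m φ j) / apo m ≤ inner ℝ y (mid m φ k) / apo m := by linarith
      exact (div_le_div_iff_of_pos_right hc).1 h2
    · have := hu.2 _ (apex_mem_cap hr hR)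
      rw [val_ringVertex, val_apex] at this
      have h1 : 0 ≤ slope r R * (inner ℝ y (mid m φ k) / apo m - r) := by linarith
      have h2 := nonneg_of_mul_nonneg_right h1 hs
      rw [← le_div_iff₀ hc]
      linarith
  · rintro _ ⟨y, hy, rfl⟩
    rw [mem_sphericalImageAt_invGnomonic]
    obtain ⟨α, β, hα, hβ, h1, h2, rfl⟩ := (mem_ringCell_iff hm).1 hy
    refine ⟨ringVertex_mem_cap hm hr hR k, fun p hp => ?_⟩
    rw [val_ringVertex_combination hm]
    exact (val_le_and_eq_iff hr hR hα hβ h1 h2 hp).1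

lemma sphericalImageAt_apex (hm : 5 ≤ m) (hr : 0 < r) (hR : r < R) :
    sphericalImageAt (cap m φ r R) (apex r) = invGnomonic '' polygon m φ r := by
  have hc := apo_pos hm
  have hs := slope_pos hr hR
  apply subset_antisymm
  · intro u hu
    obtain ⟨y, hy, rfl⟩ := exists_eq_invGnomonic hm hr hR hu
    rw [mem_sphericalImageAt_invGnomonic] at hu
    refine ⟨y, fun j => ?_, rfl⟩
    have := hu.2 _ (ringVertex_mem_cap hm hr hR j)
    rw [val_ringVertex, val_apex] at this
    have h1 : slope r R * (inner ℝ y (mid m φ j) / apo m - r) ≤ 0 := by linarith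
    rw [← div_le_iff₀ hc]
    by_contra hcon
    push Not at hcon
    exact absurd h1 (not_le.2 (mul_pos hs (sub_pos.2 hcon)))
  · rintro _ ⟨y, hy, rfl⟩
    rw [mem_sphericalImageAt_invGnomonic]
    obtain ⟨k, α, β, hα, hβ, rfl⟩ := exists_dir_combination hm φ y
    have h1 := (combination_mem_polygon_iff hm hα hβ).1 hy
    refine ⟨apex_mem_cap hr hR, fun p hp => ?_⟩
    rw [val_apex]
    exact (val_le_apex hm hα hβ h1 hp).1

/-- The bound in `val_le_and_eq_iff` is attained at `ringVertex k`, so `p` is supporting iff it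
attains it too. A vanishing factor marks a constraint that need not be tight, and which factors
vanish tells on which part of the cell boundary the normal lies. -/
lemma mem_sphericalImageAt_iff (hm : 5 ≤ m) (hr : 0 < r) (hR : r < R) {k : ℤ} {α β : ℝ}
    (hα : 0 ≤ α) (hβ : 0 ≤ β) (h1 : r ≤ α + β) (h2 : α + β ≤ R) {p : E3}
    (hp : p ∈ cap m φ r R) :
    invGnomonic (α • dir m φ k + β • dir m φ (k + 1)) ∈ sphericalImageAt (cap m φ r R) p ↔
      (α * (R - (α + β)) * slack m φ r k p = 0 ∧ α * (α + β - r) * slack m φ R k p = 0) ∧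
      (β * (R - (α + β)) * slack m φ r (k + 1) p = 0 ∧
        β * (α + β - r) * slack m φ R (k + 1) p = 0) := by
  rw [mem_sphericalImageAt_invGnomonic, ← (val_le_and_eq_iff hr hR hα hβ h1 h2 hp).2]
  constructor
  · rintro ⟨-, h⟩
    refine le_antisymm (val_le_and_eq_iff hr hR hα hβ h1 h2 hp).1 ?_
    rw [← val_ringVertex_combination hm]
    exact h _ (ringVertex_mem_cap hm hr hR k)
  · intro h
    refine ⟨hp, fun q hq => ?_⟩
    rw [h]
    exact (val_le_and_eq_iff hr hR hα hβ h1 h2 hq).1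

/-- Subtracting the two constraints in one direction gives its product with the horizontal part of
`p`, namely `slope r R`. Two consecutive directions determine that part, and one constraint then
gives the height. -/
lemma eq_ringVertex_of_slack (hm : 5 ≤ m) (hR : r < R) {k : ℤ} {p : E3}
    (h1 : slack m φ r k p = 0) (h2 : slack m φ R k p = 0) (h3 : slack m φ r (k + 1) p = 0)
    (h4 : slack m φ R (k + 1) p = 0) : p = ringVertex m φ r R k := by
  have hc := (apo_pos hm).ne'
  have hd : R - r ≠ 0 := by linarith
  have e : ∀ j, slack m φ r j p = 0 → slack m φ R j p = 0 →
      inner ℝ (dir m φ j) (hor p) = slope r R := fun j h h' => by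
    rw [slack] at h
    rw [slack, sqrt_eq_slope hR] at h'
    have : (R - r) * (slope r R - inner ℝ (dir m φ j) (hor p)) = 0 := by linarith
    have := (mul_eq_zero.1 this).resolve_left hd
    linarith
  have hz : hor p - (slope r R / apo m) • mid m φ k = 0 := by
    apply eq_zero_of_inner_dir hm (φ := φ) (k := k)
    · rw [inner_sub_right, inner_smul_right, inner_dir_mid_self hm, e k h1 h2,
        div_mul_cancel₀ _ hc, sub_self]
    · rw [inner_sub_right, inner_smul_right, inner_dir_succ_mid hm, e _ h3 h4,
        div_mul_cancel₀ _ hc, sub_self]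
  have ht : p 2 = r * slope r R - √(1 + r ^ 2) := by
    rw [slack, e k h1 h2] at h1
    linarith
  rw [← vec_hor p, ringVertex, sub_eq_zero.1 hz, ht]

/-! ### Vertices -/

lemma val_lt_ringVertex (hm : 5 ≤ m) (hr : 0 < r) (hR : r < R) {k : ℤ} {α β : ℝ} (hα : 0 < α)
    (hβ : 0 < β) (h1 : r < α + β) (h2 : α + β < R) {p : E3} (hp : p ∈ cap m φ r R)
    (hne : p ≠ ringVertex m φ r R k) :
    val (α • dir m φ k + β • dir m φ (k + 1)) p <
      val (α • dir m φ k + β • dir m φ (k + 1)) (ringVertex m φ r R k) := by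
  rw [val_ringVertex_combination hm]
  obtain ⟨hle, hiff⟩ := val_le_and_eq_iff hr hR hα.le hβ.le h1.le h2.le hp
  refine lt_of_le_of_ne hle fun h => hne ?_
  obtain ⟨⟨e1, e2⟩, e3, e4⟩ := hiff.1 h
  have n1 := sub_ne_zero.2 h2.ne'
  have n2 := sub_ne_zero.2 h1.ne'
  exact eq_ringVertex_of_slack hm hR
    ((mul_eq_zero.1 e1).resolve_left (mul_ne_zero hα.ne' n1))
    ((mul_eq_zero.1 e2).resolve_left (mul_ne_zero hα.ne' n2))
    ((mul_eq_zero.1 e3).resolve_left (mul_ne_zero hβ.ne' n1))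
    ((mul_eq_zero.1 e4).resolve_left (mul_ne_zero hβ.ne' n2))

lemma val_lt_apex (hm : 5 ≤ m) {k : ℤ} {α β : ℝ} (hα : 0 ≤ α)
    (hβ : 0 ≤ β) (h1 : α + β < r) {p : E3} (hp : p ∈ cap m φ r R) (hne : p ≠ apex r) :
    val (α • dir m φ k + β • dir m φ (k + 1)) p <
      val (α • dir m φ k + β • dir m φ (k + 1)) (apex r) := by
  obtain ⟨hle, h⟩ := val_le_apex hm hα hβ h1.le hp
  rw [val_apex]
  exact lt_of_le_of_ne hle fun heq => hne (h h1 heq)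

lemma inner_vec_neg_one (y : E2) (p : E3) : inner ℝ (vec y (-1)) p = val y p := by
  rw [inner_vec_left, val]; ring

lemma apex_mem_vertices (hm : 5 ≤ m) (hr : 0 < r) (hR : r < R) :
    apex r ∈ polyVertices (cap m φ r R) := by
  refine mem_extremePoints_of_exposed
    (u := vec ((0 : ℝ) • dir m φ 0 + (0 : ℝ) • dir m φ (0 + 1)) (-1)) (apex_mem_cap hr hR) ?_
  intro p hp hne
  rw [inner_vec_neg_one, inner_vec_neg_one]
  exact val_lt_apex hm le_rfl le_rfl (by linarith) hp hne

lemma ringVertex_mem_vertices (hm : 5 ≤ m) (hr : 0 < r) (hR : r < R) (k : ℤ) :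
    ringVertex m φ r R k ∈ polyVertices (cap m φ r R) := by
  refine mem_extremePoints_of_exposed
    (u := vec (((r + R) / 4) • dir m φ k + ((r + R) / 4) • dir m φ (k + 1)) (-1))
    (ringVertex_mem_cap hm hr hR k) ?_
  intro p hp hne
  rw [inner_vec_neg_one, inner_vec_neg_one]
  exact val_lt_ringVertex hm hr hR (by linarith) (by linarith) (by linarith) (by linarith) hp hne

lemma polygon_cases (hm : 5 ≤ m) (hr : 0 < r) (hR : r < R) {y : E2} (hy : y ∈ polygon m φ R) :
    invGnomonic y ∈ sphericalImageAt (cap m φ r R) (apex r) ∨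
      ∃ k, invGnomonic y ∈ sphericalImageAt (cap m φ r R) (ringVertex m φ r R k) := by
  rw [← polygon_union_ringCells hm hr hR] at hy
  rcases hy with hy | hy
  · left
    rw [sphericalImageAt_apex hm hr hR]
    exact mem_image_of_mem _ hy
  · obtain ⟨k, hk⟩ := mem_iUnion.1 hy
    right
    refine ⟨k, ?_⟩
    rw [sphericalImageAt_ringVertex hm hr hR]
    exact mem_image_of_mem _ hk

lemma apex_ne_ringVertex (hr : 0 < r) (hR : r < R) (k : ℤ) :
    apex r ≠ ringVertex m φ r R k := by
  intro h
  have := congrArg (fun p : E3 => p 2) h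
  simp only [apex, ringVertex, vec_two] at this
  nlinarith [slope_pos hr hR]

lemma ringVertex_inj (hm : 5 ≤ m) (hr : 0 < r) (hR : r < R) {k j : ℤ}
    (h : ringVertex m φ r R k = ringVertex m φ r R j) : (m : ℤ) ∣ k - j := by
  have := congrArg hor h
  simp only [ringVertex, hor_vec] at this
  exact mid_inj hm (smul_right_injective _ (div_pos (slope_pos hr hR) (apo_pos hm)).ne' this)

lemma ringVertex_congr (hm : 5 ≤ m) {k j : ℤ} (h : (m : ℤ) ∣ k - j) :
    ringVertex m φ r R k = ringVertex m φ r R j := by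
  rw [ringVertex, ringVertex, mid_congr (by omega) φ h]

/-- A vertex is the unique supporting point of some normal. That normal lies over the outer polygon,
hence in the spherical image of the apex or of a ring vertex, which by uniqueness is the given
vertex. -/
lemma polyVertices_cap (hm : 5 ≤ m) (hr : 0 < r) (hR : r < R) :
    polyVertices (cap m φ r R) = insert (apex r) (range (ringVertex m φ r R)) := by
  apply subset_antisymm
  · intro x hx
    obtain ⟨s, -, hs⟩ := isPolyhedron_cap hm φ r R
    obtain ⟨u, hu⟩ := exists_exposing hs hx
    -- The zero functional cannot expose `x` strictly, since the polyhedron has at least two points.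
    have hu0 : u ≠ 0 := by
      rintro rfl
      by_cases h : apex r = x
      · have := hu _ (ringVertex_mem_cap hm hr hR 0)
          (fun h' => apex_ne_ringVertex (m := m) (φ := φ) hr hR 0 (h.trans h'.symm))
        simp at this
      · have := hu _ (apex_mem_cap hr hR) h
        simp at this
    have hn : 0 < ‖u‖⁻¹ := inv_pos.2 (norm_pos_iff.2 hu0)
    let u' : S2 := ⟨‖u‖⁻¹ • u, by
      rw [mem_sphere_zero_iff_norm, norm_smul, norm_inv, norm_norm,
        inv_mul_cancel₀ (norm_ne_zero_iff.2 hu0)]⟩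
    have hcoe : (u' : E3) = ‖u‖⁻¹ • u := rfl
    have hmem : u' ∈ sphericalImageAt (cap m φ r R) x := by
      refine ⟨hx.1, fun y hy => ?_⟩
      rw [hcoe, real_inner_smul_left, real_inner_smul_left]
      by_cases h : y = x
      · rw [h]
      · exact mul_le_mul_of_nonneg_left (hu y hy h).le hn.le
    have huniq : ∀ z, u' ∈ sphericalImageAt (cap m φ r R) z → z = x := by
      intro z hz
      by_contra hne
      have h1 := hz.2 x hx.1
      rw [hcoe, real_inner_smul_left, real_inner_smul_left] at h1
      have h2 := hu z hz.1 hne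
      have := le_of_mul_le_mul_left h1 hn
      linarith
    obtain ⟨y, hy, hy'⟩ := exists_eq_invGnomonic hm hr hR hmem
    rw [hy'] at huniq
    rcases polygon_cases hm hr hR hy with h | ⟨k, h⟩
    · exact Or.inl (huniq _ h).symm
    · exact Or.inr ⟨k, huniq _ h⟩
  · rintro _ (rfl | ⟨k, rfl⟩)
    · exact apex_mem_vertices hm hr hR
    · exact ringVertex_mem_vertices hm hr hR k

lemma encard_polyVertices_cap (hm : 5 ≤ m) (hr : 0 < r) (hR : r < R) :
    (polyVertices (cap m φ r R)).encard = (m + 1 : ℕ) := by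
  rw [polyVertices_cap hm hr hR, Set.encard_insert_of_notMem]
  · have : range (ringVertex m φ r R) =
        (fun k : ℕ => ringVertex m φ r R k) '' (Finset.range m : Set ℕ) := by
      ext p
      constructor
      · rintro ⟨k, rfl⟩
        obtain ⟨i, him, hd⟩ := exists_range_dvd_sub (by omega : 0 < m) k
        exact ⟨i, by simpa using him, (ringVertex_congr hm hd).symm⟩
      · rintro ⟨k, -, rfl⟩
        exact ⟨k, rfl⟩
    rw [this, Set.InjOn.encard_image, Set.encard_coe_eq_coe_finsetCard, Finset.card_range]
    · rfl
    · intro k hk j hj h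
      have h1 := ringVertex_inj hm hr hR h
      have hk' : k < m := by simpa using hk
      have hj' : j < m := by simpa using hj
      by_contra hne
      exact not_dvd_of_lt (by omega) (by rw [abs_lt]; constructor <;> omega) h1
  · rintro ⟨k, hk⟩
    exact apex_ne_ringVertex hr hR k hk.symm

end Cap

/-! ### Faces and their spherical images -/

lemma vectorSpan_eq_top_of_interior {P : Set E3} (h : (interior P).Nonempty) :
    vectorSpan ℝ P = ⊤ := by
  have h1 := isOpen_interior.affineSpan_eq_top h
  have h2 : vectorSpan ℝ (interior P) = ⊤ := by
    rw [← direction_affineSpan, h1, AffineSubspace.direction_top]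
  exact top_le_iff.1 (h2 ▸ vectorSpan_mono ℝ interior_subset)

/-- The set of points of `P` at which the planes with outward normal `u` support `P`. -/
def supportSet (P : Set E3) (u : S2) : Set E3 := {x | u ∈ sphericalImageAt P x}

/-- Dimension `0` is excluded to rule out the empty exposed face, and dimension `3` to rule out the
zero functional, whose face is all of `P`. Any other exposing functional can be normalised. -/
lemma exists_eq_supportSet {P F : Set E3} {d : ℕ} (hP : (interior P).Nonempty) (hd0 : d ≠ 0)
    (hd3 : d ≠ 3) (hF : F ∈ facesOfDim d P) : F.Nonempty ∧ ∃ u, F = supportSet P u := by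
  obtain ⟨hexp, hdim⟩ := hF
  have hne : F.Nonempty := by
    by_contra hcon
    rw [not_nonempty_iff_eq_empty] at hcon
    rw [hcon, vectorSpan_empty, finrank_bot] at hdim
    exact hd0 hdim.symm
  refine ⟨hne, ?_⟩
  obtain ⟨l, hl⟩ := hexp hne
  set w := (InnerProductSpace.toDual ℝ E3).symm l with hw
  have hlw : ∀ x, l x = inner ℝ w x := fun x => by
    rw [hw, InnerProductSpace.toDual_symm_apply]
  have hw0 : w ≠ 0 := by
    intro h0
    have : F = P := by
      rw [hl]; ext x
      simp [hlw, h0]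
    rw [this, vectorSpan_eq_top_of_interior hP, finrank_top, finrank_euclideanSpace_fin] at hdim
    exact hd3 hdim.symm
  have hn : 0 < ‖w‖⁻¹ := inv_pos.2 (norm_pos_iff.2 hw0)
  refine ⟨⟨‖w‖⁻¹ • w, by
    rw [mem_sphere_zero_iff_norm, norm_smul, norm_inv, norm_norm,
      inv_mul_cancel₀ (norm_ne_zero_iff.2 hw0)]⟩, ?_⟩
  rw [hl]
  ext x
  simp only [supportSet, sphericalImageAt, mem_ofPred_eq, hlw, real_inner_smul_left]
  exact and_congr_right fun _ => forall₂_congr fun p _ => (mul_le_mul_iff_right₀ hn).symm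

lemma isExposed_supportSet (P : Set E3) (u : S2) : IsExposed ℝ P (supportSet P u) := fun _ =>
  ⟨InnerProductSpace.toDual ℝ E3 (u : E3), rfl⟩

lemma supportSet_eq_of_sphericalImage {P : Set E3} {u : S2} :
    supportSet P u = {x | ∀ w ∈ sphericalImageOfFace P (supportSet P u),
      w ∈ sphericalImageAt P x} := by
  apply subset_antisymm
  · exact fun x hx w hw => hw x hx
  · exact fun x hx => hx u fun z hz => hz

/-- A support set is recovered from its spherical image as the set of points where all those normals
support, so the map from faces to normals is injective. -/
lemma injOn_sphericalImageOfFace {P : Set E3} {d : ℕ} (hP : (interior P).Nonempty) (hd0 : d ≠ 0)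
    (hd3 : d ≠ 3) : InjOn (sphericalImageOfFace P) (facesOfDim d P) := by
  intro F hF G hG h
  obtain ⟨-, u, rfl⟩ := exists_eq_supportSet hP hd0 hd3 hF
  obtain ⟨-, w, rfl⟩ := exists_eq_supportSet hP hd0 hd3 hG
  rw [supportSet_eq_of_sphericalImage, supportSet_eq_of_sphericalImage (u := w), h]

lemma vectorSpan_le_orthogonal {F : Set E3} (s : Set E3) (c : E3 → ℝ)
    (h : ∀ w ∈ s, ∀ p ∈ F, inner ℝ w p = c w) : vectorSpan ℝ F ≤ (Submodule.span ℝ s)ᗮ := by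
  rw [vectorSpan_def, Submodule.span_le]
  rintro _ ⟨p, hp, q, hq, rfl⟩
  rw [SetLike.mem_coe, Submodule.mem_orthogonal]
  intro w hw
  induction hw using Submodule.span_induction with
  | mem w hw =>
    change inner ℝ w (p - q) = 0
    rw [inner_sub_right, h w hw p hp, h w hw q hq, sub_self]
  | zero => exact inner_zero_left _
  | add x y _ _ hx hy => rw [inner_add_left, hx, hy, add_zero]
  | smul a x _ hx => rw [real_inner_smul_left, hx, mul_zero]

lemma finrank_vectorSpan_eq_one {F : Set E3} {w₁ w₂ : E3} (c : E3 → ℝ)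
    (hw : LinearIndependent ℝ ![w₁, w₂]) (h₁ : ∀ p ∈ F, inner ℝ w₁ p = c w₁)
    (h₂ : ∀ p ∈ F, inner ℝ w₂ p = c w₂) {p q : E3} (hp : p ∈ F) (hq : q ∈ F) (hpq : p ≠ q) :
    Module.finrank ℝ (vectorSpan ℝ F) = 1 := by
  have hle := vectorSpan_le_orthogonal (F := F) (range ![w₁, w₂]) c (by
    rintro _ ⟨i, rfl⟩
    fin_cases i
    · exact h₁
    · exact h₂)
  have h2 := finrank_span_eq_card hw
  have h3 := Submodule.finrank_add_finrank_orthogonal (Submodule.span ℝ (range ![w₁, w₂]))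
  rw [finrank_euclideanSpace_fin, h2, Fintype.card_fin] at h3
  have h4 := Submodule.finrank_mono hle
  have h5 : 0 < Module.finrank ℝ (vectorSpan ℝ F) := by
    refine Submodule.one_le_finrank_iff.2 ?_
    intro hbot
    have := vsub_mem_vectorSpan ℝ hp hq
    rw [hbot, Submodule.mem_bot, vsub_eq_sub, sub_eq_zero] at this
    exact hpq this
  omega

lemma finrank_vectorSpan_eq_two {F : Set E3} {w : E3} (c : E3 → ℝ) (hw : w ≠ 0)
    (h : ∀ p ∈ F, inner ℝ w p = c w) {p q q' : E3} (hp : p ∈ F) (hq : q ∈ F) (hq' : q' ∈ F)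
    (hli : LinearIndependent ℝ ![q - p, q' - p]) : Module.finrank ℝ (vectorSpan ℝ F) = 2 := by
  have hle := vectorSpan_le_orthogonal (F := F) {w} c (by
    rintro _ rfl; exact h)
  have h2 := finrank_span_singleton (K := ℝ) hw
  have h3 := Submodule.finrank_add_finrank_orthogonal (Submodule.span ℝ {w})
  rw [finrank_euclideanSpace_fin, h2] at h3
  have h4 := Submodule.finrank_mono hle
  have h5 : Submodule.span ℝ (range ![q - p, q' - p]) ≤ vectorSpan ℝ F := by
    rw [Submodule.span_le]
    rintro _ ⟨i, rfl⟩
    fin_cases i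
    · exact vsub_mem_vectorSpan ℝ hq hp
    · exact vsub_mem_vectorSpan ℝ hq' hp
  have h6 := Submodule.finrank_mono h5
  rw [finrank_span_eq_card hli, Fintype.card_fin] at h6
  omega

section Cap

variable {m : ℕ} {φ r R : ℝ}

/-! ### Faces given by tight constraints, and their dimensions -/

/-- The face of the polyhedron cut out by equality in prescribed tangent half-spaces. -/
def tightFace (m : ℕ) (φ r R : ℝ) (T : Set (ℝ × ℤ)) : Set E3 :=
  {p | p ∈ cap m φ r R ∧ ∀ x ∈ T, slack m φ x.1 x.2 p = 0}

lemma mid_pred_eq (hm : 5 ≤ m) (k : ℤ) : inner ℝ (dir m φ k) (mid m φ (k - 1)) = apo m := by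
  apply inner_dir_mid_eq hm
  right
  simp

lemma slack_inner_ringVertex_self (hm : 5 ≤ m) (k : ℤ) :
    slack m φ r k (ringVertex m φ r R k) = 0 := by
  rw [slack_inner_ringVertex hm, inner_dir_mid_self hm]; simp

lemma slack_inner_succ_ringVertex (hm : 5 ≤ m) (k : ℤ) :
    slack m φ r (k + 1) (ringVertex m φ r R k) = 0 := by
  rw [slack_inner_ringVertex hm, inner_dir_succ_mid hm]; simp

lemma slack_outer_ringVertex_self (hm : 5 ≤ m) (hR : r < R) (k : ℤ) :
    slack m φ R k (ringVertex m φ r R k) = 0 := by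
  rw [slack_outer_ringVertex hm hR, inner_dir_mid_self hm]; simp

lemma slack_outer_succ_ringVertex (hm : 5 ≤ m) (hR : r < R) (k : ℤ) :
    slack m φ R (k + 1) (ringVertex m φ r R k) = 0 := by
  rw [slack_outer_ringVertex hm hR, inner_dir_succ_mid hm]; simp

lemma inner_eq_of_slack {ρ : ℝ} {k : ℤ} {p : E3} (h : slack m φ ρ k p = 0) :
    inner ℝ (vec (ρ • dir m φ k) (-1)) p = √(1 + ρ ^ 2) := by
  rw [inner_vec_smul_dir, h, sub_zero]

lemma vec_neg_one_ne_zero (y : E2) : vec y (-1) ≠ 0 := fun h => by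
  have := congrArg (fun x : E3 => x 2) h
  simp at this

lemma linearIndependent_vec {y z : E2} (h : y ≠ z) :
    LinearIndependent ℝ ![vec y (-1), vec z (-1)] := by
  rw [LinearIndependent.pair_iff]
  intro a b hab
  have h2 := congrArg (fun x : E3 => x 2) hab
  simp at h2
  have h1 := congrArg hor hab
  simp only [hor_add, hor_smul, hor_vec] at h1
  obtain rfl : b = -a := by linarith
  have h3 : a • (y - z) = hor 0 := by rw [← h1]; module
  have h4 : hor 0 = 0 := by ext i; fin_cases i <;> rfl
  rw [h4] at h3
  have := (smul_eq_zero.1 h3).resolve_right (sub_ne_zero.2 h)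
  simp [this]

lemma ray_ne_zero (m : ℕ) (φ R : ℝ) (k : ℤ) : ray m φ R k ≠ 0 := fun h => by
  have h1 := congrArg hor h
  have h4 : hor 0 = 0 := by ext i; fin_cases i <;> rfl
  rw [ray, hor_vec, h4] at h1
  exact dir_ne_zero _ _ _ h1

lemma finrank_tightFace_of_ne {k j : ℤ} {ρ ρ' : ℝ} (hne : ρ • dir m φ k ≠ ρ' • dir m φ j)
    {p q : E3} (hp : p ∈ tightFace m φ r R {(ρ, k), (ρ', j)})
    (hq : q ∈ tightFace m φ r R {(ρ, k), (ρ', j)}) (hpq : p ≠ q) :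
    Module.finrank ℝ (vectorSpan ℝ (tightFace m φ r R {(ρ, k), (ρ', j)})) = 1 := by
  have e1 : ∀ x ∈ tightFace m φ r R {(ρ, k), (ρ', j)}, slack m φ ρ k x = 0 := fun x hx =>
    hx.2 (ρ, k) (by simp)
  have e2 : ∀ x ∈ tightFace m φ r R {(ρ, k), (ρ', j)}, slack m φ ρ' j x = 0 := fun x hx =>
    hx.2 (ρ', j) (by simp)
  refine finrank_vectorSpan_eq_one (fun w => inner ℝ w p) (linearIndependent_vec hne) ?_ ?_
    hp hq hpq
  · intro x hx
    rw [inner_eq_of_slack (e1 x hx), inner_eq_of_slack (e1 p hp)]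
  · intro x hx
    rw [inner_eq_of_slack (e2 x hx), inner_eq_of_slack (e2 p hp)]

lemma finrank_tightFace_single {k : ℤ} {ρ : ℝ} {p q q' : E3}
    (hp : p ∈ tightFace m φ r R {(ρ, k)}) (hq : q ∈ tightFace m φ r R {(ρ, k)})
    (hq' : q' ∈ tightFace m φ r R {(ρ, k)}) (hli : LinearIndependent ℝ ![q - p, q' - p]) :
    Module.finrank ℝ (vectorSpan ℝ (tightFace m φ r R {(ρ, k)})) = 2 := by
  have e1 : ∀ x ∈ tightFace m φ r R {(ρ, k)}, slack m φ ρ k x = 0 := fun x hx =>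
    hx.2 (ρ, k) (by simp)
  refine finrank_vectorSpan_eq_two (fun w => inner ℝ w p)
    (vec_neg_one_ne_zero (ρ • dir m φ k)) ?_ hp hq hq' hli
  intro x hx
  rw [inner_eq_of_slack (e1 x hx), inner_eq_of_slack (e1 p hp)]

/-- The edges and facets of the polyhedron, paired with the corresponding cells of the planar
subdivision: `IsDual T A` says that the face where the half-spaces in `T` are tight corresponds
to the cell `A`. -/
def IsDualEdge (m : ℕ) (φ r R : ℝ) (T : Set (ℝ × ℤ)) (A : Set E2) : Prop :=
  ∃ k : ℤ, (T = {(r, k), (r, k + 1)} ∧ A = segment ℝ (r • dir m φ k) (r • dir m φ (k + 1))) ∨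
    (T = {(r, k), (R, k)} ∧ A = segment ℝ (r • dir m φ k) (R • dir m φ k)) ∨
    (T = {(R, k), (R, k + 1)} ∧ A = segment ℝ (R • dir m φ k) (R • dir m φ (k + 1)))

/-- The facets of the polyhedron, paired with the vertices of the planar subdivision. -/
def IsDualFacet (m : ℕ) (φ r R : ℝ) (T : Set (ℝ × ℤ)) (p : E2) : Prop :=
  ∃ k : ℤ, (T = {(r, k)} ∧ p = r • dir m φ k) ∨ (T = {(R, k)} ∧ p = R • dir m φ k)

lemma apex_mem_tightFace (hr : 0 < r) (hR : r < R) {T : Set (ℝ × ℤ)} (hT : ∀ x ∈ T, x.1 = r) :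
    apex r ∈ tightFace m φ r R T :=
  ⟨apex_mem_cap hr hR, fun x hx => by rw [hT x hx]; exact slack_inner_apex m φ r x.2⟩

lemma ringVertex_mem_tightFace (hm : 5 ≤ m) (hr : 0 < r) (hR : r < R) {T : Set (ℝ × ℤ)} {k : ℤ}
    (hT : ∀ x ∈ T, (x.1 = r ∨ x.1 = R) ∧ (x.2 = k ∨ x.2 = k + 1)) :
    ringVertex m φ r R k ∈ tightFace m φ r R T := by
  refine ⟨ringVertex_mem_cap hm hr hR k, fun x hx => ?_⟩
  obtain ⟨h1 | h1, h2 | h2⟩ := hT x hx <;> rw [h1, h2]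
  · exact slack_inner_ringVertex_self hm k
  · exact slack_inner_succ_ringVertex hm k
  · exact slack_outer_ringVertex_self hm hR k
  · exact slack_outer_succ_ringVertex hm hR k

lemma add_ray_mem_tightFace (hm : 5 ≤ m) (hr : 0 < r) (hR : r < R) {T : Set (ℝ × ℤ)} {k : ℤ}
    (hT : ∀ x ∈ T, x.1 = R ∧ (x.2 = k ∨ x.2 = k + 1)) {p : E3} (hp : p ∈ tightFace m φ r R T) :
    p + ray m φ R k ∈ tightFace m φ r R T := by
  have hmem := add_ray_mem_cap hm hr hR k zero_le_one hp.1
  have hsl : ∀ j, inner ℝ (dir m φ j) (mid m φ k) = apo m →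
      slack m φ R j (p + ray m φ R k) = slack m φ R j p := fun j hj => by
    have := slack_add_ray (m := m) (φ := φ) (R := R) R k j 1 p
    rw [one_smul, hj] at this
    rw [this]; ring
  rw [one_smul] at hmem
  refine ⟨hmem, fun x hx => ?_⟩
  have h0 := hp.2 x hx
  obtain ⟨h1, h2 | h2⟩ := hT x hx
  · rw [h1, h2] at h0 ⊢
    rw [hsl _ (inner_dir_mid_self hm φ k), h0]
  · rw [h1, h2] at h0 ⊢
    rw [hsl _ (inner_dir_succ_mid hm φ k), h0]

/-- Two independent normals bound the dimension by one. Two distinct points on the face are the apex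
and a ring vertex, two neighbouring ring vertices, or a ring vertex and its translate by a ray,
according to the type of edge. -/
lemma finrank_tightFace_edge (hm : 5 ≤ m) (hr : 0 < r) (hR : r < R) {T : Set (ℝ × ℤ)} {A : Set E2}
    (h : IsDualEdge m φ r R T A) :
    Module.finrank ℝ (vectorSpan ℝ (tightFace m φ r R T)) = 1 := by
  obtain ⟨k, ⟨rfl, -⟩ | ⟨rfl, -⟩ | ⟨rfl, -⟩⟩ := h
  · refine finrank_tightFace_of_ne
      (fun h => dir_ne_succ hm φ k (smul_right_injective _ hr.ne' h))
      (apex_mem_tightFace hr hR ?_) (ringVertex_mem_tightFace hm hr hR (k := k) ?_)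
      (apex_ne_ringVertex hr hR k)
    · simp
    · simp
  · refine finrank_tightFace_of_ne
      (fun h => hR.ne (smul_left_injective ℝ (dir_ne_zero m φ k) h))
      (ringVertex_mem_tightFace hm hr hR (k := k) ?_)
      (ringVertex_mem_tightFace hm hr hR (k := k - 1) ?_) fun h => ?_
    · simp
    · simp
    · have := ringVertex_inj hm hr hR h
      rw [show k - (k - 1) = 1 by ring] at this
      exact not_dvd_of_lt (by norm_num) (by norm_num; omega) this
  · have hx : ringVertex m φ r R k ∈ tightFace m φ r R {(R, k), (R, k + 1)} :=
      ringVertex_mem_tightFace hm hr hR (k := k) (by simp)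
    refine finrank_tightFace_of_ne
      (fun h => dir_ne_succ hm φ k (smul_right_injective _ (hr.trans hR).ne' h)) hx
      (add_ray_mem_tightFace hm hr hR (k := k) (by simp) hx) ?_
    simpa using ray_ne_zero m φ R k

lemma linearIndependent_mid (hm : 5 ≤ m) (φ : ℝ) (k : ℤ) :
    LinearIndependent ℝ ![mid m φ k, mid m φ (k - 1)] := by
  rw [LinearIndependent.pair_iff]
  intro a b hab
  have h1 := congrArg (fun y : E2 => inner ℝ (dir m φ k) y) hab
  have h2 := congrArg (fun y : E2 => inner ℝ (dir m φ (k + 1)) y) hab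
  simp only [inner_add_right, inner_smul_right, inner_zero_right, mid_pred_eq hm,
    inner_dir_mid_self hm, inner_dir_succ_mid hm] at h1 h2
  have hc := apo_pos hm
  have hlt : inner ℝ (dir m φ (k + 1)) (mid m φ (k - 1)) < apo m := by
    apply inner_dir_mid_lt hm
    · rw [show k + 1 - (k - 1) = 2 by ring]; exact not_dvd_two hm
    · rw [show k + 1 - (k - 1) - 1 = 1 by ring]
      exact not_dvd_of_lt (by norm_num) (by norm_num; omega)
  have h3 : b * (apo m - inner ℝ (dir m φ (k + 1)) (mid m φ (k - 1))) = 0 := by linarith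
  have hb := (mul_eq_zero.1 h3).resolve_right (by linarith)
  rw [hb, zero_mul, add_zero] at h1
  exact ⟨(mul_eq_zero.1 h1).resolve_right hc.ne', hb⟩

/-- Three non-collinear points are the two ring vertices on either side of spoke `k`, together with
the apex for an inner node or with a point of an unbounded edge for an outer node. -/
lemma finrank_tightFace_facet (hm : 5 ≤ m) (hr : 0 < r) (hR : r < R) {T : Set (ℝ × ℤ)} {y : E2}
    (h : IsDualFacet m φ r R T y) :
    Module.finrank ℝ (vectorSpan ℝ (tightFace m φ r R T)) = 2 := by
  have hs := (div_pos (slope_pos hr hR) (apo_pos hm)).ne'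
  have hor0 : hor 0 = 0 := by ext i; fin_cases i <;> rfl
  obtain ⟨k, ⟨rfl, -⟩ | ⟨rfl, -⟩⟩ := h
  · have hmid := LinearIndependent.pair_iff.1 (linearIndependent_mid hm φ k)
    refine finrank_tightFace_single (apex_mem_tightFace hr hR (by simp))
      (ringVertex_mem_tightFace hm hr hR (k := k) (by simp))
      (ringVertex_mem_tightFace hm hr hR (k := k - 1) (by simp)) ?_
    rw [LinearIndependent.pair_iff]
    intro a b hab
    have h1 := congrArg hor hab
    simp only [hor_add, hor_smul, hor_sub, ringVertex, apex, hor_vec, sub_zero, smul_smul,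
      hor0] at h1
    obtain ⟨h2, h3⟩ := hmid _ _ h1
    exact ⟨(mul_eq_zero.1 h2).resolve_right hs, (mul_eq_zero.1 h3).resolve_right hs⟩
  · have hmid := LinearIndependent.pair_iff.1 (linearIndependent_mid hm φ k)
    have hx : ringVertex m φ r R k ∈ tightFace m φ r R {(R, k)} :=
      ringVertex_mem_tightFace hm hr hR (k := k) (by simp)
    refine finrank_tightFace_single hx
      (ringVertex_mem_tightFace hm hr hR (k := k - 1) (by simp))
      (add_ray_mem_tightFace hm hr hR (k := k) (by simp) hx) ?_
    rw [LinearIndependent.pair_iff]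
    intro a b hab
    have h1 := congrArg hor hab
    simp only [hor_add, hor_smul, hor_sub, ringVertex, ray, hor_vec, hor0] at h1
    obtain ⟨h2, h3⟩ := hmid (b - a * (slope r R / apo m)) (a * (slope r R / apo m))
      (by rw [← h1]; module)
    have ha := (mul_eq_zero.1 h3).resolve_right hs
    rw [ha] at h2
    exact ⟨ha, by linarith⟩

/-! ### Spherical images of edges and facets -/

lemma mem_ringCell_of_ringVertex_mem (hm : 5 ≤ m) (hr : 0 < r) (hR : r < R) {F : Set E3} {k : ℤ}
    (hF : ringVertex m φ r R k ∈ F) {y : E2}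
    (hy : invGnomonic y ∈ sphericalImageOfFace (cap m φ r R) F) : y ∈ ringCell m φ r R k := by
  have := hy _ hF
  rw [sphericalImageAt_ringVertex hm hr hR] at this
  exact (invGnomonic_injective.mem_set_image).1 this

lemma mem_polygon_of_apex_mem (hm : 5 ≤ m) (hr : 0 < r) (hR : r < R) {F : Set E3}
    (hF : apex r ∈ F) {y : E2}
    (hy : invGnomonic y ∈ sphericalImageOfFace (cap m φ r R) F) : y ∈ polygon m φ r := by
  have := hy _ hF
  rw [sphericalImageAt_apex hm hr hR] at this
  exact (invGnomonic_injective.mem_set_image).1 this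

lemma notMem_interior_of_ray_mem (hm : 5 ≤ m) (hr : 0 < r) (hR : r < R) {F : Set E3} {k : ℤ}
    (hF : ringVertex m φ r R k + ray m φ R k ∈ F) {y : E2}
    (hy : invGnomonic y ∈ sphericalImageOfFace (cap m φ r R) F) :
    y ∈ (interior (polygon m φ R))ᶜ := by
  have h1 := (mem_sphericalImageAt_invGnomonic.1 (hy _ hF)).2 _ (ringVertex_mem_cap hm hr hR k)
  rw [val_add, val_ray] at h1
  rw [interior_polygon hm (hr.trans hR)]
  intro h2
  have := h2 k
  linarith

lemma exists_eq_of_mem_sphericalImageOfFace (hm : 5 ≤ m) (hr : 0 < r) (hR : r < R) {F : Set E3}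
    (hF : F.Nonempty) {u : S2} (hu : u ∈ sphericalImageOfFace (cap m φ r R) F) :
    ∃ y, u = invGnomonic y := by
  obtain ⟨x, hx⟩ := hF
  obtain ⟨y, -, rfl⟩ := exists_eq_invGnomonic hm hr hR (hu x hx)
  exact ⟨y, rfl⟩

/-- Testing a normal at two points of the face places it in two adjacent closed traces, whose
intersection is the dual edge; for an unbounded edge the second point is a translate along the ray.
Conversely, along that edge only the constraints in `T` carry nonzero weight. -/
lemma sphericalImage_tightFace_edge (hm : 5 ≤ m) (hr : 0 < r) (hR : r < R) {T : Set (ℝ × ℤ)}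
    {A : Set E2} (h : IsDualEdge m φ r R T A) :
    sphericalImageOfFace (cap m φ r R) (tightFace m φ r R T) = invGnomonic '' A := by
  have hR0 := hr.trans hR
  obtain ⟨k, ⟨rfl, rfl⟩ | ⟨rfl, rfl⟩ | ⟨rfl, rfl⟩⟩ := h
  · have ha : apex r ∈ tightFace m φ r R {(r, k), (r, k + 1)} :=
      apex_mem_tightFace hr hR (by simp)
    have hx : ringVertex m φ r R k ∈ tightFace m φ r R {(r, k), (r, k + 1)} :=
      ringVertex_mem_tightFace hm hr hR (k := k) (by simp)
    apply subset_antisymm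
    · intro u hu
      obtain ⟨y, rfl⟩ := exists_eq_of_mem_sphericalImageOfFace hm hr hR ⟨_, ha⟩ hu
      refine mem_image_of_mem _ ?_
      rw [← polygon_inter_ringCell hm hr hR]
      exact ⟨mem_polygon_of_apex_mem hm hr hR ha hu, mem_ringCell_of_ringVertex_mem hm hr hR hx hu⟩
    · rintro _ ⟨y, hy, rfl⟩ p hp
      obtain ⟨α, β, hα, hβ, hs, rfl⟩ := (mem_edge_iff hr).1 hy
      rw [mem_sphericalImageAt_iff hm hr hR hα hβ hs.ge (hs.trans_le hR.le) hp.1, hs,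
        hp.2 (r, k) (by simp), hp.2 (r, k + 1) (by simp)]
      simp
  · have hx : ringVertex m φ r R k ∈ tightFace m φ r R {(r, k), (R, k)} :=
      ringVertex_mem_tightFace hm hr hR (k := k) (by simp)
    have hx' : ringVertex m φ r R (k - 1) ∈ tightFace m φ r R {(r, k), (R, k)} :=
      ringVertex_mem_tightFace hm hr hR (k := k - 1) (by simp)
    apply subset_antisymm
    · intro u hu
      obtain ⟨y, rfl⟩ := exists_eq_of_mem_sphericalImageOfFace hm hr hR ⟨_, hx⟩ hu
      refine mem_image_of_mem _ ?_
      rw [← ringCell_inter_pred hm hr hR]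
      exact ⟨mem_ringCell_of_ringVertex_mem hm hr hR hx hu,
        mem_ringCell_of_ringVertex_mem hm hr hR hx' hu⟩
    · rintro _ ⟨y, hy, rfl⟩ p hp
      obtain ⟨μ, h1, h2, rfl⟩ := (mem_spoke_iff hR).1 hy
      have := mem_sphericalImageAt_iff (φ := φ) (k := k) (β := 0) hm hr hR (by linarith : 0 ≤ μ)
        le_rfl (by simpa using h1) (by simpa using h2) hp.1
      rw [zero_smul, add_zero] at this
      rw [this, hp.2 (r, k) (by simp), hp.2 (R, k) (by simp)]
      simp
  · have hx : ringVertex m φ r R k ∈ tightFace m φ r R {(R, k), (R, k + 1)} :=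
      ringVertex_mem_tightFace hm hr hR (k := k) (by simp)
    have hx' := add_ray_mem_tightFace hm hr hR (k := k) (by simp) hx
    apply subset_antisymm
    · intro u hu
      obtain ⟨y, rfl⟩ := exists_eq_of_mem_sphericalImageOfFace hm hr hR ⟨_, hx⟩ hu
      refine mem_image_of_mem _ ?_
      rw [← ringCell_sdiff_interior hm hr hR]
      exact ⟨mem_ringCell_of_ringVertex_mem hm hr hR hx hu,
        notMem_interior_of_ray_mem hm hr hR hx' hu⟩
    · rintro _ ⟨y, hy, rfl⟩ p hp
      obtain ⟨α, β, hα, hβ, hs, rfl⟩ := (mem_edge_iff hR0).1 hy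
      rw [mem_sphericalImageAt_iff hm hr hR hα hβ (hR.le.trans hs.ge) hs.le hp.1, hs,
        hp.2 (R, k) (by simp), hp.2 (R, k + 1) (by simp)]
      simp

lemma sphericalImage_tightFace_facet (hm : 5 ≤ m) (hr : 0 < r) (hR : r < R) {T : Set (ℝ × ℤ)}
    {y : E2} (h : IsDualFacet m φ r R T y) :
    sphericalImageOfFace (cap m φ r R) (tightFace m φ r R T) = {invGnomonic y} := by
  have hR0 := hr.trans hR
  obtain ⟨k, ⟨rfl, rfl⟩ | ⟨rfl, rfl⟩⟩ := h
  · have ha : apex r ∈ tightFace m φ r R {(r, k)} := apex_mem_tightFace hr hR (by simp)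
    have hx : ringVertex m φ r R k ∈ tightFace m φ r R {(r, k)} :=
      ringVertex_mem_tightFace hm hr hR (k := k) (by simp)
    have hx' : ringVertex m φ r R (k - 1) ∈ tightFace m φ r R {(r, k)} :=
      ringVertex_mem_tightFace hm hr hR (k := k - 1) (by simp)
    apply subset_antisymm
    · intro u hu
      obtain ⟨y, rfl⟩ := exists_eq_of_mem_sphericalImageOfFace hm hr hR ⟨_, hx⟩ hu
      have h1 := ringCell_inter_pred hm hr hR k ▸
        (mem_inter (mem_ringCell_of_ringVertex_mem hm hr hR hx hu)
        (mem_ringCell_of_ringVertex_mem hm hr hR hx' hu))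
      obtain ⟨μ, h2, h3, rfl⟩ := (mem_spoke_iff hR).1 h1
      have h4 := (smul_dir_mem_polygon_iff hm (by linarith) k).1
        (mem_polygon_of_apex_mem hm hr hR ha hu)
      rw [le_antisymm h4 h2]; rfl
    · rintro _ rfl p hp
      have := mem_sphericalImageAt_iff (φ := φ) (k := k) (β := 0) hm hr hR hr.le
        le_rfl (by simp) (by simpa using hR.le) hp.1
      rw [zero_smul, add_zero] at this
      rw [this, hp.2 (r, k) (by simp)]
      simp
  · have hx : ringVertex m φ r R k ∈ tightFace m φ r R {(R, k)} :=
      ringVertex_mem_tightFace hm hr hR (k := k) (by simp)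
    have hx' : ringVertex m φ r R (k - 1) ∈ tightFace m φ r R {(R, k)} :=
      ringVertex_mem_tightFace hm hr hR (k := k - 1) (by simp)
    have hx'' := add_ray_mem_tightFace hm hr hR (k := k) (by simp) hx
    apply subset_antisymm
    · intro u hu
      obtain ⟨y, rfl⟩ := exists_eq_of_mem_sphericalImageOfFace hm hr hR ⟨_, hx⟩ hu
      have h1 := ringCell_inter_pred hm hr hR k ▸
        (mem_inter (mem_ringCell_of_ringVertex_mem hm hr hR hx hu)
        (mem_ringCell_of_ringVertex_mem hm hr hR hx' hu))
      obtain ⟨μ, h2, h3, rfl⟩ := (mem_spoke_iff hR).1 h1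
      have h4 := (smul_dir_notMem_interior_iff hm hR0 (by linarith) k).1
        (notMem_interior_of_ray_mem hm hr hR hx'' hu)
      rw [le_antisymm h3 h4]; rfl
    · rintro _ rfl p hp
      have := mem_sphericalImageAt_iff (φ := φ) (k := k) (β := 0) hm hr hR hR0.le
        le_rfl (by simpa using hR.le) (by simp) hp.1
      rw [zero_smul, add_zero] at this
      rw [this, hp.2 (R, k) (by simp)]
      simp

/-! ### Classification of the faces -/

lemma supportSet_eq_tightFace {u : S2} {T : Set (ℝ × ℤ)}
    (h : ∀ p ∈ cap m φ r R, u ∈ sphericalImageAt (cap m φ r R) p ↔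
      ∀ x ∈ T, slack m φ x.1 x.2 p = 0) :
    supportSet (cap m φ r R) u = tightFace m φ r R T := by
  ext p
  constructor
  · intro hp
    exact ⟨hp.1, (h p hp.1).1 hp⟩
  · rintro ⟨hp, hp'⟩
    exact (h p hp).2 hp'

/-- With `β = 0` only the two constraints in direction `k` remain, weighted by `R - μ` and `μ - r`.
At an end of the spoke one weight vanishes and its constraint is dropped, which turns an edge into a
facet. -/
lemma supportSet_smul_dir (hm : 5 ≤ m) (hr : 0 < r) (hR : r < R) (k : ℤ) {μ : ℝ} (h1 : r ≤ μ)
    (h2 : μ ≤ R) : supportSet (cap m φ r R) (invGnomonic (μ • dir m φ k)) =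
      tightFace m φ r R ({x | x = (r, k) ∧ μ ≠ R} ∪ {x | x = (R, k) ∧ μ ≠ r}) := by
  apply supportSet_eq_tightFace
  intro p hp
  have hμ : μ ≠ 0 := by linarith
  have := mem_sphericalImageAt_iff (φ := φ) (k := k) (β := 0) hm hr hR (by linarith : 0 ≤ μ)
    le_rfl (by simpa using h1) (by simpa using h2) hp
  rw [zero_smul, add_zero] at this
  rw [this]
  simp only [add_zero, mul_eq_zero, hμ, false_or, zero_mul, and_true, sub_eq_zero,
    mem_union, mem_ofPred_eq, or_imp, forall_and, and_imp, forall_eq]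
  have e1 : R = μ ↔ μ = R := eq_comm
  rw [e1]
  tauto

lemma supportSet_inner_edge (hm : 5 ≤ m) (hr : 0 < r) (hR : r < R) (k : ℤ) {α β : ℝ} (hα : 0 < α)
    (hβ : 0 < β) (h : α + β = r) :
    supportSet (cap m φ r R) (invGnomonic (α • dir m φ k + β • dir m φ (k + 1))) =
      tightFace m φ r R {(r, k), (r, k + 1)} := by
  apply supportSet_eq_tightFace
  intro p hp
  have hd : R - r ≠ 0 := by linarith
  rw [mem_sphericalImageAt_iff hm hr hR hα.le hβ.le h.ge (h.trans_le hR.le) hp, h]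
  simp [hα.ne', hβ.ne', hd]

lemma supportSet_outer_edge (hm : 5 ≤ m) (hr : 0 < r) (hR : r < R) (k : ℤ) {α β : ℝ} (hα : 0 < α)
    (hβ : 0 < β) (h : α + β = R) :
    supportSet (cap m φ r R) (invGnomonic (α • dir m φ k + β • dir m φ (k + 1))) =
      tightFace m φ r R {(R, k), (R, k + 1)} := by
  apply supportSet_eq_tightFace
  intro p hp
  have hd : R - r ≠ 0 := by linarith
  rw [mem_sphericalImageAt_iff hm hr hR hα.le hβ.le (hR.le.trans h.ge) h.le hp, h]
  simp [hα.ne', hβ.ne', hd]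

lemma supportSet_spoke (hm : 5 ≤ m) (hr : 0 < r) (hR : r < R) (k : ℤ) {μ : ℝ} (h1 : r < μ)
    (h2 : μ < R) : supportSet (cap m φ r R) (invGnomonic (μ • dir m φ k)) =
      tightFace m φ r R {(r, k), (R, k)} := by
  rw [supportSet_smul_dir hm hr hR k h1.le h2.le]
  congr 1
  ext x
  simp [h1.ne', h2.ne, or_comm]

lemma supportSet_inner_node (hm : 5 ≤ m) (hr : 0 < r) (hR : r < R) (k : ℤ) :
    supportSet (cap m φ r R) (invGnomonic (r • dir m φ k)) = tightFace m φ r R {(r, k)} := by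
  rw [supportSet_smul_dir hm hr hR k le_rfl hR.le]
  congr 1
  ext x
  simp [hR.ne]

lemma supportSet_outer_node (hm : 5 ≤ m) (hr : 0 < r) (hR : r < R) (k : ℤ) :
    supportSet (cap m φ r R) (invGnomonic (R • dir m φ k)) = tightFace m φ r R {(R, k)} := by
  rw [supportSet_smul_dir hm hr hR k hR.le le_rfl]
  congr 1
  ext x
  simp [hR.ne']

/-- The position of the normal in the subdivision decides: open cells give single vertices, relative
interiors of edges give edges, and nodes give facets. -/
lemma supportSet_cases (hm : 5 ≤ m) (hr : 0 < r) (hR : r < R) {u : S2}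
    (hne : (supportSet (cap m φ r R) u).Nonempty) :
    (supportSet (cap m φ r R) u).Subsingleton ∨
    (∃ T A, IsDualEdge m φ r R T A ∧ supportSet (cap m φ r R) u = tightFace m φ r R T) ∨
    ∃ T p, IsDualFacet m φ r R T p ∧ supportSet (cap m φ r R) u = tightFace m φ r R T := by
  obtain ⟨x, hx⟩ := hne
  obtain ⟨y, hy, rfl⟩ := exists_eq_invGnomonic hm hr hR hx
  obtain ⟨k, α, β, hα, hβ, rfl⟩ := exists_dir_combination hm φ y
  have hsum := (combination_mem_polygon_iff hm hα hβ).1 hy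
  have hsub : ∀ z, (∀ p ∈ supportSet (cap m φ r R)
      (invGnomonic (α • dir m φ k + β • dir m φ (k + 1))), p = z) →
      (supportSet (cap m φ r R)
        (invGnomonic (α • dir m φ k + β • dir m φ (k + 1)))).Subsingleton :=
    fun z h p hp q hq => (h p hp).trans (h q hq).symm
  have hspoke : ∀ (j : ℤ) (μ : ℝ), r ≤ μ → μ ≤ R →
      (∃ T A, IsDualEdge m φ r R T A ∧
        supportSet (cap m φ r R) (invGnomonic (μ • dir m φ j)) = tightFace m φ r R T) ∨
      ∃ T p, IsDualFacet m φ r R T p ∧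
        supportSet (cap m φ r R) (invGnomonic (μ • dir m φ j)) = tightFace m φ r R T := by
    intro j μ h1 h2
    rcases h1.eq_or_lt with rfl | h1
    · exact Or.inr ⟨_, _, ⟨j, Or.inl ⟨rfl, rfl⟩⟩, supportSet_inner_node hm hr hR j⟩
    rcases h2.eq_or_lt with rfl | h2
    · exact Or.inr ⟨_, _, ⟨j, Or.inr ⟨rfl, rfl⟩⟩, supportSet_outer_node hm hr hR j⟩
    · exact Or.inl ⟨_, _, ⟨j, Or.inr (Or.inl ⟨rfl, rfl⟩)⟩, supportSet_spoke hm hr hR j h1 h2⟩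
  rcases lt_or_ge (α + β) r with hlt | hge
  · left
    refine hsub (apex r) fun p hp => ?_
    by_contra hne
    have h1 := val_lt_apex (k := k) hm hα hβ hlt hp.1 hne
    have h2 := (mem_sphericalImageAt_invGnomonic.1 hp).2 _ (apex_mem_cap hr hR)
    linarith
  rcases hα.eq_or_lt with rfl | hα
  · right
    rw [zero_smul, zero_add] at *
    exact hspoke (k + 1) β (by linarith) (by linarith)
  rcases hβ.eq_or_lt with rfl | hβ
  · right
    rw [zero_smul, add_zero] at *
    exact hspoke k α (by linarith) (by linarith)
  rcases hge.eq_or_lt with heq | hgt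
  · right; left
    exact ⟨_, _, ⟨k, Or.inl ⟨rfl, rfl⟩⟩, supportSet_inner_edge hm hr hR k hα hβ heq.symm⟩
  rcases hsum.eq_or_lt with heq | hlt
  · right; left
    exact ⟨_, _, ⟨k, Or.inr (Or.inr ⟨rfl, rfl⟩)⟩, supportSet_outer_edge hm hr hR k hα hβ heq⟩
  · left
    refine hsub (ringVertex m φ r R k) fun p hp => ?_
    by_contra hne
    have h1 := val_lt_ringVertex hm hr hR hα hβ hgt hlt hp.1 hne
    have h2 := (mem_sphericalImageAt_invGnomonic.1 hp).2 _ (ringVertex_mem_cap hm hr hR k)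
    linarith

lemma finrank_vectorSpan_subsingleton {F : Set E3} (hF : F.Subsingleton) :
    Module.finrank ℝ (vectorSpan ℝ F) = 0 := by
  rw [vectorSpan_of_subsingleton ℝ hF, finrank_bot]

lemma tightFace_edge_mem (hm : 5 ≤ m) (hr : 0 < r) (hR : r < R) {T : Set (ℝ × ℤ)} {A : Set E2}
    (h : IsDualEdge m φ r R T A) : tightFace m φ r R T ∈ facesOfDim 1 (cap m φ r R) := by
  refine ⟨?_, finrank_tightFace_edge hm hr hR h⟩
  have hR0 := hr.trans hR
  obtain ⟨k, ⟨rfl, -⟩ | ⟨rfl, -⟩ | ⟨rfl, -⟩⟩ := h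
  · rw [← supportSet_inner_edge hm hr hR k (half_pos hr) (half_pos hr) (add_halves r)]
    exact isExposed_supportSet _ _
  · rw [← supportSet_spoke hm hr hR k (μ := (r + R) / 2) (by linarith) (by linarith)]
    exact isExposed_supportSet _ _
  · rw [← supportSet_outer_edge hm hr hR k (half_pos hR0) (half_pos hR0) (add_halves R)]
    exact isExposed_supportSet _ _

lemma tightFace_facet_mem (hm : 5 ≤ m) (hr : 0 < r) (hR : r < R) {T : Set (ℝ × ℤ)} {p : E2}
    (h : IsDualFacet m φ r R T p) : tightFace m φ r R T ∈ facesOfDim 2 (cap m φ r R) := by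
  refine ⟨?_, finrank_tightFace_facet hm hr hR h⟩
  obtain ⟨k, ⟨rfl, -⟩ | ⟨rfl, -⟩⟩ := h
  · rw [← supportSet_inner_node hm hr hR k]
    exact isExposed_supportSet _ _
  · rw [← supportSet_outer_node hm hr hR k]
    exact isExposed_supportSet _ _

lemma bijOn_edges (hm : 5 ≤ m) (hr : 0 < r) (hR : r < R) :
    BijOn (sphericalImageOfFace (cap m φ r R)) (facesOfDim 1 (cap m φ r R))
      (subdivisionClosedEdges (ringSubdivision (m + 1) φ r R)) := by
  have hint := interior_cap_nonempty m φ r R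
  rw [subdivisionClosedEdges_eq hm hr hR]
  refine ⟨fun F hF => ?_, injOn_sphericalImageOfFace hint one_ne_zero (by norm_num), ?_⟩
  · obtain ⟨hne, u, rfl⟩ := exists_eq_supportSet hint one_ne_zero (by norm_num) hF
    have hdim := hF.2
    rcases supportSet_cases hm hr hR hne with h | ⟨T, A, hTA, h⟩ | ⟨T, p, hTp, h⟩
    · rw [finrank_vectorSpan_subsingleton h] at hdim
      exact absurd hdim (by norm_num)
    · rw [h, sphericalImage_tightFace_edge hm hr hR hTA]
      refine mem_image_of_mem _ ?_
      obtain ⟨k, ⟨-, h⟩ | ⟨-, h⟩ | ⟨-, h⟩⟩ := hTA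
      · exact ⟨k, Or.inl h⟩
      · exact ⟨k, Or.inr (Or.inl h)⟩
      · exact ⟨k, Or.inr (Or.inr h)⟩
    · rw [h, finrank_tightFace_facet hm hr hR hTp] at hdim
      exact absurd hdim (by norm_num)
  · rintro _ ⟨A, ⟨k, hA⟩, rfl⟩
    obtain ⟨T, hT⟩ : ∃ T, IsDualEdge m φ r R T A := by
      rcases hA with h | h | h
      · exact ⟨_, k, Or.inl ⟨rfl, h⟩⟩
      · exact ⟨_, k, Or.inr (Or.inl ⟨rfl, h⟩)⟩
      · exact ⟨_, k, Or.inr (Or.inr ⟨rfl, h⟩)⟩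
    exact ⟨_, tightFace_edge_mem hm hr hR hT, sphericalImage_tightFace_edge hm hr hR hT⟩

lemma bijOn_facets (hm : 5 ≤ m) (hr : 0 < r) (hR : r < R) :
    BijOn (sphericalImageOfFace (cap m φ r R)) (facesOfDim 2 (cap m φ r R))
      ((fun v => {v}) '' subdivisionVertices (ringSubdivision (m + 1) φ r R)) := by
  have hint := interior_cap_nonempty m φ r R
  rw [subdivisionVertices_eq hm hr hR]
  refine ⟨fun F hF => ?_, injOn_sphericalImageOfFace hint two_ne_zero (by norm_num), ?_⟩
  · obtain ⟨hne, u, rfl⟩ := exists_eq_supportSet hint two_ne_zero (by norm_num) hF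
    have hdim := hF.2
    rcases supportSet_cases hm hr hR hne with h | ⟨T, A, hTA, h⟩ | ⟨T, p, hTp, h⟩
    · rw [finrank_vectorSpan_subsingleton h] at hdim
      exact absurd hdim (by norm_num)
    · rw [h, finrank_tightFace_edge hm hr hR hTA] at hdim
      exact absurd hdim (by norm_num)
    · rw [h, sphericalImage_tightFace_facet hm hr hR hTp]
      refine ⟨_, mem_image_of_mem _ ?_, rfl⟩
      obtain ⟨k, ⟨-, h⟩ | ⟨-, h⟩⟩ := hTp
      · exact ⟨k, Or.inl h⟩
      · exact ⟨k, Or.inr h⟩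
  · rintro _ ⟨_, ⟨p, ⟨k, hp⟩, rfl⟩, rfl⟩
    obtain ⟨T, hT⟩ : ∃ T, IsDualFacet m φ r R T p := by
      rcases hp with h | h
      · exact ⟨_, k, Or.inl ⟨rfl, h⟩⟩
      · exact ⟨_, k, Or.inr ⟨rfl, h⟩⟩
    exact ⟨_, tightFace_facet_mem hm hr hR hT, sphericalImage_tightFace_facet hm hr hR hT⟩

lemma bijOn_vertices (hm : 5 ≤ m) (hr : 0 < r) (hR : r < R) :
    BijOn (sphericalImageAt (cap m φ r R)) (polyVertices (cap m φ r R))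
      (closure '' ringSubdivision (m + 1) φ r R) := by
  rw [closure_image_ringSubdivision hm hr hR, polyVertices_cap hm hr hR]
  have hne : ∀ k, invGnomonic '' polygon m φ r ≠ invGnomonic '' ringCell m φ r R k := by
    intro k h
    have h0 : (0 : E2) ∈ polygon m φ r := interior_subset (zero_mem_interior_polygon hm hr)
    rw [invGnomonic_injective.image_injective h] at h0
    exact zero_notMem_ringCell hm hr k h0
  refine ⟨?_, ?_, ?_⟩
  · rintro _ (rfl | ⟨k, rfl⟩)
    · rw [sphericalImageAt_apex hm hr hR]
      exact mem_insert _ _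
    · rw [sphericalImageAt_ringVertex hm hr hR]
      exact mem_insert_of_mem _ ⟨k, rfl⟩
  · rintro _ (rfl | ⟨k, rfl⟩) _ (rfl | ⟨j, rfl⟩) h
    · rfl
    · rw [sphericalImageAt_apex hm hr hR, sphericalImageAt_ringVertex hm hr hR] at h
      exact absurd h (hne j)
    · rw [sphericalImageAt_apex hm hr hR, sphericalImageAt_ringVertex hm hr hR] at h
      exact absurd h.symm (hne k)
    · rw [sphericalImageAt_ringVertex hm hr hR, sphericalImageAt_ringVertex hm hr hR] at h
      exact ringVertex_congr hm (ringCell_inj hm hr hR (invGnomonic_injective.image_injective h))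
  · rintro _ (rfl | ⟨k, rfl⟩)
    · exact ⟨_, mem_insert _ _, sphericalImageAt_apex hm hr hR⟩
    · exact ⟨_, mem_insert_of_mem _ ⟨k, rfl⟩, sphericalImageAt_ringVertex hm hr hR k⟩

lemma sphericalImageSubdivision_cap (hm : 5 ≤ m) (hr : 0 < r) (hR : r < R) :
    sphericalImageSubdivision (cap m φ r R) = ringSubdivision (m + 1) φ r R := by
  rw [sphericalImageSubdivision, polyVertices_cap hm hr hR, ringSubdivision_eq hm hr hR,
    image_insert_eq, sphericalImageAt_apex hm hr hR, interior_image_invGnomonic, ← range_comp]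
  simp only [Function.comp_def, sphericalImageAt_ringVertex hm hr hR, interior_image_invGnomonic]

end Cap

/-! ### The shadow number of the tangent polyhedron -/

section Cap

variable {m : ℕ} {φ r R : ℝ}

lemma convex_cap (m : ℕ) (φ r R : ℝ) : Convex ℝ (cap m φ r R) := by
  intro p hp q hq a b ha hb hab k
  have e : ∀ ρ, slack m φ ρ k (a • p + b • q) = a * slack m φ ρ k p + b * slack m φ ρ k q := by
    intro ρ
    rw [slack_eq_val, slack_eq_val, slack_eq_val, val_add, val_smul, val_smul]
    obtain rfl : b = 1 - a := by linarith
    ring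
  rw [e, e]
  exact ⟨add_nonneg (mul_nonneg ha (hp k).1) (mul_nonneg hb (hq k).1),
    add_nonneg (mul_nonneg ha (hp k).2) (mul_nonneg hb (hq k).2)⟩

lemma ray_congr (hm : 5 ≤ m) {k j : ℤ} (h : (m : ℤ) ∣ k - j) : ray m φ R k = ray m φ R j := by
  rw [ray, ray, mid_congr (by omega) φ h]

lemma finite_range_of_congr (hm : 5 ≤ m) {X : Type*} (f : ℤ → X)
    (hf : ∀ k j : ℤ, (m : ℤ) ∣ k - j → f k = f j) : (range f).Finite := by
  apply ((Finset.range m).finite_toSet.image fun k : ℕ => f k).subset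
  rintro _ ⟨k, rfl⟩
  obtain ⟨j, hj, hd⟩ := exists_range_dvd_sub (by omega : 0 < m) k
  exact ⟨j, hj, (hf _ _ hd).symm⟩

lemma finite_polyVertices_cap (hm : 5 ≤ m) (hr : 0 < r) (hR : r < R) :
    (polyVertices (cap m φ r R)).Finite := by
  rw [polyVertices_cap hm hr hR]
  exact (finite_range_of_congr hm _ fun k j h => ringVertex_congr hm h).insert _

/-- An extreme point is not in the convex hull of finitely many other points of `A`; that hull is
compact, so it can be strictly separated from the point. -/
lemma exists_separating_functional {A T : Set E3} {q : E3} (hA : Convex ℝ A)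
    (hq : q ∈ A.extremePoints ℝ) (hT : T.Finite) (hTA : T ⊆ A) (hqT : q ∉ T) :
    ∃ w : E3, ∀ z ∈ T, inner ℝ w z < inner ℝ w q := by
  have h1 := (hA.mem_extremePoints_iff_mem_sdiff_convexHull_sdiff.1 hq).2
  have hsub : T ⊆ A \ {q} := fun z hz =>
    ⟨hTA hz, fun hzq => hqT (by rwa [mem_singleton_iff.1 hzq] at hz)⟩
  have h2 : q ∉ convexHull ℝ T := fun h => h1 (convexHull_mono hsub h)
  obtain ⟨f, u, hf, hu⟩ := geometric_hahn_banach_closed_point (convex_convexHull ℝ T)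
    (hT.isCompact_convexHull ℝ).isClosed h2
  refine ⟨(InnerProductSpace.toDual ℝ E3).symm f, fun z hz => ?_⟩
  rw [InnerProductSpace.toDual_symm_apply, InnerProductSpace.toDual_symm_apply]
  exact (hf z (subset_convexHull ℝ T hz)).trans hu

/-- Turns a shadow vertex into a planar point `y` on the line `val y v = 0`. The strict inequalities
hold only against vertices with a different image; ties within a fibre and points on the outer
boundary are left to a perturbation. -/
lemma exists_supporting_point (hm : 5 ≤ m) (hr : 0 < r) (hR : r < R) {v : S2} {k : ℤ}
    (hq : (Submodule.span ℝ {(v : E3)})ᗮ.starProjection (ringVertex m φ r R k) ∈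
      polyVertices (shadow v (cap m φ r R)))
    (hne : (Submodule.span ℝ {(v : E3)})ᗮ.starProjection (apex r) ≠
      (Submodule.span ℝ {(v : E3)})ᗮ.starProjection (ringVertex m φ r R k)) :
    ∃ y : E2, val y (v : E3) = 0 ∧
      (∀ j, (Submodule.span ℝ {(v : E3)})ᗮ.starProjection (ringVertex m φ r R j) ≠
        (Submodule.span ℝ {(v : E3)})ᗮ.starProjection (ringVertex m φ r R k) →
        inner ℝ y (mid m φ j) < inner ℝ y (mid m φ k)) ∧
      r * apo m < inner ℝ y (mid m φ k) ∧ inner ℝ y (mid m φ k) ≤ R * apo m := by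
  set π := (Submodule.span ℝ {(v : E3)})ᗮ.starProjection with hπ
  set q := π (ringVertex m φ r R k) with hqdef
  have hc := apo_pos hm
  have hs := slope_pos hr hR
  -- The translates of `q` by projected rays are included so that the separating functional is
  -- nonpositive on every recession direction.
  let T : Set E3 := (π '' polyVertices (cap m φ r R) ∪ range fun j => q + π (ray m φ R j)) \ {q}
  have hTfin : T.Finite := (((finite_polyVertices_cap hm hr hR).image π).union
    (finite_range_of_congr hm _ fun k j h => by rw [ray_congr hm h])).subset sdiff_subset
  have hTS : T ⊆ shadow v (cap m φ r R) := by
    rintro z ⟨⟨x, hx, rfl⟩ | ⟨j, rfl⟩, -⟩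
    · exact mem_image_of_mem _ hx.1
    · refine ⟨ringVertex m φ r R k + (1 : ℝ) • ray m φ R j,
        add_ray_mem_cap hm hr hR j zero_le_one (ringVertex_mem_cap hm hr hR k), ?_⟩
      rw [one_smul, map_add]
  obtain ⟨w, hw⟩ := exists_separating_functional ((convex_cap m φ r R).linear_image
    (π : E3 →ₗ[ℝ] E3)) hq hTfin hTS fun h => h.2 rfl
  have hvv : inner ℝ (v : E3) (v : E3) = 1 := by
    rw [real_inner_self_eq_norm_sq, mem_sphere_zero_iff_norm.1 v.2, one_pow]
  -- The component of `w` orthogonal to `v`: it agrees with `w` on the shadow and does not see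
  -- displacements along `v`.
  set u : E3 := w - inner ℝ (v : E3) w • (v : E3) with hu
  have hvu : inner ℝ (v : E3) u = 0 := by
    rw [hu, inner_sub_right, inner_smul_right, hvv]; ring
  have hwu : ∀ z, inner ℝ w (π z) = inner ℝ u z := by
    intro z
    rw [hπ, starProjection_apply, hu, inner_sub_right, inner_sub_left, inner_smul_right,
      real_inner_smul_left, real_inner_comm w]
    ring
  have ha : ∀ x ∈ polyVertices (cap m φ r R), π x ≠ q →
      inner ℝ u x < inner ℝ u (ringVertex m φ r R k) := by
    intro x hx hxq
    rw [← hwu, ← hwu]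
    exact hw _ ⟨Or.inl (mem_image_of_mem _ hx), hxq⟩
  have hb : ∀ j, inner ℝ u (ray m φ R j) ≤ 0 := by
    intro j
    rw [← hwu]
    by_cases h0 : π (ray m φ R j) = 0
    · rw [h0, inner_zero_right]
    · have := hw _ ⟨Or.inr ⟨j, rfl⟩, by simpa using h0⟩
      rw [inner_add_right] at this
      linarith
  have hu0 : u ≠ 0 := by
    intro h0
    have := ha _ (apex_mem_vertices hm hr hR) hne
    rw [h0, inner_zero_left, inner_zero_left] at this
    exact lt_irrefl _ this
  have hneg := two_neg_of_inner_ray hm (hr.trans hR) hu0 hb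
  have hpos : 0 < -(u 2) := by linarith
  set y : E2 := (-(u 2))⁻¹ • hor u with hy
  have hval : ∀ p, inner ℝ u p = -(u 2) * val y p := by
    intro p
    rw [inner_eq_hor, val, hy, real_inner_smul_left, mul_sub, mul_inv_cancel_left₀ hpos.ne']
    ring
  have hlt : ∀ p p', inner ℝ u p < inner ℝ u p' → val y p < val y p' := fun p p' h => by
    rw [hval, hval] at h
    exact lt_of_mul_lt_mul_left h hpos.le
  refine ⟨y, ?_, fun j hj => ?_, ?_, ?_⟩
  · rw [real_inner_comm, hval] at hvu
    exact (mul_eq_zero.1 hvu).resolve_left hpos.ne'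
  · have h1 := hlt _ _ (ha _ (ringVertex_mem_vertices hm hr hR j) hj)
    rw [val_ringVertex, val_ringVertex] at h1
    have h2 := lt_of_mul_lt_mul_left (lt_of_add_lt_add_left h1) hs.le
    have h3 : inner ℝ y (mid m φ j) / apo m < inner ℝ y (mid m φ k) / apo m := by linarith
    exact (div_lt_div_iff_of_pos_right hc).1 h3
  · have h1 := hlt _ _ (ha _ (apex_mem_vertices hm hr hR) hne)
    rw [val_ringVertex, val_apex] at h1
    have h2 := pos_of_mul_pos_right (by linarith : 0 < slope r R *
      (inner ℝ y (mid m φ k) / apo m - r)) hs.le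
    rw [← lt_div_iff₀ hc]
    linarith
  · have h1 := hb k
    rw [hval, val_ray] at h1
    by_contra hcon
    push Not at hcon
    exact absurd h1 (not_le.2 (mul_pos hpos (sub_pos.2 hcon)))

/-- Moving `y` by `ε ^ 2` along the horizontal part of `v` breaks ties inside the fibre in favour of
the maximal index `k`. Contracting by `1 + ε` pulls the point off the outer boundary, as `ε ^ 2` is
negligible against `ε`. -/
lemma eventually_mem_interior_ringCell (hm : 5 ≤ m) (hr : 0 < r) (hR : r < R) {v : S2} {k : ℤ}
    {y : E2} (hv : hor (v : E3) ≠ 0) (hyv : val y (v : E3) = 0)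
    (hlt : ∀ j, (Submodule.span ℝ {(v : E3)})ᗮ.starProjection (ringVertex m φ r R j) ≠
        (Submodule.span ℝ {(v : E3)})ᗮ.starProjection (ringVertex m φ r R k) →
        inner ℝ y (mid m φ j) < inner ℝ y (mid m φ k))
    (hk : ∀ j, (Submodule.span ℝ {(v : E3)})ᗮ.starProjection (ringVertex m φ r R j) =
        (Submodule.span ℝ {(v : E3)})ᗮ.starProjection (ringVertex m φ r R k) →
        inner ℝ (hor (v : E3)) (mid m φ j) ≤ inner ℝ (hor (v : E3)) (mid m φ k))
    (h1 : r * apo m < inner ℝ y (mid m φ k)) (h2 : inner ℝ y (mid m φ k) ≤ R * apo m) :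
    ∀ᶠ ε : ℝ in 𝓝[>] 0, (1 + ε)⁻¹ • (y + ε ^ 2 • hor (v : E3)) ∈
      interior (ringCell m φ r R k) := by
  have hc := apo_pos hm
  have hR0 := hr.trans hR
  have hs := div_pos (slope_pos hr hR) hc
  set a := hor (v : E3) with ha
  have hcont : ContinuousAt (fun ε : ℝ => (1 + ε)⁻¹ • (y + ε ^ 2 • a)) 0 := by
    fun_prop (disch := norm_num)
  have hcontj : ∀ j, ContinuousAt
      (fun ε : ℝ => inner ℝ ((1 + ε)⁻¹ • (y + ε ^ 2 • a)) (mid m φ j)) 0 := fun j =>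
    hcont.inner continuousAt_const
  have hz : (1 + (0 : ℝ))⁻¹ • (y + (0 : ℝ) ^ 2 • a) = y := by simp
  have e1 : ∀ᶠ ε : ℝ in 𝓝[>] 0,
      r * apo m < inner ℝ ((1 + ε)⁻¹ • (y + ε ^ 2 • a)) (mid m φ k) :=
    nhdsWithin_le_nhds (continuousAt_const.eventually_lt (hcontj k) (by rwa [hz]))
  have e2 : ∀ᶠ ε : ℝ in 𝓝[>] 0, ε * inner ℝ a (mid m φ k) < R * apo m := by
    have hcc : ContinuousAt (fun ε : ℝ => ε * inner ℝ a (mid m φ k)) 0 := by fun_prop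
    exact nhdsWithin_le_nhds (hcc.eventually_lt continuousAt_const (by
      rw [zero_mul]; positivity))
  have e3 : ∀ᶠ ε : ℝ in 𝓝[>] 0, ∀ j ∈ Finset.range m, ¬ (m : ℤ) ∣ k - (j : ℤ) →
      inner ℝ ((1 + ε)⁻¹ • (y + ε ^ 2 • a)) (mid m φ j) <
        inner ℝ ((1 + ε)⁻¹ • (y + ε ^ 2 • a)) (mid m φ k) := by
    rw [Filter.eventually_all_finset]
    intro j _
    by_cases hd : (m : ℤ) ∣ k - (j : ℤ)
    · exact Eventually.of_forall fun _ h => absurd hd h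
    by_cases hj : (Submodule.span ℝ {(v : E3)})ᗮ.starProjection (ringVertex m φ r R j) =
        (Submodule.span ℝ {(v : E3)})ᗮ.starProjection (ringVertex m φ r R k)
    · obtain ⟨t, ht⟩ := starProjection_eq_iff.1 hj.symm
      have hx : ringVertex m φ r R k = ringVertex m φ r R j + t • (v : E3) := by
        rw [← ht]; abel
      have ht0 : t ≠ 0 := by
        rintro rfl
        rw [zero_smul, add_zero] at hx
        exact hd (ringVertex_inj hm hr hR hx)
      have hval : val y (ringVertex m φ r R k) = val y (ringVertex m φ r R j) := by
        rw [hx, val_add, val_smul, hyv, mul_zero, add_zero]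
      rw [val_ringVertex, val_ringVertex] at hval
      have heq : inner ℝ y (mid m φ k) = inner ℝ y (mid m φ j) := by
        have h3 := mul_left_cancel₀ (slope_pos hr hR).ne' (add_left_cancel hval)
        exact (div_left_inj' hc.ne').1 (sub_left_inj.1 h3)
      -- Two ring vertices of one fibre differ by a multiple of `v`, so the difference of their
      -- midpoint directions is parallel to `a`. Their products with `a` therefore differ, and the
      -- maximum at `k` is strict.
      have hhor := congrArg hor ht
      rw [hor_sub, hor_smul, ringVertex, ringVertex, hor_vec, hor_vec, ← ha] at hhor
      have hin := congrArg (fun z : E2 => inner ℝ a z) hhor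
      simp only [inner_sub_right, inner_smul_right] at hin
      have hne : inner ℝ a (mid m φ j) ≠ inner ℝ a (mid m φ k) := by
        intro h
        rw [h, sub_self, eq_comm] at hin
        exact mul_ne_zero ht0 (inner_self_ne_zero.2 hv) hin
      have hlt' := lt_of_le_of_ne (hk j hj) hne
      filter_upwards [self_mem_nhdsWithin] with ε hε _
      have hε' : 0 < ε := hε
      rw [real_inner_smul_left, real_inner_smul_left, inner_add_left, inner_add_left,
        real_inner_smul_left, real_inner_smul_left, heq]
      gcongr
    · filter_upwards [nhdsWithin_le_nhds ((hcontj j).eventually_lt (hcontj k)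
        (by rw [hz]; exact hlt j hj))] with ε hε _ using hε
  filter_upwards [e1, e2, e3, self_mem_nhdsWithin] with ε h3 h4 h5 hε
  have hε' : 0 < ε := hε
  refine mem_interior_ringCell hm h5 h3 ?_
  rw [real_inner_smul_left, inner_add_left, real_inner_smul_left, inv_mul_lt_iff₀ (by positivity)]
  nlinarith

lemma finrank_orthogonal_E2 {a : E2} (ha : a ≠ 0) :
    Module.finrank ℝ (Submodule.span ℝ {a})ᗮ = 1 := by
  have h3 := Submodule.finrank_add_finrank_orthogonal (Submodule.span ℝ {a})
  rw [finrank_euclideanSpace_fin, finrank_span_singleton ha] at h3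
  omega

/-- The image of the apex accounts for at most one shadow vertex. The others inject into the ring
regions met by one line, of which thinness allows four. -/
lemma shadowNumberAt_cap_le (hm : 5 ≤ m) (hr : 0 < r) (hR : r < R) (hthin : IsThinRing m φ r R)
    (v : S2) : shadowNumberAt v (cap m φ r R) ≤ 5 := by
  obtain ⟨s, -, hs⟩ := isPolyhedron_cap hm φ r R
  set π := (Submodule.span ℝ {(v : E3)})ᗮ.starProjection with hπ
  have hover : ∀ q ∈ polyVertices (shadow v (cap m φ r R)), q ≠ π (apex r) →
      ∃ k, π (ringVertex m φ r R k) = q ∧ ∀ j, π (ringVertex m φ r R j) = q →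
        inner ℝ (hor (v : E3)) (mid m φ j) ≤ inner ℝ (hor (v : E3)) (mid m φ k) := by
    intro q hq hqa
    obtain ⟨x, hx, hxq⟩ := exists_vertex_over hs ⟨_, apex_mem_vertices hm hr hR⟩ hq
    rw [polyVertices_cap hm hr hR] at hx
    rcases hx with rfl | ⟨k₀, rfl⟩
    · exact absurd hxq.symm hqa
    classical
    have hm0 : 0 < m := by omega
    have hne : ((Finset.range m).filter fun j : ℕ => π (ringVertex m φ r R j) = q).Nonempty := by
      obtain ⟨j, hj, hd⟩ := exists_range_dvd_sub hm0 k₀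
      exact ⟨j, Finset.mem_filter.2 ⟨hj, by rw [← ringVertex_congr hm hd]; exact hxq⟩⟩
    obtain ⟨k, hk, hmax⟩ := Finset.exists_max_image _
      (fun j : ℕ => inner ℝ (hor (v : E3)) (mid m φ j)) hne
    refine ⟨k, (Finset.mem_filter.1 hk).2, fun j hj => ?_⟩
    obtain ⟨i, hi, hd⟩ := exists_range_dvd_sub hm0 j
    rw [mid_congr hm0 φ hd]
    exact hmax i (Finset.mem_filter.2 ⟨hi, by rw [← ringVertex_congr hm hd]; exact hj⟩)
  set Q := {q | q ∈ polyVertices (shadow v (cap m φ r R)) ∧ q ≠ π (apex r)} with hQ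
  have hsub : polyVertices (shadow v (cap m φ r R)) ⊆ insert (π (apex r)) Q := by
    intro q hq
    by_cases h : q = π (apex r)
    · exact Or.inl h
    · exact Or.inr ⟨hq, h⟩
  suffices h4 : Q.encard ≤ 4 by
    calc _ ≤ (insert (π (apex r)) Q).encard := Set.encard_le_encard hsub
      _ ≤ Q.encard + 1 := Set.encard_insert_le _ _
      _ ≤ 4 + 1 := by gcongr
      _ = 5 := by norm_num
  rcases Q.eq_empty_or_nonempty with hQe | ⟨q₀, hq₀⟩
  · rw [hQe, Set.encard_empty]; exact zero_le
  have hQfin : Q.Finite := by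
    apply ((finite_polyVertices_cap (φ := φ) hm hr hR).image π).subset
    intro q hq
    obtain ⟨k, hk, -⟩ := hover q hq.1 hq.2
    exact ⟨_, ringVertex_mem_vertices hm hr hR k, hk⟩
  have hex : ∀ q ∈ Q, ∃ (k : ℤ) (y : E2), π (ringVertex m φ r R k) = q ∧ val y (v : E3) = 0 ∧
      (hor (v : E3) ≠ 0 → ∀ᶠ ε : ℝ in 𝓝[>] 0, (1 + ε)⁻¹ • (y + ε ^ 2 • hor (v : E3)) ∈
        interior (ringCell m φ r R k)) := by
    intro q hq
    obtain ⟨k, hk, hmax⟩ := hover q hq.1 hq.2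
    obtain ⟨y, hy1, hy2, hy3, hy4⟩ := exists_supporting_point hm hr hR (v := v) (k := k)
      (by rw [← hπ, hk]; exact hq.1) (by rw [← hπ, hk]; exact hq.2.symm)
    refine ⟨k, y, hk, hy1, fun hv => ?_⟩
    refine eventually_mem_interior_ringCell hm hr hR hv hy1 hy2 (fun j hj => hmax j ?_) hy3 hy4
    rw [hj, ← hπ, hk]
  -- If `v` were vertical, `val y v = 0` would force `v = 0`; so in that direction only the apex can
  -- give a shadow vertex.
  have hv : hor (v : E3) ≠ 0 := by
    intro h0
    obtain ⟨k, y, -, hy, -⟩ := hex q₀ hq₀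
    rw [val, h0, inner_zero_right, zero_sub, neg_eq_zero] at hy
    refine ne_zero_of_mem_unit_sphere v ?_
    rw [← vec_hor (v : E3), h0, hy]
    ext i; fin_cases i <;> rfl
  choose! k y hk hy hev using hex
  set a := hor (v : E3) with ha
  -- One `ε` serves all the finitely many shadow vertices, so the perturbation carries the original
  -- line to a single parallel line `L`.
  obtain ⟨ε, hε⟩ : ∃ ε : ℝ, ∀ q ∈ Q, (1 + ε)⁻¹ • (y q + ε ^ 2 • a) ∈
      interior (ringCell m φ r R (k q)) :=
    ((hQfin.eventually_all).2 fun q hq => hev q hq hv).exists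
  have haa : inner ℝ a a ≠ 0 := inner_self_ne_zero.2 hv
  set d := (1 + ε)⁻¹ * ((v : E3) 2 + ε ^ 2 * inner ℝ a a) with hd
  let L : AffineSubspace ℝ E2 := AffineSubspace.mk' ((d / inner ℝ a a) • a) (Submodule.span ℝ {a})ᗮ
  have hL : ∀ q ∈ Q, (1 + ε)⁻¹ • (y q + ε ^ 2 • a) ∈ L := by
    intro q hq
    have h1 := hy q hq
    rw [val, ← ha, real_inner_comm, sub_eq_zero] at h1
    rw [AffineSubspace.mem_mk', Submodule.mem_orthogonal_singleton_iff_inner_right, vsub_eq_sub,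
      inner_sub_right, inner_smul_right, inner_smul_right, inner_add_right, inner_smul_right,
      div_mul_cancel₀ _ haa, h1, hd, sub_self]
  have hcount := hthin L (by
    rw [AffineSubspace.direction_mk']
    exact finrank_orthogonal_E2 hv)
  refine le_trans ?_ hcount
  refine Set.encard_le_encard_of_injOn (f := fun q => interior (ringCell m φ r R (k q))) ?_ ?_
  · intro q hq
    refine ⟨?_, _, hL q hq, hε q hq⟩
    rw [ringRegions_eq hm hr hR]
    exact ⟨k q, rfl⟩
  · intro q hq q' hq' h
    have h1 := congrArg closure h
    simp only [closure_interior_ringCell hm hr hR] at h1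
    rw [← hk q hq, ← hk q' hq', ringVertex_congr hm (ringCell_inj hm hr hR h1)]

/-! ### A direction whose shadow has at least five vertices -/

lemma inner_dir_zero (m : ℕ) (φ : ℝ) (k : ℤ) :
    inner ℝ (dir m φ k) (dir m φ 0) = Real.cos (2 * Real.pi / m * k) := by
  rw [inner_dir_dir]
  push_cast
  congr 1
  ring

/-- The line where the product with `dir 0` equals `δ` passes through the inner region at `δ • dir
0` and crosses the spokes `1` and `-1` at radius `δ / C`, strictly inside the ring. It therefore
meets the open cells on both sides of each spoke: `0`, `1`, `-1` and `-2`. -/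
lemma five_le_shadowNumber_cap (hm : 5 ≤ m) (hr : 0 < r) (hR : r < R) :
    5 ≤ shadowNumber (cap m φ r R) := by
  have hR0 := hr.trans hR
  set τ := 2 * Real.pi / m with hτ
  have hτ' : τ = 2 * (Real.pi / m) := by rw [hτ]; ring
  have hpi := Real.pi_pos
  have hτ0 : 0 < τ := by rw [hτ']; linarith [pi_div_pos hm]
  have hτ5 : τ ≤ 2 * Real.pi / 5 := by rw [hτ']; linarith [pi_div_lt hm]
  set C := Real.cos τ with hC
  set C₂ := Real.cos (2 * τ) with hC₂
  have hC0 : 0 < C := Real.cos_pos_of_mem_Ioo ⟨by linarith, by linarith⟩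
  have hC1 : C < 1 := by
    rw [hC, ← Real.cos_zero]
    exact Real.cos_lt_cos_of_nonneg_of_le_pi le_rfl (by linarith) hτ0
  have hC2 : C₂ < C := Real.cos_lt_cos_of_nonneg_of_le_pi hτ0.le (by linarith) (by linarith)
  -- The bounds say `δ < r` and `r < δ / C < R`; they are compatible because `0 < C < 1`.
  obtain ⟨δ, hδ1, hδ2⟩ : ∃ δ, r * C < δ ∧ δ < min (R * C) r := exists_between (by
    rw [lt_min_iff]
    exact ⟨by gcongr, by nlinarith⟩)
  have hδR := hδ2.trans_le (min_le_left _ _)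
  have hδr := hδ2.trans_le (min_le_right _ _)
  have hδ0 : 0 < δ := lt_trans (by positivity) hδ1
  -- Here `ε` is the coefficient of the far corner direction in each cell; the other coefficient is
  -- then fixed by the line, and all conditions hold in the limit `ε = 0`.
  obtain ⟨ε, ⟨h1, h2, h3, h4⟩, hε⟩ : ∃ ε : ℝ, (r < ε + (δ - ε) / C ∧ (δ - ε * C₂) / C + ε < R ∧
      0 < δ - ε ∧ 0 < δ - ε * C₂) ∧ 0 < ε := by
    have c1 : ContinuousAt (fun ε : ℝ => ε + (δ - ε) / C) 0 := by fun_prop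
    have c2 : ContinuousAt (fun ε : ℝ => (δ - ε * C₂) / C + ε) 0 := by fun_prop
    have c3 : ContinuousAt (fun ε : ℝ => δ - ε) 0 := by fun_prop
    have c4 : ContinuousAt (fun ε : ℝ => δ - ε * C₂) 0 := by fun_prop
    have e1 := (continuousAt_const (y := r)).eventually_lt c1 (by
      simp only [sub_zero, zero_add]; rwa [lt_div_iff₀ hC0])
    have e2 := c2.eventually_lt (continuousAt_const (y := R)) (by
      simp only [zero_mul, sub_zero, add_zero]; rwa [div_lt_iff₀ hC0])
    have e3 := (continuousAt_const (y := (0 : ℝ))).eventually_lt c3 (by simpa using hδ0)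
    have e4 := (continuousAt_const (y := (0 : ℝ))).eventually_lt c4 (by simpa using hδ0)
    have := e1.and (e2.and (e3.and e4))
    exact ((this.filter_mono (nhdsWithin_le_nhds (s := Ioi 0))).and self_mem_nhdsWithin).exists
  have hup : ε + (δ - ε) / C < R := by
    have e : ε + (δ - ε) / C = δ / C - ε * (1 / C - 1) := by field_simp; ring
    have h5 : δ / C < R := by rwa [div_lt_iff₀ hC0]
    have h6 : 1 < 1 / C := by rwa [lt_div_iff₀ hC0, one_mul]
    rw [e]; nlinarith
  have hlow : r < (δ - ε * C₂) / C + ε := by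
    have e : (δ - ε * C₂) / C + ε = δ / C + ε * (1 - C₂ / C) := by field_simp; ring
    have h5 : r < δ / C := by rwa [lt_div_iff₀ hC0]
    have h6 : C₂ / C < 1 := by rwa [div_lt_iff₀ hC0, one_mul]
    rw [e]; nlinarith
  have ha : 0 < (δ - ε) / C := div_pos h3 hC0
  have hb : 0 < (δ - ε * C₂) / C := div_pos h4 hC0
  have i0 : inner ℝ (dir m φ 0) (dir m φ 0) = 1 := by rw [inner_dir_zero]; simp
  have i1 : inner ℝ (dir m φ 1) (dir m φ 0) = C := by rw [inner_dir_zero]; simp [hC, hτ]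
  have i1' : inner ℝ (dir m φ (-1)) (dir m φ 0) = C := by
    rw [inner_dir_zero, hC, ← Real.cos_neg]; simp [hτ]
  have i2 : inner ℝ (dir m φ 2) (dir m φ 0) = C₂ := by
    rw [inner_dir_zero, hC₂, mul_comm]; simp [hτ]
  have i2' : inner ℝ (dir m φ (-2)) (dir m φ 0) = C₂ := by
    rw [inner_dir_zero, hC₂, ← Real.cos_neg, mul_comm]; simp [hτ]
  have hw0 : vec (dir m φ 0) δ ≠ 0 := fun h => hδ0.ne' (congrArg (fun p : E3 => p 2) h)
  let v : S2 := ⟨‖vec (dir m φ 0) δ‖⁻¹ • vec (dir m φ 0) δ, by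
    rw [mem_sphere_zero_iff_norm, norm_smul, norm_inv, norm_norm,
      inv_mul_cancel₀ (norm_ne_zero_iff.2 hw0)]⟩
  have hv : ∀ y : E2, inner ℝ y (dir m φ 0) = δ → inner ℝ (v : E3) (vec y (-1)) = 0 := by
    intro y hy
    change inner ℝ (‖vec (dir m φ 0) δ‖⁻¹ • vec (dir m φ 0) δ) (vec y (-1)) = 0
    rw [real_inner_smul_left, inner_vec_left, hor_vec, vec_two, real_inner_comm, hy]
    ring
  have hring : ∀ (k : ℤ) (α β : ℝ), 0 < α → 0 < β → r < α + β → α + β < R →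
      inner ℝ (α • dir m φ k + β • dir m φ (k + 1)) (dir m φ 0) = δ →
      ∃ u : E3, inner ℝ (v : E3) u = 0 ∧ ∀ p ∈ cap m φ r R, p ≠ ringVertex m φ r R k →
        inner ℝ u p < inner ℝ u (ringVertex m φ r R k) := by
    intro k α β hα hβ hlo hhi hin
    refine ⟨_, hv _ hin, fun p hp hne => ?_⟩
    rw [inner_vec_neg_one, inner_vec_neg_one]
    exact val_lt_ringVertex hm hr hR hα hβ hlo hhi hp hne
  have hne : ∀ k j : ℤ, k - j ≠ 0 → |k - j| < 5 → ringVertex m φ r R k ≠ ringVertex m φ r R j :=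
    fun k j h0 h5 h => not_dvd_of_lt h0 (by have : (5 : ℤ) ≤ m := by exact_mod_cast hm
                                            linarith) (ringVertex_inj hm hr hR h)
  let U : Set E3 := {apex r, ringVertex m φ r R 0, ringVertex m φ r R 1, ringVertex m φ r R (-1),
    ringVertex m φ r R (-2)}
  have hUcard : U.encard = 5 := by
    have hap := fun k => apex_ne_ringVertex (m := m) (φ := φ) hr hR k
    have d1 := hne 0 1 (by norm_num) (by norm_num)
    have d2 := hne 0 (-1) (by norm_num) (by norm_num)
    have d3 := hne 0 (-2) (by norm_num) (by norm_num)
    have d4 := hne 1 (-1) (by norm_num) (by norm_num)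
    have d5 := hne 1 (-2) (by norm_num) (by norm_num)
    have d6 := hne (-1) (-2) (by norm_num) (by norm_num)
    rw [Set.encard_insert_of_notMem (by simp [hap]),
      Set.encard_insert_of_notMem (by simp [d1, d2, d3]),
      Set.encard_insert_of_notMem (by simp [d4, d5]), Set.encard_pair d6]
    norm_num
  rw [← hUcard]
  refine le_trans ?_ (le_iSup (fun v => shadowNumberAt v (cap m φ r R)) v)
  apply encard_le_shadowNumberAt
  · rintro _ (rfl | rfl | rfl | rfl | rfl)
    · exact apex_mem_cap hr hR
    all_goals exact ringVertex_mem_cap hm hr hR _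
  · rintro _ (rfl | rfl | rfl | rfl | rfl)
    · refine ⟨vec (δ • dir m φ 0 + (0 : ℝ) • dir m φ (0 + 1)) (-1), hv _ ?_, fun p hp hne => ?_⟩
      · simp [real_inner_smul_left, norm_dir]
      · rw [inner_vec_neg_one, inner_vec_neg_one]
        exact val_lt_apex hm hδ0.le le_rfl (by simpa using hδr) hp hne
    · refine hring 0 ε ((δ - ε) / C) hε ha h1 hup ?_
      rw [inner_add_left, real_inner_smul_left, real_inner_smul_left, zero_add, i0, i1]
      field_simp; ring
    · refine hring 1 ((δ - ε * C₂) / C) ε hb hε hlow h2 ?_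
      rw [inner_add_left, real_inner_smul_left, real_inner_smul_left, one_add_one_eq_two, i1, i2]
      field_simp; ring
    · refine hring (-1) ((δ - ε) / C) ε ha hε (by linarith) (by linarith) ?_
      rw [inner_add_left, real_inner_smul_left, real_inner_smul_left, neg_add_cancel, i0, i1']
      field_simp; ring
    · refine hring (-2) ε ((δ - ε * C₂) / C) hε hb (by linarith) (by linarith) ?_
      rw [inner_add_left, real_inner_smul_left, real_inner_smul_left,
        show (-2 : ℤ) + 1 = -1 by norm_num, i1', i2']
      field_simp; ring

lemma shadowNumber_cap (hm : 5 ≤ m) (hr : 0 < r) (hR : r < R) (hthin : IsThinRing m φ r R) :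
    shadowNumber (cap m φ r R) = 5 :=
  le_antisymm (iSup_le fun v => shadowNumberAt_cap_le hm hr hR hthin v)
    (five_le_shadowNumber_cap hm hr hR)

end Cap

/-! ### Polyhedra with few vertices -/

lemma extremePoints_eq_empty_of_translate {A : Set E3} {w : E3} (hw : w ≠ 0)
    (h : ∀ x ∈ A, x + w ∈ A ∧ x - w ∈ A) : A.extremePoints ℝ = ∅ := by
  rw [eq_empty_iff_forall_notMem]
  rintro x ⟨hx, hext⟩
  have := hext (h x hx).1 (h x hx).2 ⟨1 / 2, 1 / 2, by norm_num, by norm_num, by norm_num,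
    by module⟩
  exact hw (by simpa using this)

lemma shadowNumberAt_univ (v : S2) : shadowNumberAt v univ = 0 := by
  obtain ⟨w, hw⟩ := exists_unit_orthogonal (v : E3)
  rw [shadowNumberAt, Set.encard_eq_zero]
  refine extremePoints_eq_empty_of_translate (ne_zero_of_mem_unit_sphere w) ?_
  have hπ : (Submodule.span ℝ {(v : E3)})ᗮ.starProjection (w : E3) = w := by
    rw [starProjection_apply, real_inner_comm, hw]; simp
  rintro _ ⟨x, -, rfl⟩
  exact ⟨⟨x + w, mem_univ _, by rw [map_add, hπ]⟩, ⟨x - w, mem_univ _, by rw [map_sub, hπ]⟩⟩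

lemma univ_mem_polyhedraWithVertices : (univ : Set E3) ∈ polyhedraWithVertices 0 := by
  refine ⟨⟨∅, by simp, by ext; simp⟩, by simp, ?_⟩
  obtain ⟨w, -⟩ := exists_unit_orthogonal 0
  rw [Nat.cast_zero, Set.encard_eq_zero]
  exact extremePoints_eq_empty_of_translate (ne_zero_of_mem_unit_sphere w) fun x _ =>
    ⟨mem_univ _, mem_univ _⟩

/-! ### Explicit polyhedra with a prescribed number of vertices -/

/-- The half-spaces that cut out `wedge n`. -/
def wedgeHalfSpaces (n : ℕ) : Set (E3 × ℝ) :=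
  insert (!₂[0, 0, -1], 0)
    ((fun i : ℕ => (!₂[(i : ℝ), -1, 0], (i : ℝ) * (i + 1) / 2)) '' Iic n)

lemma finite_wedgeHalfSpaces (n : ℕ) : (wedgeHalfSpaces n).Finite :=
  ((finite_Iic n).image _).insert _

/-- The product of a half-line and the unbounded convex polygon bounded by `n + 1` tangents to a
parabola. -/
def wedge (n : ℕ) : Set E3 :=
  {x | ∀ h ∈ (finite_wedgeHalfSpaces n).toFinset, inner ℝ h.1 x ≤ h.2}

lemma inner_vec3 (a b c : ℝ) (p : E3) :
    inner ℝ (!₂[a, b, c] : E3) p = a * p 0 + b * p 1 + c * p 2 := by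
  rw [inner_E3]; rfl

lemma mem_wedge {n : ℕ} {p : E3} :
    p ∈ wedge n ↔ 0 ≤ p 2 ∧ ∀ i : ℕ, i ≤ n → (i : ℝ) * p 0 - p 1 ≤ i * (i + 1) / 2 := by
  unfold wedge
  simp only [mem_ofPred_eq, Finite.mem_toFinset, wedgeHalfSpaces, forall_mem_insert,
    forall_mem_image,
    inner_vec3, mem_Iic]
  constructor
  · rintro ⟨h1, h2⟩
    exact ⟨by linarith, fun i hi => by linarith [h2 hi]⟩
  · rintro ⟨h1, h2⟩
    exact ⟨by linarith, fun i hi => by linarith [h2 i hi]⟩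

lemma isPolyhedron_wedge (n : ℕ) : IsPolyhedron (wedge n) := by
  refine ⟨(finite_wedgeHalfSpaces n).toFinset, fun h hh => ?_, rfl⟩
  rw [Finite.mem_toFinset] at hh
  rcases hh with rfl | ⟨i, -, rfl⟩
  · intro h0
    have := congrArg (fun p : E3 => p 2) h0
    simp at this
  · intro h0
    have := congrArg (fun p : E3 => p 1) h0
    simp at this

lemma mem_interior_of_strict {s : Finset (E3 × ℝ)} {x : E3} (h : ∀ a ∈ s, inner ℝ a.1 x < a.2) :
    x ∈ interior {x | ∀ a ∈ s, inner ℝ a.1 x ≤ a.2} := by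
  rw [mem_interior_iff_mem_nhds]
  have : ∀ᶠ z in 𝓝 x, ∀ a ∈ s, inner ℝ a.1 z ≤ a.2 := by
    rw [Filter.eventually_all_finset]
    intro a ha
    have hc : ContinuousAt (fun z : E3 => inner ℝ a.1 z) x := by fun_prop
    filter_upwards [hc.eventually_lt continuousAt_const (h a ha)] with z hz using hz.le
  exact this

lemma interior_wedge_nonempty (n : ℕ) : (interior (wedge n)).Nonempty := by
  refine ⟨!₂[0, 1, 1], mem_interior_of_strict fun h hh => ?_⟩
  rw [Finite.mem_toFinset] at hh
  rcases hh with rfl | ⟨i, -, rfl⟩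
  · simp [inner_vec3]
  · simp only [inner_vec3]
    have : (0 : ℝ) ≤ (i : ℝ) * (i + 1) / 2 := by positivity
    simp
    linarith

/-- The constants `i * (i + 1) / 2` make the lines `j - 1` and `j` meet at abscissa `j`. With `n +
1` lines, exactly `n` consecutive pairs produce vertices. -/
lemma polyVertices_wedge (n : ℕ) : polyVertices (wedge n) =
    (fun j : ℕ => (!₂[(j : ℝ), (j : ℝ) * (j - 1) / 2, 0] : E3)) '' (Finset.Icc 1 n : Set ℕ) := by
  have hdef : wedge n = {x | ∀ h ∈ (finite_wedgeHalfSpaces n).toFinset, inner ℝ h.1 x ≤ h.2} := rfl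
  have hactive : ∀ (p d : E3), (∀ h ∈ (finite_wedgeHalfSpaces n).toFinset,
      inner ℝ h.1 p = h.2 → inner ℝ h.1 d = 0) ↔ (p 2 = 0 → d 2 = 0) ∧
      ∀ i : ℕ, i ≤ n → (i : ℝ) * p 0 - p 1 = i * (i + 1) / 2 → (i : ℝ) * d 0 - d 1 = 0 := by
    intro p d
    simp only [Finite.mem_toFinset, wedgeHalfSpaces, forall_mem_insert,
    forall_mem_image,
      inner_vec3, mem_Iic]
    refine and_congr (by simp) (forall₂_congr fun i _ => ?_)
    simp only [neg_mul, one_mul, zero_mul, add_zero, sub_eq_add_neg]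
  apply subset_antisymm
  · intro p hp
    obtain ⟨h0, hP⟩ := mem_wedge.1 hp.1
    have hker : ∀ d : E3, ((p 2 = 0 → d 2 = 0) ∧
      ∀ i : ℕ, i ≤ n → (i : ℝ) * p 0 - p 1 = i * (i + 1) / 2 → (i : ℝ) * d 0 - d 1 = 0) → d = 0 :=
      fun d hd => eq_zero_of_active hdef hp ((hactive p d).2 hd)
    have hp2 : p 2 = 0 := by
      by_contra hne
      have := hker !₂[0, 0, 1] ⟨fun h => absurd h hne, fun i _ _ => by simp⟩
      have := congrArg (fun p : E3 => p 2) this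
      simp at this
    have htwo : ∃ i j : ℕ, i < j ∧ j ≤ n ∧ (i : ℝ) * p 0 - p 1 = i * (i + 1) / 2 ∧
        (j : ℝ) * p 0 - p 1 = j * (j + 1) / 2 := by
      by_contra hcon
      push Not at hcon
      obtain ⟨i₀, hi₀⟩ : ∃ i₀ : ℕ, ∀ j : ℕ, j ≤ n → (j : ℝ) * p 0 - p 1 = j * (j + 1) / 2 →
          j = i₀ := by
        by_cases hex : ∃ i : ℕ, i ≤ n ∧ (i : ℝ) * p 0 - p 1 = i * (i + 1) / 2
        · obtain ⟨i, hi, hi'⟩ := hex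
          refine ⟨i, fun j hj hj' => ?_⟩
          rcases lt_trichotomy i j with h | h | h
          · exact absurd hj' (hcon i j h hj hi')
          · exact h.symm
          · exact absurd hi' (hcon j i h hi hj')
        · push Not at hex
          exact ⟨0, fun j hj hj' => absurd hj' (hex j hj)⟩
      -- With at most one planar constraint active, the direction of its line would be tangent to
      -- everything active. If none is active, the default index `0` serves.
      have := hker !₂[1, (i₀ : ℝ), 0] ⟨fun _ => by simp, fun i hi hi' => by
        rw [hi₀ i hi hi']; simp⟩
      have := congrArg (fun p : E3 => p 0) this
      simp at this
    obtain ⟨i, j, hij, hjn, hi, hj⟩ := htwo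
    have hij' : (i : ℝ) < j := by exact_mod_cast hij
    have hp0 : p 0 = (i + j + 1) / 2 := by
      have : ((j : ℝ) - i) * (p 0 - (i + j + 1) / 2) = 0 := by linarith
      have := (mul_eq_zero.1 this).resolve_left (by linarith)
      linarith
    -- The line following `i` forces `p 0 ≤ i + 1`, so lines `i` and `j` can meet on the boundary
    -- only when `j = i + 1`.
    have h1 := hP (i + 1) (by omega)
    push_cast at h1
    have hji : (j : ℝ) ≤ i + 1 := by nlinarith
    have hji' : j = i + 1 := by
      have : j ≤ i + 1 := by exact_mod_cast hji
      omega
    have hjr : (i : ℝ) = j - 1 := by rw [hji']; push_cast; ring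
    refine ⟨j, by simp; omega, ?_⟩
    rw [hjr] at hp0
    have hp1 : p 1 = (j : ℝ) * (j - 1) / 2 := by
      rw [hp0] at hj
      linarith
    ext a
    fin_cases a
    · simp [hp0]; ring
    · simp [hp1]
    · simp [hp2]
  · rintro _ ⟨j, hj, rfl⟩
    simp only [Finset.coe_Icc, mem_Icc] at hj
    refine mem_vertices_of_active hdef (mem_wedge.2 ⟨by simp, fun i hi => ?_⟩) fun d hd => ?_
    · simp only [Matrix.cons_val]
      -- Up to the factor `2`, this is the slack of line `i` at vertex `j`; a product of consecutive
      -- integers is nonnegative.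
      have hz : 0 ≤ ((j : ℤ) - i) * (j - i - 1) := by
        rcases le_or_gt (j : ℤ) i with h | h
        · nlinarith
        · exact mul_nonneg (by omega) (by omega)
      have hz' : (0 : ℝ) ≤ ((j : ℝ) - i) * (j - i - 1) := by exact_mod_cast hz
      nlinarith
    · rw [hactive] at hd
      simp only [Matrix.cons_val, true_implies] at hd
      obtain ⟨hd2, hd⟩ := hd
      have e1 := hd j hj.2 (by ring)
      have e2 := hd (j - 1) (by omega) (by rw [Nat.cast_sub hj.1]; push_cast; ring)
      rw [Nat.cast_sub hj.1] at e2
      push_cast at e2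
      have d0 : d 0 = 0 := by linarith
      have d1 : d 1 = 0 := by rw [d0] at e1; linarith
      ext a
      fin_cases a
      · exact d0
      · exact d1
      · exact hd2

lemma encard_polyVertices_wedge (n : ℕ) : (polyVertices (wedge n)).encard = n := by
  rw [polyVertices_wedge, Set.InjOn.encard_image, Set.encard_coe_eq_coe_finsetCard, Nat.card_Icc,
    Nat.add_sub_cancel]
  intro i _ j _ h
  have := congrArg (fun p : E3 => p 0) h
  simpa using this

/-! ### Bounds for the unbounded shadow number -/

lemma wedge_mem (n : ℕ) : wedge n ∈ polyhedraWithVertices n :=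
  ⟨isPolyhedron_wedge n, interior_wedge_nonempty n, encard_polyVertices_wedge n⟩

lemma cap_mem {m : ℕ} {φ r R : ℝ} (hm : 5 ≤ m) (hr : 0 < r) (hR : r < R) :
    cap m φ r R ∈ polyhedraWithVertices (m + 1) :=
  ⟨isPolyhedron_cap hm φ r R, interior_cap_nonempty m φ r R, encard_polyVertices_cap hm hr hR⟩

/-- The whole space serves `n = 0`, where no vertex is available to lift shadow vertices. A wedge
serves `1 ≤ n ≤ 5` by counting vertices, and the tangent polyhedron over a thin ring of `n - 1`
cells serves the rest. -/
lemma unboundedShadowNumber_le_five (n : ℕ) : unboundedShadowNumber n ≤ 5 := by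
  have key : ∀ P ∈ polyhedraWithVertices n, shadowNumber P ≤ 5 → unboundedShadowNumber n ≤ 5 :=
    fun P hP h => (iInf₂_le P hP).trans h
  rcases Nat.eq_zero_or_pos n with rfl | hn
  · refine key _ univ_mem_polyhedraWithVertices (iSup_le fun v => ?_)
    rw [shadowNumberAt_univ]
    exact zero_le
  rcases le_or_gt n 5 with hn5 | hn5
  · refine key _ (wedge_mem n) (iSup_le fun v => ?_)
    have hcard := encard_polyVertices_wedge n
    have hne : (polyVertices (wedge n)).Nonempty := by
      rw [← Set.encard_ne_zero, hcard]
      exact_mod_cast hn.ne'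
    refine (shadowNumberAt_le (P := wedge n) (s := (finite_wedgeHalfSpaces n).toFinset) rfl hne
      v).trans ?_
    rw [hcard]
    exact_mod_cast hn5
  · obtain ⟨m, rfl⟩ : ∃ m, n = m + 1 := ⟨n - 1, by omega⟩
    have hm : 5 ≤ m := by omega
    obtain ⟨r, ⟨h1, h2⟩, h3⟩ := (((eventually_isThinRing (φ := 0) hm one_pos).and
      ((lt_mem_nhds (zero_lt_one' ℝ)).filter_mono nhdsWithin_le_nhds)).and
      self_mem_nhdsWithin).exists
    exact key _ (cap_mem (φ := 0) hm h2 h3) (shadowNumber_cap hm h2 h3 h1).le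

lemma one_le_unboundedShadowNumber {n : ℕ} (hn : n ≠ 0) : 1 ≤ unboundedShadowNumber n := by
  refine le_iInf₂ fun P hP => ?_
  obtain ⟨⟨s, -, hs⟩, -, hcard⟩ := hP
  refine one_le_shadowNumber hs ?_
  rw [← Set.encard_ne_zero, hcard]
  exact_mod_cast hn

lemma unboundedShadowNumber_isTheta :
    (fun n : ℕ => ((unboundedShadowNumber n).toNat : ℝ)) =Θ[atTop] (fun _ => (1 : ℝ)) := by
  have hle : ∀ n, (unboundedShadowNumber n).toNat ≤ 5 := fun n =>
    ENat.toNat_le_of_le_natCast (unboundedShadowNumber_le_five n)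
  have hge : ∀ n ≠ 0, 1 ≤ (unboundedShadowNumber n).toNat := fun n hn => by
    -- `ENat.toNat` sends `⊤` to `0`, so finiteness is needed before the lower bound can be
    -- transferred.
    have htop : unboundedShadowNumber n ≠ ⊤ := fun h => by
      have := unboundedShadowNumber_le_five n
      rw [h] at this
      exact absurd this (by decide)
    have := one_le_unboundedShadowNumber hn
    rw [← ENat.natCast_toNat htop] at this
    exact_mod_cast this
  constructor
  · refine IsBigO.of_bound 5 (Eventually.of_forall fun n => ?_)
    simp only [Real.norm_natCast, norm_one, mul_one]
    exact_mod_cast hle n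
  · refine IsBigO.of_bound 1 ?_
    filter_upwards [eventually_ne_atTop 0] with n hn
    simp only [Real.norm_natCast, norm_one, one_mul]
    exact_mod_cast hge n hn

end ShadowProblem

end

open ShadowProblem
theorem theorem1p2 :
    ((fun n : ℕ => ((unboundedShadowNumber n).toNat : ℝ)) =Θ[atTop] (fun _ => (1 : ℝ))) ∧
    (∀ n : ℕ, unboundedShadowNumber n ≤ 5) ∧
    (∀ n : ℕ, 6 ≤ n → ∀ R : ℝ, 0 < R → ∀ φ : ℝ,
      (∀ᶠ r in 𝓝[<] R, IsThinRing (n - 1) φ r R) ∧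
      (∀ r : ℝ, 0 < r → r < R → IsThinRing (n - 1) φ r R →
        ∀ (D : Set (Set S2)) (P : Set E3),
          D = ringSubdivision n φ r R → P = tangentPolyhedron D →
            P ∈ polyhedraWithVertices n ∧
            ¬ Bornology.IsBounded P ∧
            sphericalImageSubdivision P = D ∧
            BijOn (sphericalImageAt P) (polyVertices P) (closure '' D) ∧
            BijOn (sphericalImageOfFace P) (facesOfDim 1 P) (subdivisionClosedEdges D) ∧
            BijOn (sphericalImageOfFace P) (facesOfDim 2 P)
              ((fun v => {v}) '' subdivisionVertices D) ∧
            shadowNumber P = 5)) := by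
  refine ⟨unboundedShadowNumber_isTheta, unboundedShadowNumber_le_five, fun n hn R hR φ => ?_⟩
  obtain ⟨m, rfl⟩ : ∃ m, n = m + 1 := ⟨n - 1, by omega⟩
  rw [Nat.add_sub_cancel]
  have hm : 5 ≤ m := by omega
  refine ⟨eventually_isThinRing hm hR, ?_⟩
  rintro r hr hrR hthin D P rfl rfl
  rw [tangentPolyhedron_eq hm hr hrR]
  exact ⟨cap_mem hm hr hrR, not_isBounded_cap m φ r R, sphericalImageSubdivision_cap hm hr hrR,
    bijOn_vertices hm hr hrR, bijOn_edges hm hr hrR, bijOn_facets hm hr hrR,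
    shadowNumber_cap hm hr hrR hthin⟩
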